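/- **Setting.** $(U,\rho)$ is a finite metric space with $n=|U|$ points, $\min_{u\ne v}\rho(u,v)=1$ and $\triangle=\max_{u,v}\rho(u,v)=2^L$ for an integer $L\ge 1$; $1\le k\le n$ and $\epsilon>0$. For a demand set $D\subseteq U$ and $F\subseteq U$ put $cost_k(F,D)=\sum_{v\in D}\min_{f\in F}\rho(v,f)$ and $OPT_k(D)=\min_{F\subseteq U,\,|F|=k}cost_k(F,D)$. A randomized algorithm $\mathbb A$ is $\epsilon$-differentially private (with respect to $D$) if $\Pr[\mathbb A(D)\in O]\le e^{\epsilon}\Pr[\mathbb A(D')\in O]$ for every set $O$ of outputs and all $D,D'\subseteq U$ whose symmetric difference has exactly one element. **2-HST.** The root, at level $L$, is the whole of $U$. Each cluster $S$ at level $h+1\in\{1,\dots,L\}$ with at least two points is split into its children at level $h$ by ball carving: in a fresh uniformly random order of the points, each $v\in S$ takes all points of $S$ within distance $\tfrac{\beta}{2}2^{h}$ of $v$ that have not been taken yet; the non-empty parts are the children. Here $\beta\in[1,2)$ is any fixed number. One-point clusters are leaves (at level $0$ all clusters are single points). **DP-HST initialization with privacy $\epsilon_0$.** For each node $v$ below the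 root, with level $h_v$ and cluster $T(v)$, let $\hat N_v=|T(v)\cap D|+Lap(2^{L-h_v}/\epsilon_0)$, with independent centred Laplace variables of the indicated scales, and $score(v)=\hat N_v2^{h_v}$. Starting from $C_1=\emptyset$, while $|C_1|<k$: add to $C_1$ the $k-|C_1|$ nodes of highest score among the nodes below the root that are neither in $C_1$ nor ancestors of elements of $C_1$; then remove from $C_1$ every node that has a descendant in $C_1$. Finally, from each $v\in C_1$ go down, always to the child $w$ with the largest $\hat N_w$, until a leaf is reached; the $k$ leaves (points of $U$) found in this way are the output. **DP-HST local search with $T$ iterations.** Let $F_1$ be the output of DP-HST initialization with privacy $\epsilon/2$, and $\epsilon'=\frac{\epsilon}{4\triangle(T+1)}$. For $i=1,\dots,T$ draw $(x,y)\in F_i\times(U\setminus F_i)$ with probability proportional to $\exp(-\epsilon'\,cost_k(F_i-\{x\}+\{y\},D))$ and let $F_{i+1}=F_i-\{x\}+\{y\}$ (if $k=n$ there is no swap and $F_{i+1}=F_i$). Then draw $j\in\{1,\dots,T+1\}$ with probability proportional to $\exp(-\epsilon'\,cost_k(F_j,D))$ and output $F_j$. **Theorem.** 1. For every $T\ge 0$,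 DP-HST local search with $T$ iterations is $\epsilon$-differentially private. 2. For every $c>0$ there are constants $A,B>0$, depending on $c$ only, such that, for all $U,\rho,L,\beta,k,\epsilon$ as above with $n\ge 3$ and every $D\subseteq U$, DP-HST local search with $T=\lceil A\,k\log\log n\rceil$ iterations outputs, with probability at least $1-n^{-c}$, a set $F$ of $k$ centers with $$cost_k(F,D)\le 6\,OPT_k(D)+B\,\epsilon^{-1}k^2\triangle(\log\log n)\log n .$$ -/

import Mathlib

namespace DPHST

noncomputable section

open scoped Classical ENNReal
open MeasureTheory

/-! ### Differential privacy and the two basic mechanisms -/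

/-- A randomized algorithm whose input is a finite data set is `ε`-differentially private if, for
any two data sets whose symmetric difference has exactly one element and any set `O` of outputs,
`Pr[M D ∈ O] ≤ exp ε * Pr[M D' ∈ O]`. -/
def IsDifferentiallyPrivate {U α : Type*} (ε : ℝ) (M : Finset U → PMF α) : Prop :=
  ∀ D D' : Finset U, (symmDiff D D').card = 1 →
    ∀ O : Set α, (M D).toOuterMeasure O ≤ ENNReal.ofReal (Real.exp ε) * (M D').toOuterMeasure O

/-- Density of the centred Laplace distribution of scale `b`. -/
def laplacePDF (b x : ℝ) : ℝ := Real.exp (-(|x| / b)) / (2 * b)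

/-- The centred Laplace distribution of scale `b`. -/
def laplace (b : ℝ) : Measure ℝ := volume.withDensity fun x => ENNReal.ofReal (laplacePDF b x)

theorem lintegral_laplacePDF {b : ℝ} (hb : 0 < b) :
    ∫⁻ x, ENNReal.ofReal (laplacePDF b x) = 1 := by
  have hI : ∫ x : ℝ, laplacePDF b x = 1 := by
    have h1 : ∫ x : ℝ, Real.exp (-(|x| / b)) = 2 * b := by
      have h := integral_comp_abs (f := fun x : ℝ => Real.exp (-(x / b)))
      rw [h]
      have h2 : ∀ x : ℝ, Real.exp (-(x / b)) = Real.exp ((-b⁻¹) * x) := by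
        intro x; congr 1; field_simp
      simp_rw [h2]
      rw [integral_exp_mul_Ioi (by simpa using hb)]
      simp
    unfold laplacePDF
    rw [integral_div, h1]
    exact div_self (by positivity)
  have hint : Integrable (laplacePDF b) := by
    by_contra hn
    rw [integral_undef hn] at hI
    exact zero_ne_one hI
  rw [← ofReal_integral_eq_lintegral_ofReal hint, hI, ENNReal.ofReal_one]
  exact Filter.Eventually.of_forall fun x => by unfold laplacePDF; positivity

theorem isProbabilityMeasure_laplace {b : ℝ} (hb : 0 < b) : IsProbabilityMeasure (laplace b) :=
  ⟨by rw [laplace, withDensity_apply _ MeasurableSet.univ, Measure.restrict_univ,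
    lintegral_laplacePDF hb]⟩

/-- The exponential mechanism: an element `a` of the nonempty set `s` of candidates is drawn with
probability proportional to `exp (-η * q a)`. -/
def expMechanism {α : Type*} [Fintype α] (s : Finset α) (hs : s.Nonempty) (η : ℝ) (q : α → ℝ) :
    PMF α :=
  PMF.normalize (fun a => if a ∈ s then ENNReal.ofReal (Real.exp (-(η * q a))) else 0)
    (by
      obtain ⟨a, ha⟩ := hs
      intro h
      have h' := ENNReal.tsum_eq_zero.1 h a
      simp only [ha, if_true, ENNReal.ofReal_eq_zero] at h'
      exact absurd (Real.exp_pos _) (not_lt.2 h'))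
    (by
      rw [tsum_fintype]
      refine ENNReal.sum_ne_top.2 fun a _ => ?_
      split_ifs
      · exact ENNReal.ofReal_ne_top
      · exact ENNReal.zero_ne_top)

/-! ### The `k`-median problem -/

section Metric

variable {U : Type*} [MetricSpace U] [Fintype U]

/-- `cost_k(F, D) = ∑_{v ∈ D} min_{f ∈ F} ρ(v, f)`. -/
def cost (F D : Finset U) : ℝ := ∑ v ∈ D, Metric.infDist v (F : Set U)

/-- `OPT_k(D)`: the least cost of `k` centers, which may lie anywhere in the universe. -/
def opt (k : ℕ) (D : Finset U) : ℝ := ⨅ F : {F : Finset U // F.card = k}, cost F.1 D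

/-! ### The 2-HST

The tree has its root, the whole universe, at level `L`, and levels `L - 1, …, 0` below it.
The depth of a node of level `h` is `L - h`. -/

/-- `c` is the center to which ball carving of the cluster `S` with radius `r` assigns `u`, when the
points of `S` open their balls in the order `σ`: the first point of `S` within distance `r`. -/
def IsCenterOf (σ : U ≃ Fin (Fintype.card U)) (r : ℝ) (S : Finset U) (c u : U) : Prop :=
  c ∈ S ∧ dist c u ≤ r ∧ ∀ c' ∈ S, dist c' u ≤ r → σ c ≤ σ c'

/-- The part containing `u` of the partition of the cluster `S` by ball carving. -/
def carve (σ : U ≃ Fin (Fintype.card U)) (r : ℝ) (S : Finset U) (u : U) : Finset U :=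
  S.filter fun w => ∃ c, IsCenterOf σ r S c u ∧ IsCenterOf σ r S c w

/-- The random orders that are used to build the tree, one for each depth and each cluster. -/
abbrev Orders (U : Type*) [Fintype U] (L : ℕ) : Type _ :=
  Fin L → Finset U → (U ≃ Fin (Fintype.card U))

instance (L : ℕ) : Nonempty (Orders U L) := ⟨fun _ _ => Fintype.equivFin U⟩

/-- The cluster of `u` at depth `t`. The whole universe has depth `0`; a cluster of depth `t` is
carved with radius `β * 2 ^ L / 2 ^ (t + 2)` into clusters of depth `t + 1`. -/
def cluster {L : ℕ} (β : ℝ) (π : Orders U L) : ℕ → U → Finset U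
  | 0, _ => Finset.univ
  | t + 1, u =>
    if ht : t < L then
      carve (π ⟨t, ht⟩ (cluster β π t u)) (β * 2 ^ L / 2 ^ (t + 2)) (cluster β π t u) u
    else cluster β π t u

/-- A potential node `(t, S)` of the tree below the root, of depth `t + 1`, hence of level
`L - 1 - t`, with cluster `S`. -/
abbrev Node (U : Type*) (L : ℕ) : Type _ := Fin L × Finset U

/-- The level `h_v`. -/
def level {L : ℕ} (v : Node U L) : ℕ := L - 1 - v.1

/-- The nodes of the tree below the root. A one-point cluster is not divided any further. -/
def nodes {L : ℕ} (β : ℝ) (π : Orders U L) : Finset (Node U L) :=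
  Finset.univ.filter fun v =>
    ∃ u, 1 < (cluster β π v.1 u).card ∧ v.2 = cluster β π (v.1 + 1) u

/-- `w` is a (proper) descendant of `v`. -/
def IsDescendant {L : ℕ} (w v : Node U L) : Prop := v.1 < w.1 ∧ w.2 ⊆ v.2

/-! ### DP-HST initialization -/

/-- Remove every node that has a descendant in the set. -/
def prune {L : ℕ} (C : Finset (Node U L)) : Finset (Node U L) :=
  C.filter fun v => ∀ w ∈ C, ¬ IsDescendant w v

/-- The `m` elements of `P` of highest score (if the scores are pairwise different). -/
def top {L : ℕ} (score : Node U L → ℝ) (m : ℕ) (P : Finset (Node U L)) : Finset (Node U L) :=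
  P.filter fun v => (P.filter fun w => score v < score w).card < m

/-- One round of the subtree search: add the `k - |C|` nodes of highest score to `C`, not
reselecting elements of `C` and their ancestors, and prune. -/
def searchRound {L : ℕ} (N : Finset (Node U L)) (score : Node U L → ℝ) (k : ℕ)
    (C : Finset (Node U L)) : Finset (Node U L) :=
  prune (C ∪ top score (k - C.card)
    (N.filter fun v => v ∉ C ∧ ∀ w ∈ C, ¬ IsDescendant w v))

/-- The subtree search, started from `∅`. A round does not change a set of `k` nodes produced by the
search, and each earlier round selects some node that was not selected before, so it is enough to
run as many rounds as there are potential nodes. -/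
def subtreeSearch {L : ℕ} (N : Finset (Node U L)) (score : Node U L → ℝ) (k : ℕ) :
    Finset (Node U L) :=
  (searchRound N score k)^[Fintype.card (Node U L)] ∅

/-- FIND-LEAF started from the node `v`: the points `u` of the cluster of `v` such that, on the path
from `v` to the leaf `u`, each node (other than `v`) has the largest count among its siblings.
If the counts are pairwise different then there is exactly one such point. -/
def findLeaf {L : ℕ} (β : ℝ) (π : Orders U L) (count : Node U L → ℝ) (v : Node U L) : Finset U :=
  v.2.filter fun u => ∀ t : Fin L, v.1 < t → ∀ w ∈ cluster β π t u,
    count (t, cluster β π (t + 1) w) ≤ count (t, cluster β π (t + 1) u)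

/-- The noisy counts `|D ∩ T(v)| + ω v`. -/
def noisyCount {L : ℕ} (D : Finset U) (ω : Node U L → ℝ) (v : Node U L) : ℝ :=
  ((D ∩ v.2).card : ℝ) + ω v

/-- The initial centers, as a function of the orders `π` and of the noise `ω`; the score of a node
is its noisy count times `2 ^ level`. -/
def hstCenters {L : ℕ} (β : ℝ) (k : ℕ) (D : Finset U) (π : Orders U L) (ω : Node U L → ℝ) :
    Finset U :=
  (subtreeSearch (nodes β π) (fun v => noisyCount D ω v * 2 ^ level v) k).biUnion
    (findLeaf β π (noisyCount D ω))

/-- Independent Laplace noise, of scale `2 ^ (L - h_v) / ε` at the node `v`. -/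
def noise (U : Type*) [Fintype U] (L : ℕ) (ε : ℝ) : Measure (Node U L → ℝ) :=
  Measure.pi fun v => laplace (2 ^ (v.1 + 1 : ℕ) / ε)

end Metric

/-! The initial centers are a measurable function of the noise. -/

section Measurability

variable {U : Type*}

/-- All events `{ω | f ω = a}` are measurable. -/
def MeasFibers {Ω α : Type*} [MeasurableSpace Ω] (f : Ω → α) : Prop :=
  ∀ a, MeasurableSet {ω | f ω = a}

theorem MeasFibers.comp₂ {Ω α β : Type*} [MeasurableSpace Ω] [Countable α]
    {c : Ω → α} {g : Ω → α → β} (hc : MeasFibers c) (hg : ∀ a, MeasFibers fun ω => g ω a) :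
    MeasFibers fun ω => g ω (c ω) := by
  intro b
  have : {ω | g ω (c ω) = b} = ⋃ a, {ω | c ω = a} ∩ {ω | g ω a = b} := by
    ext ω; simp
  rw [this]
  exact MeasurableSet.iUnion fun a => (hc a).inter (hg a b)

theorem measFibers_const {Ω α : Type*} [MeasurableSpace Ω] (a : α) :
    MeasFibers fun _ : Ω => a := fun b => MeasurableSet.const (a = b)

theorem measFibers_filter {Ω α : Type*} [MeasurableSpace Ω] (s : Finset α)
    (p : Ω → α → Prop) [∀ ω, DecidablePred (p ω)]
    (hp : ∀ a, MeasurableSet {ω | p ω a}) :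
    MeasFibers fun ω => s.filter (p ω) := by
  intro a
  have h : {ω | s.filter (p ω) = a} =
      {ω | (∀ x ∈ s, p ω x ↔ x ∈ a) ∧ ∀ x ∈ a, x ∈ s} := by
    ext ω
    simp only [Set.mem_ofPred_eq, Finset.ext_iff, Finset.mem_filter]
    constructor
    · intro h
      exact ⟨fun x hx => ⟨fun hpx => (h x).1 ⟨hx, hpx⟩, fun hxa => ((h x).2 hxa).2⟩,
        fun x hxa => ((h x).2 hxa).1⟩
    · rintro ⟨h1, h2⟩ x
      exact ⟨fun hx => (h1 x hx.1).1 hx.2, fun hxa => ⟨h2 x hxa, (h1 x (h2 x hxa)).2 hxa⟩⟩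
  have h0 : {ω | (∀ x ∈ s, p ω x ↔ x ∈ a) ∧ ∀ x ∈ a, x ∈ s} =
      {ω | ∀ x ∈ s, p ω x ↔ x ∈ a} ∩ {_ω | ∀ x ∈ a, x ∈ s} := by
    ext ω; simp
  rw [h, h0]
  refine MeasurableSet.inter ?_ (MeasurableSet.const _)
  have h3 : {ω | ∀ x ∈ s, p ω x ↔ x ∈ a} = ⋂ x ∈ s, {ω | p ω x ↔ x ∈ a} := by
    ext ω; simp
  rw [h3]
  refine Finset.measurableSet_biInter _ fun x _ => ?_
  by_cases hx : x ∈ a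
  · have h4 : {ω | p ω x ↔ x ∈ a} = {ω | p ω x} := by ext ω; simp [hx]
    rw [h4]; exact hp x
  · have h4 : {ω | p ω x ↔ x ∈ a} = {ω | p ω x}ᶜ := by ext ω; simp [hx]
    rw [h4]; exact (hp x).compl

theorem measurable_noisyCount {L : ℕ} (D : Finset U) (v : Node U L) :
    Measurable fun ω : Node U L → ℝ => noisyCount D ω v := by
  unfold noisyCount
  fun_prop

theorem measFibers_hstCenters [MetricSpace U] [Fintype U] {L : ℕ} (β : ℝ) (k : ℕ) (D : Finset U)
    (π : Orders U L) :
    MeasFibers (hstCenters β k D π) := by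
  have hfin : Finite (Node U L) := inferInstance
  have htop : ∀ (m : ℕ) (P : Finset (Node U L)), MeasFibers fun ω : Node U L → ℝ =>
      top (fun v => noisyCount D ω v * 2 ^ level v) m P := by
    intro m P
    refine measFibers_filter P (fun (ω : Node U L → ℝ) v => (P.filter fun w =>
      noisyCount D ω v * 2 ^ level v < noisyCount D ω w * 2 ^ level w).card < m) fun v => ?_
    have h := measFibers_filter (Ω := Node U L → ℝ) P
      (fun ω w => noisyCount D ω v * 2 ^ level v < noisyCount D ω w * 2 ^ level w)
      (fun w => measurableSet_lt ((measurable_noisyCount D v).mul_const _)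
        ((measurable_noisyCount D w).mul_const _))
    have h' := MeasFibers.comp₂ (g := fun (_ : Node U L → ℝ) (Q : Finset (Node U L)) => Q.card < m)
      h (fun Q => measFibers_const _) True
    convert h' using 3
    simp
  have hsub : MeasFibers fun ω : Node U L → ℝ =>
      subtreeSearch (nodes β π) (fun v => noisyCount D ω v * 2 ^ level v) k := by
    have : ∀ n : ℕ, MeasFibers fun ω : Node U L → ℝ =>
        (searchRound (nodes β π) (fun v => noisyCount D ω v * 2 ^ level v) k)^[n] ∅ := by
      intro n
      induction n with
      | zero => exact measFibers_const _
      | succ n ih =>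
        simp only [Function.iterate_succ_apply']
        refine MeasFibers.comp₂ (g := fun ω C => searchRound (nodes β π)
          (fun v => noisyCount D ω v * 2 ^ level v) k C) ih fun C => ?_
        exact MeasFibers.comp₂ (g := fun _ A => prune (C ∪ A)) (htop _ _)
          fun A => measFibers_const _
    exact this _
  have hleaf : ∀ v : Node U L, MeasFibers fun ω : Node U L → ℝ =>
      findLeaf β π (noisyCount D ω) v := by
    intro v
    refine measFibers_filter v.2 (fun ω u => ∀ t : Fin L, v.1 < t → ∀ w ∈ cluster β π t u,
      noisyCount D ω (t, cluster β π (t + 1) w) ≤ noisyCount D ω (t, cluster β π (t + 1) u))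
      fun u => ?_
    have h : {ω : Node U L → ℝ | ∀ t : Fin L, v.1 < t → ∀ w ∈ cluster β π t u,
        noisyCount D ω (t, cluster β π (t + 1) w) ≤ noisyCount D ω (t, cluster β π (t + 1) u)} =
        ⋂ (t : Fin L), ⋂ (_ : v.1 < t), ⋂ w, ⋂ (_ : w ∈ cluster β π t u),
        {ω | noisyCount D ω (t, cluster β π (t + 1) w) ≤
          noisyCount D ω (t, cluster β π (t + 1) u)} := by
      ext ω; simp
    rw [h]
    exact MeasurableSet.iInter fun t => MeasurableSet.iInter fun _ => MeasurableSet.iInter fun w =>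
      MeasurableSet.iInter fun _ =>
        measurableSet_le (measurable_noisyCount D _) (measurable_noisyCount D _)
  refine MeasFibers.comp₂ (g := fun ω C => Finset.biUnion C (findLeaf β π (noisyCount D ω)))
    hsub fun C => ?_
  induction C using Finset.induction_on with
  | empty => simpa using measFibers_const _
  | insert v C _ ih =>
    simp only [Finset.biUnion_insert]
    refine MeasFibers.comp₂ (g := fun ω A => A ∪ C.biUnion (findLeaf β π (noisyCount D ω)))
      (hleaf v) fun A => ?_
    exact MeasFibers.comp₂ (g := fun _ B => A ∪ B) ih fun B => measFibers_const _

theorem isProbabilityMeasure_noise [Fintype U] (L : ℕ) {ε : ℝ} (hε : 0 < ε) :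
    IsProbabilityMeasure (noise U L ε) := by
  have h : ∀ v : Node U L, IsProbabilityMeasure (laplace (2 ^ (v.1 + 1 : ℕ) / ε)) :=
    fun v => isProbabilityMeasure_laplace (by positivity)
  unfold noise
  infer_instance

theorem sum_measure_fibers {Ω α : Type*} [MeasurableSpace Ω] [Fintype α] (μ : Measure Ω)
    [IsProbabilityMeasure μ] {f : Ω → α} (hf : MeasFibers f) :
    ∑ a, μ {ω | f ω = a} = 1 := by
  rw [← tsum_fintype (L := .unconditional _), ← measure_iUnion _ hf]
  · have : (⋃ a, {ω | f ω = a}) = Set.univ := by ext; simp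
    rw [this, measure_univ]
  · intro a b hab
    exact Set.disjoint_left.2 fun ω h1 h2 => hab (h1.symm.trans h2)

end Measurability

/-! ### The algorithms -/

section Algorithms

variable {U : Type*} [MetricSpace U] [Fintype U]

/-- The law of the initial centers for fixed orders `π`, with privacy parameter `ε`. -/
def initGivenOrders {L : ℕ} (β : ℝ) (k : ℕ) {ε : ℝ} (hε : 0 < ε) (D : Finset U)
    (π : Orders U L) : PMF (Finset U) :=
  PMF.ofFintype (fun F => noise U L ε {ω | hstCenters β k D π ω = F})
    (haveI := isProbabilityMeasure_noise (U := U) L hε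
     sum_measure_fibers _ (measFibers_hstCenters β k D π))

/-- DP-HST initialization with privacy parameter `ε`: the law of its output. The orders are
uniformly distributed and independent. -/
def dpHstInit (L : ℕ) (β : ℝ) (k : ℕ) {ε : ℝ} (hε : 0 < ε) (D : Finset U) : PMF (Finset U) :=
  (PMF.uniformOfFintype (Orders U L)).bind (initGivenOrders β k hε D)

/-- The center set after the swap `F - x + y`. -/
def swap (F : Finset U) (p : U × U) : Finset U := insert p.2 (F.erase p.1)

/-- One private swap with parameter `η`: a pair in `F × (U \ F)` is drawn with probability
proportional to `exp (-η * cost (F - x + y))`. If there is no such pair then `F` is kept. -/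
def swapStep (η : ℝ) (D F : Finset U) : PMF (Finset U) :=
  if h : (F ×ˢ Fᶜ).Nonempty then
    (expMechanism (F ×ˢ Fᶜ) h η fun p => cost (swap F p) D).map (swap F)
  else PMF.pure F

/-- The law of the sequence of center sets that `T` successive private swaps produce from `F`. -/
def swapSequence (η : ℝ) (D F : Finset U) : (T : ℕ) → PMF (Fin (T + 1) → Finset U)
  | 0 => PMF.pure fun _ => F
  | T + 1 => (swapSequence η D F T).bind fun Fs =>
      (swapStep η D (Fs (Fin.last T))).map fun F' => Fin.snoc (α := fun _ => Finset U) Fs F'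

/-- The parameter `ε' = ε / (4 Δ (T + 1))`, where `Δ = 2 ^ L`. -/
def swapParameter (L T : ℕ) (ε : ℝ) : ℝ := ε / (4 * 2 ^ L * (T + 1))

/-- DP-HST local search with `T` iterations: the law of its output. -/
def dpHstLocalSearch (L : ℕ) (β : ℝ) (k T : ℕ) {ε : ℝ} (hε : 0 < ε) (D : Finset U) :
    PMF (Finset U) :=
  (dpHstInit L β k (half_pos hε) D).bind fun F₁ =>
    (swapSequence (swapParameter L T ε) D F₁ T).bind fun Fs =>
      (expMechanism Finset.univ Finset.univ_nonempty (swapParameter L T ε)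
        fun j : Fin (T + 1) => cost (Fs j) D).map Fs

end Algorithms

end

end DPHST

/-! Privacy is composition. Inserting a point p into D raises by one the count of exactly one
cluster per depth. Shifting the noise at these nodes undoes the change, and with scales 2^depth / ε₀
the density ratios multiply to at most exp ε₀ (`sum_shift_le`, `dpHstInit_apply_le`). The T swaps
and the final selection are T + 1 exponential mechanisms whose scores have sensitivity at most Δ.
Each costs 2 ε' Δ, together ε / 2.

For the utility, the initial centers matter only through their number, which is almost surely k
(`dpHstInit_card`). By a union bound all exponential draws are within e = O(log n / ε') of the best
candidate. The rest is deterministic: best-swap local search with errors at most e, started from any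
k centers, reaches 6 OPT + 12 k e within O(k log log n) steps (`SwapRun.exists_cost_le`). The
classical pairing of optimal centers with swaps (`exists_swaps`) makes each step gain a fraction 1 /
(6 k) of the cost while the goal is missed (`SwapRun.gain_ge`). Alone this would take k times the
logarithm of the initial ratio; two faster phases come before it.

Phase one. A swap is nearly as good as the addition of the best center, since some center can be
removed cheaply (`exists_removal`). So the run dominates a greedy addition with small slacks, and
`SlowGreedy.length_le` bounds the time during which such an addition stays expensive. Times are
grouped by the dyadic level j of the largest possible gain, and the number of steps is controlled by
the sum over j of (cost at the start of level j) / 2^j (`SlowGreedy.steps_le`). This sum is split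
over clients X and the centers serving them. If X is served at distance u and W clients lie within u
/ 16 of X, then u W = O(2^j), so one server contributes O(1 / W). It remains to bound the servers
with W in one bin [(3/2)^i, (3/2)^(i+1)). If the mass grows out of the bin within distance 4 u, the
distances are comparable and the sum is geometric (`SlowGreedy.static_sum_le`). Otherwise X is
isolated: greedy preferred its center to X and therefore gained beyond half the radius R of
isolation (`SlowGreedy.far_gain`). Charging to these far gains shows that the atypical pairs make up
a small part of the whole sum (`SlowGreedy.atypical_sum_le`). For typical pairs a normalized level
is at least squared from one server to the next, so O(log log n) of them count
(`SlowGreedy.typical_sum_le`).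

Phase two. Reference centers M that minimize cost + θ |M| are well separated and have heavy cells.
At a time of small gain almost all of the cost lies near M, and one step can serve the neighbourhood
of only one reference center. A potential argument (`SwapRun.gain_le`) makes later gains small, and
since gains are at least cost / (6 k), so is the cost. Thus 3 k steps bring the ratio from K Y² to K
Y (`SwapRun.round`), and O(log log n) rounds leave only a factor that the geometric decrease removes
in time. -/

namespace DPHST

noncomputable section

open scoped Classical ENNReal
open MeasureTheory

set_option linter.unusedSectionVars false

/-! ### Greedy addition of centers -/

section AddGreedy

variable {U : Type*} [MetricSpace U]

/-- The number of clients within distance `r` of `X`. -/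
def mass (D : Finset U) (X : U) (r : ℝ) : ℝ := ((D.filter fun Y => dist Y X ≤ r).card : ℝ)

/-- The decrease of the total connection cost `∑ S` when the center `z` is added. -/
def gain (D : Finset U) (S : U → ℝ) (z : U) : ℝ := ∑ Y ∈ D, max (S Y - dist Y z) 0

/-- The largest possible gain of an added center. -/
def maxGain (D : Finset U) (S : U → ℝ) : ℝ := ⨆ z, gain D S z

/-- The connection costs after the centers `y 0, …, y (t - 1)` have been added. -/
def added (S₀ : U → ℝ) (y : ℕ → U) : ℕ → U → ℝ
  | 0 => S₀
  | t + 1 => fun X => min (added S₀ y t X) (dist X (y t))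

variable {D : Finset U} {S₀ : U → ℝ} {y : ℕ → U}

theorem mass_mono (D : Finset U) (X : U) {r r' : ℝ} (h : r ≤ r') : mass D X r ≤ mass D X r' := by
  unfold mass
  exact_mod_cast Finset.card_le_card
    (Finset.monotone_filter_right D fun Y _ hY => le_trans hY h)

theorem one_le_mass {X : U} (hX : X ∈ D) {r : ℝ} (hr : 0 ≤ r) : 1 ≤ mass D X r := by
  unfold mass
  exact_mod_cast Finset.card_pos.2 ⟨X, Finset.mem_filter.2 ⟨hX, by simpa using hr⟩⟩

theorem mass_le_card (D : Finset U) (X : U) (r : ℝ) : mass D X r ≤ D.card := by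
  unfold mass
  exact_mod_cast Finset.card_le_card (Finset.filter_subset _ _)

theorem gain_nonneg (D : Finset U) (S : U → ℝ) (z : U) : 0 ≤ gain D S z :=
  Finset.sum_nonneg fun _ _ => le_max_right _ _

theorem gain_mono {S S' : U → ℝ} (h : ∀ X, S X ≤ S' X) (z : U) : gain D S z ≤ gain D S' z :=
  Finset.sum_le_sum fun Y _ => max_le_max (sub_le_sub_right (h Y) _) le_rfl

theorem gain_le_maxGain [Finite U] (D : Finset U) (S : U → ℝ) (z : U) :
    gain D S z ≤ maxGain D S :=
  le_ciSup (Set.finite_range _).bddAbove z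

theorem maxGain_mono [Finite U] {S S' : U → ℝ} (h : ∀ X, S X ≤ S' X) :
    maxGain D S ≤ maxGain D S' :=
  ciSup_mono (Set.finite_range _).bddAbove fun z => gain_mono h z

theorem added_nonneg (h : ∀ X, 0 ≤ S₀ X) (t : ℕ) (X : U) : 0 ≤ added S₀ y t X := by
  induction t with
  | zero => exact h X
  | succ t ih => exact le_min ih dist_nonneg

theorem added_lip (h : ∀ X Y, S₀ X ≤ S₀ Y + dist X Y) (t : ℕ) (X Y : U) :
    added S₀ y t X ≤ added S₀ y t Y + dist X Y := by
  induction t with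
  | zero => exact h X Y
  | succ t ih =>
    have h1 : added S₀ y (t + 1) X ≤ added S₀ y t X := min_le_left _ _
    have h2 : added S₀ y (t + 1) X ≤ dist X (y t) := min_le_right _ _
    have h3 := dist_triangle X Y (y t)
    rcases min_choice (added S₀ y t Y) (dist Y (y t)) with h | h
    · have : added S₀ y (t + 1) Y = added S₀ y t Y := h
      linarith
    · have : added S₀ y (t + 1) Y = dist Y (y t) := h
      linarith

theorem added_anti {t t' : ℕ} (h : t ≤ t') (X : U) : added S₀ y t' X ≤ added S₀ y t X := by
  induction h with
  | refl => exact le_rfl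
  | step _ ih => exact le_trans (min_le_left _ _) ih

theorem added_le_dist {τ a : ℕ} (h : τ < a) (X : U) : added S₀ y a X ≤ dist X (y τ) :=
  (added_anti (S₀ := S₀) (y := y) (Nat.succ_le_of_lt h) X).trans (min_le_right _ _)

theorem sum_added_succ (t : ℕ) :
    ∑ X ∈ D, added S₀ y (t + 1) X = ∑ X ∈ D, added S₀ y t X - gain D (added S₀ y t) (y t) := by
  unfold gain
  rw [← Finset.sum_sub_distrib]
  refine Finset.sum_congr rfl fun X _ => ?_
  show min _ _ = _
  rcases le_total (added S₀ y t X) (dist X (y t)) with h | h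
  · rw [min_eq_left h, max_eq_right (by linarith)]; ring
  · rw [min_eq_right h, max_eq_left (by linarith)]; ring

/-- Each client within `r` of `X` has connection cost at least `S X - r` by the Lipschitz property,
and a center at `X` would serve it at distance at most `r`. -/
theorem mass_mul_le_gain {S : U → ℝ} (hS : ∀ X Y, S X ≤ S Y + dist X Y) (X : U) (r : ℝ) :
    mass D X r * (S X - 2 * r) ≤ gain D S X := by
  unfold mass gain
  rw [← nsmul_eq_mul, ← Finset.sum_const]
  calc ∑ _ ∈ D.filter (fun Y => dist Y X ≤ r), (S X - 2 * r)
      ≤ ∑ Y ∈ D.filter (fun Y => dist Y X ≤ r), max (S Y - dist Y X) 0 := by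
        refine Finset.sum_le_sum fun Y hY => le_max_of_le_left ?_
        have h1 := (Finset.mem_filter.1 hY).2
        have h2 := hS X Y
        rw [dist_comm] at h2
        linarith
    _ ≤ _ := Finset.sum_le_sum_of_subset_of_nonneg (Finset.filter_subset _ _)
        fun _ _ _ => le_max_right _ _

theorem le_gain {S : U → ℝ} {X : U} (hX : X ∈ D) : S X ≤ gain D S X := by
  unfold gain
  have h := Finset.single_le_sum (f := fun Y => max (S Y - dist Y X) 0)
    (fun _ _ => le_max_right _ _) hX
  simp only [dist_self, sub_zero] at h
  exact (le_max_left _ _).trans h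

/-- The center `y τ` serves `X` at time `a`: it is the center that was added when the connection
cost of `X` dropped for the last time before `a`. -/
def IsCaptor (S₀ : U → ℝ) (y : ℕ → U) (τ a : ℕ) (X : U) : Prop :=
  τ < a ∧ added S₀ y a X = dist X (y τ) ∧ dist X (y τ) < added S₀ y τ X

theorem exists_isCaptor {a : ℕ} {X : U} (h : added S₀ y a X ≠ S₀ X) :
    ∃ τ, IsCaptor S₀ y τ a X := by
  induction a with
  | zero => exact absurd rfl h
  | succ a ih =>
    by_cases h1 : dist X (y a) < added S₀ y a X
    · exact ⟨a, Nat.lt_succ_self a, min_eq_right h1.le, h1⟩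
    · have h2 : added S₀ y (a + 1) X = added S₀ y a X := min_eq_left (not_lt.1 h1)
      obtain ⟨τ, h3, h4, h5⟩ := ih (by rwa [h2] at h)
      exact ⟨τ, h3.trans (Nat.lt_succ_self a), by rw [h2, h4], h5⟩

/-- The periods in which different centers serve `X` do not overlap: a later captor must come
strictly closer to `X`, which ends the service by the earlier one. -/
theorem IsCaptor.lt_of_ne {τ τ' a a' : ℕ} {X : U} (h : IsCaptor S₀ y τ a X)
    (h' : IsCaptor S₀ y τ' a' X) (hlt : τ < τ') : a ≤ τ' := by
  by_contra hcon
  push Not at hcon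
  have h1 : added S₀ y τ' X ≤ dist X (y τ) := added_le_dist hlt X
  have h2 : added S₀ y a X ≤ dist X (y τ') := added_le_dist hcon X
  have h3 := h'.2.2
  rw [h.2.1] at h2
  linarith

theorem IsCaptor.unique {τ τ' a : ℕ} {X : U} (h : IsCaptor S₀ y τ a X)
    (h' : IsCaptor S₀ y τ' a X) : τ = τ' := by
  rcases lt_trichotomy τ τ' with hlt | heq | hlt
  · exact absurd (h.lt_of_ne h' hlt) (not_le.2 h'.1)
  · exact heq
  · exact absurd (h'.lt_of_ne h hlt) (not_le.2 h.1)

/-- A sum of distinct integral powers of `1 / 2` is at most twice the largest one. -/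
theorem sum_two_zpow_neg_le {ι : Type*} (s : Finset ι) (f : ι → ℤ) (hf : Set.InjOn f s) (m : ℤ)
    (hm : ∀ i ∈ s, m ≤ f i) : ∑ i ∈ s, ((2 : ℝ) ^ f i)⁻¹ ≤ 2 * ((2 : ℝ) ^ m)⁻¹ := by
  have h1 : ∀ i ∈ s, ((2 : ℝ) ^ f i)⁻¹ = ((2 : ℝ) ^ m)⁻¹ * (1 / 2) ^ (f i - m).toNat := by
    intro i hi
    have h2 : f i = m + ((f i - m).toNat : ℤ) := by have := hm i hi; omega
    conv_lhs => rw [h2, zpow_add₀ (by norm_num), zpow_natCast, mul_inv]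
    rw [one_div, inv_pow]
  have hinj : Set.InjOn (fun i => (f i - m).toNat) s := by
    intro i hi j hj hij
    have h3 := hm i hi
    have h4 := hm j hj
    refine hf hi hj ?_
    simp only at hij
    omega
  rw [Finset.sum_congr rfl h1, ← Finset.mul_sum, mul_comm]
  refine mul_le_mul_of_nonneg_right ?_ (by positivity)
  rw [← Finset.sum_image (s := s) (g := fun i => (f i - m).toNat) (f := fun k => (1 / 2 : ℝ) ^ k)
    hinj]
  exact (summable_geometric_two.sum_le_tsum _ fun _ _ => by positivity).trans_eq tsum_geometric_two

end AddGreedy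

/-! ### Slow greedy addition: gain levels, number of steps, regular pairs. -/

section SlowGreedy

variable {U : Type*} [MetricSpace U] [Fintype U]

/-- Greedy addition of the centers `y 0, …, y (T - 1)`, where `y t` has the largest gain up to
`s t`, which ends with a cost that is large compared with `A + H`. Here `h X` is a lower bound for
the number of clients within distance `ρ X` of the client `X`. -/
structure SlowGreedy (D : Finset U) (S₀ : U → ℝ) (y : ℕ → U) (s : ℕ → ℝ) (h ρ : U → ℝ) (T n : ℕ)
    (κ A H : ℝ) : Prop where
  nonneg : ∀ X, 0 ≤ S₀ X
  lip : ∀ X Y, S₀ X ≤ S₀ Y + dist X Y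
  slack_nonneg : ∀ t, 0 ≤ s t
  sum_slack : ∑ t ∈ Finset.range T, s t ≤ H
  slack : ∀ t < T, ∀ z, gain D (added S₀ y t) z ≤ gain D (added S₀ y t) (y t) + s t
  card_le : D.card ≤ n
  h_pos : ∀ X ∈ D, 0 < h X
  ρ_nonneg : ∀ X ∈ D, 0 ≤ ρ X
  h_le : ∀ X ∈ D, h X ≤ mass D X (ρ X)
  sum_h : ∑ X ∈ D, (h X)⁻¹ ≤ κ
  sum_ρ : ∑ X ∈ D, ρ X ≤ A
  large : 256 * (A + H) < ∑ X ∈ D, added S₀ y T X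

/-- The exponent of the power of `3 / 2` that is closest to `W` from below. -/
def bin (W : ℝ) : ℕ := ⌊Real.logb (3 / 2) W⌋₊

theorem pow_bin_le {W : ℝ} (hW : 1 ≤ W) : (3 / 2 : ℝ) ^ bin W ≤ W := by
  have h := Nat.floor_le (Real.logb_nonneg (b := 3 / 2) (by norm_num) hW)
  rwa [Real.le_logb_iff_rpow_le (by norm_num) (by linarith), Real.rpow_natCast] at h

theorem lt_pow_bin {W : ℝ} (hW : 1 ≤ W) : W < (3 / 2 : ℝ) ^ (bin W + 1) := by
  have h := Nat.lt_floor_add_one (Real.logb (3 / 2) W)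
  rw [Real.logb_lt_iff_lt_rpow (by norm_num) (by linarith)] at h
  exact_mod_cast h

theorem pow_bin_succ_le {W : ℝ} (hW : 1 ≤ W) : (3 / 2 : ℝ) ^ (bin W + 1) ≤ 3 / 2 * W := by
  rw [pow_succ']
  linarith [pow_bin_le hW]

/-- The mass of the balls around `X` hardly grows from radius `u / 16` to radius `4 * u`. -/
def IsIsolated (D : Finset U) (X : U) (u : ℝ) : Prop :=
  mass D X (4 * u) < (3 / 2) ^ (bin (mass D X (u / 16)) + 1)

/-- The clients served by a common center in an isolated way are few. -/
theorem exists_card_le_mass {D K : Finset U} (hK : K ⊆ D) (hne : K.Nonempty) (f : U)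
    (hiso : ∀ X ∈ K, IsIsolated D X (dist X f)) :
    ∃ X ∈ K, (∀ Y ∈ K, dist Y f ≤ dist X f) ∧
      (K.card : ℝ) ≤ 3 / 2 * mass D X (dist X f / 16) := by
  obtain ⟨X, hX, hmax⟩ := K.exists_max_image (fun X => dist X f) hne
  refine ⟨X, hX, hmax, ?_⟩
  have h1 : (K.card : ℝ) ≤ mass D X (4 * dist X f) := by
    unfold mass
    refine mod_cast Finset.card_le_card fun Y hY => Finset.mem_filter.2 ⟨hK hY, ?_⟩
    have h2 := dist_triangle_right Y X f
    have h3 := hmax Y hY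
    have h4 : 0 ≤ dist X f := dist_nonneg
    linarith
  exact h1.trans ((hiso X hX).le.trans
    (pow_bin_succ_le (one_le_mass (hK hX) (by have : 0 ≤ dist X f := dist_nonneg; linarith))))

namespace SlowGreedy

variable {D : Finset U} {S₀ : U → ℝ} {y : ℕ → U} {s : ℕ → ℝ} {h ρ : U → ℝ} {T n : ℕ} {κ A H : ℝ}

/-- The radius of a sixteenth of the connection cost costs only a factor 7/8 in `mass_mul_le_gain`.
The same radius reappears in `coreMass`. -/
theorem mass_mul_le (G : SlowGreedy D S₀ y s h ρ T n κ A H) (t : ℕ) (X : U) :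
    mass D X (added S₀ y t X / 16) * added S₀ y t X ≤ 8 / 7 * maxGain D (added S₀ y t) := by
  have h1 := mass_mul_le_gain (D := D) (S := added S₀ y t) (added_lip G.lip t) X
    (added S₀ y t X / 16)
  have h2 := gain_le_maxGain D (added S₀ y t) X
  linarith

theorem h_le_mass (G : SlowGreedy D S₀ y s h ρ T n κ A H) {X : U} (hX : X ∈ D) {r : ℝ}
    (hr : ρ X ≤ r) : h X ≤ mass D X r :=
  (G.h_le X hX).trans (mass_mono D X hr)

theorem le_add_maxGain (G : SlowGreedy D S₀ y s h ρ T n κ A H) (t : ℕ) {X : U} (hX : X ∈ D) :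
    added S₀ y t X ≤ 16 * ρ X + 8 / 7 * maxGain D (added S₀ y t) * (h X)⁻¹ := by
  have h0 : 0 ≤ added S₀ y t X := added_nonneg G.nonneg t X
  have hh := G.h_pos X hX
  have hM : 0 ≤ maxGain D (added S₀ y t) := (gain_nonneg _ _ X).trans (gain_le_maxGain _ _ X)
  by_cases hc : 16 * ρ X ≤ added S₀ y t X
  · have h1 := G.mass_mul_le t X
    have h2 := G.h_le_mass hX (r := added S₀ y t X / 16) (by linarith)
    have h3 : h X * added S₀ y t X ≤ 8 / 7 * maxGain D (added S₀ y t) :=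
      (mul_le_mul_of_nonneg_right h2 h0).trans h1
    have h4 : added S₀ y t X ≤ 8 / 7 * maxGain D (added S₀ y t) * (h X)⁻¹ := by
      rw [← div_eq_mul_inv, le_div_iff₀ hh]
      linarith
    linarith [G.ρ_nonneg X hX]
  · have : 0 ≤ 8 / 7 * maxGain D (added S₀ y t) * (h X)⁻¹ := by positivity
    linarith

theorem A_nonneg (G : SlowGreedy D S₀ y s h ρ T n κ A H) : 0 ≤ A :=
  (Finset.sum_nonneg G.ρ_nonneg).trans G.sum_ρ

theorem H_nonneg (G : SlowGreedy D S₀ y s h ρ T n κ A H) : 0 ≤ H :=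
  (Finset.sum_nonneg fun t _ => G.slack_nonneg t).trans G.sum_slack

theorem lt_cost (G : SlowGreedy D S₀ y s h ρ T n κ A H) {t : ℕ} (ht : t ≤ T) :
    256 * (A + H) < ∑ X ∈ D, added S₀ y t X :=
  G.large.trans_le (Finset.sum_le_sum fun X _ => added_anti ht X)

theorem nonempty (G : SlowGreedy D S₀ y s h ρ T n κ A H) : D.Nonempty := by
  by_contra hD
  have h1 := G.large
  rw [Finset.not_nonempty_iff_eq_empty.1 hD, Finset.sum_empty] at h1
  linarith [G.A_nonneg, G.H_nonneg]

theorem κ_pos (G : SlowGreedy D S₀ y s h ρ T n κ A H) : 0 < κ :=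
  (Finset.sum_pos (fun X hX => inv_pos.2 (G.h_pos X hX)) G.nonempty).trans_le G.sum_h

theorem n_pos (G : SlowGreedy D S₀ y s h ρ T n κ A H) : 0 < n :=
  (Finset.card_pos.2 G.nonempty).trans_le G.card_le

/-- Some center gains a fraction 1 / (2 κ) of the cost: summing `le_add_maxGain` leaves the error 16
A, which is below C / 16 because the cost C exceeds 256 (A + H). -/
theorem cost_le (G : SlowGreedy D S₀ y s h ρ T n κ A H) {t : ℕ} (ht : t ≤ T) :
    ∑ X ∈ D, added S₀ y t X ≤ 2 * κ * maxGain D (added S₀ y t) := by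
  have h1 : ∑ X ∈ D, added S₀ y t X ≤
      ∑ X ∈ D, (16 * ρ X + 8 / 7 * maxGain D (added S₀ y t) * (h X)⁻¹) :=
    Finset.sum_le_sum fun X hX => G.le_add_maxGain t hX
  rw [Finset.sum_add_distrib, ← Finset.mul_sum, ← Finset.mul_sum] at h1
  have hM : 0 ≤ maxGain D (added S₀ y t) := by
    obtain ⟨X, -⟩ := G.nonempty
    exact (gain_nonneg _ _ X).trans (gain_le_maxGain _ _ X)
  have h2 : 8 / 7 * maxGain D (added S₀ y t) * ∑ X ∈ D, (h X)⁻¹ ≤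
      8 / 7 * maxGain D (added S₀ y t) * κ :=
    mul_le_mul_of_nonneg_left G.sum_h (by positivity)
  have h3 := G.sum_ρ
  have h4 := G.lt_cost ht
  have h5 := G.H_nonneg
  have h6 : 0 ≤ maxGain D (added S₀ y t) * κ := mul_nonneg hM G.κ_pos.le
  nlinarith

theorem cost_pos (G : SlowGreedy D S₀ y s h ρ T n κ A H) {t : ℕ} (ht : t ≤ T) :
    0 < ∑ X ∈ D, added S₀ y t X := by
  have := G.lt_cost ht
  linarith [G.A_nonneg, G.H_nonneg]

theorem maxGain_pos (G : SlowGreedy D S₀ y s h ρ T n κ A H) {t : ℕ} (ht : t ≤ T) :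
    0 < maxGain D (added S₀ y t) := by
  by_contra hcon
  push Not at hcon
  have h1 := G.cost_le ht
  have h2 := G.cost_pos ht
  have h3 : 0 ≤ 2 * κ := by linarith [G.κ_pos]
  nlinarith [mul_nonneg h3 (neg_nonneg.2 hcon)]

end SlowGreedy

/-- The level of the time `t`: the dyadic logarithm of the largest possible gain. -/
def lev (D : Finset U) (S₀ : U → ℝ) (y : ℕ → U) (t : ℕ) : ℤ := Int.log 2 (maxGain D (added S₀ y t))

/-- The levels of the times before `T`. -/
def levels (D : Finset U) (S₀ : U → ℝ) (y : ℕ → U) (T : ℕ) : Finset ℤ :=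
  (Finset.range T).image (lev D S₀ y)

/-- The first time of level `j`. -/
def start (D : Finset U) (S₀ : U → ℝ) (y : ℕ → U) (j : ℤ) : ℕ :=
  if h : ∃ t, lev D S₀ y t = j then Nat.find h else 0

variable {D : Finset U} {S₀ : U → ℝ} {y : ℕ → U} {T : ℕ}

theorem start_lev_le (t : ℕ) : start D S₀ y (lev D S₀ y t) ≤ t := by
  have h : ∃ t', lev D S₀ y t' = lev D S₀ y t := ⟨t, rfl⟩
  rw [start, dif_pos h]
  exact Nat.find_min' h rfl

theorem lev_mem_levels {t : ℕ} (ht : t < T) : lev D S₀ y t ∈ levels D S₀ y T :=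
  Finset.mem_image_of_mem _ (Finset.mem_range.2 ht)

theorem start_spec {j : ℤ} (hj : j ∈ levels D S₀ y T) :
    start D S₀ y j < T ∧ lev D S₀ y (start D S₀ y j) = j := by
  obtain ⟨t, ht, rfl⟩ := Finset.mem_image.1 hj
  refine ⟨(start_lev_le t).trans_lt (Finset.mem_range.1 ht), ?_⟩
  have h : ∃ t', lev D S₀ y t' = lev D S₀ y t := ⟨t, rfl⟩
  rw [start, dif_pos h]
  exact Nat.find_spec h

namespace SlowGreedy

variable {s : ℕ → ℝ} {h ρ : U → ℝ} {n : ℕ} {κ A H : ℝ}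

theorem zpow_lev_le (G : SlowGreedy D S₀ y s h ρ T n κ A H) {t : ℕ} (ht : t ≤ T) :
    (2 : ℝ) ^ lev D S₀ y t ≤ maxGain D (added S₀ y t) :=
  Int.zpow_log_le_self (b := 2) (by norm_num) (G.maxGain_pos ht)

theorem lt_zpow_lev (_ : SlowGreedy D S₀ y s h ρ T n κ A H) (t : ℕ) :
    maxGain D (added S₀ y t) < 2 * (2 : ℝ) ^ lev D S₀ y t := by
  have := Int.lt_zpow_succ_log_self (b := 2) (by norm_num) (maxGain D (added S₀ y t))
  rw [zpow_add_one₀ (by norm_num)] at this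
  rw [mul_comm]
  exact_mod_cast this

theorem lev_anti (G : SlowGreedy D S₀ y s h ρ T n κ A H) {t t' : ℕ} (h : t ≤ t') (ht : t' ≤ T) :
    lev D S₀ y t' ≤ lev D S₀ y t :=
  Int.log_mono_right (G.maxGain_pos ht) (maxGain_mono fun X => added_anti h X)

theorem sum_gain_le (G : SlowGreedy D S₀ y s h ρ T n κ A H) (a b : ℕ) :
    ∑ t ∈ Finset.Ico a b, gain D (added S₀ y t) (y t) ≤ ∑ X ∈ D, added S₀ y a X := by
  rcases le_total a b with hab | hab
  · have h1 : ∑ t ∈ Finset.Ico a b, gain D (added S₀ y t) (y t) =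
        ∑ X ∈ D, added S₀ y a X - ∑ X ∈ D, added S₀ y b X := by
      induction b, hab using Nat.le_induction with
      | base => simp
      | succ b hab ih =>
        rw [Finset.sum_Ico_succ_top hab, ih, sum_added_succ]
        ring
    rw [h1]
    linarith [Finset.sum_nonneg fun X (_ : X ∈ D) => added_nonneg (y := y) G.nonneg b X]
  · rw [Finset.Ico_eq_empty_of_le hab, Finset.sum_empty]
    exact Finset.sum_nonneg fun X _ => added_nonneg G.nonneg a X

/-- A step whose slack is at most half the largest gain gains at least 2^j / 2 at level j, and the
gains from the start of the level on add up to at most the cost there. The other steps are few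
because of the total slack. -/
theorem steps_le (G : SlowGreedy D S₀ y s h ρ T n κ A H) :
    (T : ℝ) ≤ κ + 2 * ∑ j ∈ levels D S₀ y T,
      (∑ X ∈ D, added S₀ y (start D S₀ y j) X) * ((2 : ℝ) ^ j)⁻¹ := by
  set M : ℕ → ℝ := fun t => maxGain D (added S₀ y t) with hM
  set bad := (Finset.range T).filter fun t => M t < 2 * s t with hbad
  set good := (Finset.range T).filter fun t => ¬ M t < 2 * s t with hgood
  have hcard : (T : ℝ) = bad.card + good.card := by
    rw [hbad, hgood, ← Nat.cast_add, Finset.card_filter_add_card_filter_not, Finset.card_range]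
  have hκ := G.κ_pos
  have h1 : (bad.card : ℝ) ≤ κ := by
    -- A bad step has slack at least CT / (4 κ) by `cost_le`. The slacks sum to at most H < CT /
    -- 256, so there are fewer than κ bad steps.
    set CT := ∑ X ∈ D, added S₀ y T X with hCT
    have hpos : 0 < CT := G.cost_pos le_rfl
    have h2 : (bad.card : ℝ) * (CT / (4 * κ)) ≤ H := by
      rw [← nsmul_eq_mul, ← Finset.sum_const]
      refine le_trans (Finset.sum_le_sum fun t ht => ?_)
        (le_trans (Finset.sum_le_sum_of_subset_of_nonneg (Finset.filter_subset _ _)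
          fun t _ _ => G.slack_nonneg t) G.sum_slack)
      obtain ⟨ht1, ht2⟩ := Finset.mem_filter.1 ht
      have ht3 : t ≤ T := (Finset.mem_range.1 ht1).le
      have h3 := G.cost_le ht3
      have h4 : CT ≤ ∑ X ∈ D, added S₀ y t X := Finset.sum_le_sum fun X _ => added_anti ht3 X
      rw [div_le_iff₀ (by positivity)]
      have h5 : 2 * κ * M t ≤ 2 * κ * (2 * s t) :=
        mul_le_mul_of_nonneg_left ht2.le (by positivity)
      simp only [hM] at h5
      linarith
    have h3 := G.large
    rw [← hCT] at h3
    have h4 : (bad.card : ℝ) * (CT / (4 * κ)) < CT / 256 := by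
      linarith [G.A_nonneg]
    have h5 : (bad.card : ℝ) * CT < κ * CT := by
      have h6 : (bad.card : ℝ) * (CT / (4 * κ)) * (4 * κ) = bad.card * CT := by
        field_simp
      have h7 := mul_lt_mul_of_pos_right h4 (show 0 < 4 * κ by positivity)
      rw [h6] at h7
      nlinarith [mul_pos hκ hpos]
    exact (lt_of_mul_lt_mul_right h5 hpos.le).le
  have h2 : (good.card : ℝ) ≤ 2 * ∑ j ∈ levels D S₀ y T,
      (∑ X ∈ D, added S₀ y (start D S₀ y j) X) * ((2 : ℝ) ^ j)⁻¹ := by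
    have hmaps : ∀ t ∈ good, lev D S₀ y t ∈ levels D S₀ y T := fun t ht =>
      lev_mem_levels (Finset.mem_range.1 (Finset.mem_filter.1 ht).1)
    rw [Finset.card_eq_sum_card_fiberwise hmaps, Nat.cast_sum, Finset.mul_sum]
    refine Finset.sum_le_sum fun j _ => ?_
    rw [← mul_assoc, ← div_eq_mul_inv, le_div_iff₀ (by positivity)]
    have h3 : ((good.filter fun t => lev D S₀ y t = j).card : ℝ) * ((2 : ℝ) ^ j / 2) ≤
        ∑ X ∈ D, added S₀ y (start D S₀ y j) X := by
      rw [← nsmul_eq_mul, ← Finset.sum_const]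
      refine le_trans (Finset.sum_le_sum (g := fun t => gain D (added S₀ y t) (y t))
        fun t ht => ?_)
        (le_trans (Finset.sum_le_sum_of_subset_of_nonneg (fun t ht => ?_)
          fun t _ _ => gain_nonneg _ _ _) (G.sum_gain_le (start D S₀ y j) T))
      · obtain ⟨ht1, ht2⟩ := Finset.mem_filter.1 ht
        obtain ⟨ht3, ht4⟩ := Finset.mem_filter.1 ht1
        have ht5 := Finset.mem_range.1 ht3
        have h6 := G.zpow_lev_le ht5.le
        rw [ht2] at h6
        have h7 : M t ≤ gain D (added S₀ y t) (y t) + s t :=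
          haveI : Nonempty U := ⟨y 0⟩
          ciSup_le fun z => G.slack t ht5 z
        simp only [hM] at h7 ht4
        linarith
      · obtain ⟨ht1, ht2⟩ := Finset.mem_filter.1 ht
        obtain ⟨ht3, -⟩ := Finset.mem_filter.1 ht1
        refine Finset.mem_Ico.2 ⟨?_, Finset.mem_range.1 ht3⟩
        rw [← ht2]
        exact start_lev_le t
    linarith
  rw [hcard]
  linarith

/-- The pair `(j, X)` is regular: at the start of level `j`, the connection cost of `X` is not
small, and `X` is not served by a center that was added because of a large slack. -/
def Regular (D : Finset U) (S₀ : U → ℝ) (y : ℕ → U) (s : ℕ → ℝ) (ρ : U → ℝ) (n : ℕ) (a : ℕ)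
    (X : U) : Prop :=
  16 * ρ X ≤ added S₀ y a X ∧ (∑ Y ∈ D, added S₀ y a Y) / (16 * n) ≤ added S₀ y a X ∧
    ∀ τ, IsCaptor S₀ y τ a X → IsIsolated D X (dist X (y τ)) →
      64 * s τ ≤ dist X (y τ) * mass D X (dist X (y τ) / 16)

/-- The three ways to fail regularity cost at most 16 A, C / 16 and 96 H. For the last one, all
clients served by `y τ` in an isolated way with small product of distance and core mass are counted
by `exists_card_le_mass` at the farthest of them, which bounds their cost by 3/2 · 64 s τ. -/
theorem sum_not_regular_le (G : SlowGreedy D S₀ y s h ρ T n κ A H) {a : ℕ} (ha : a ≤ T) :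
    ∑ X ∈ D.filter (fun X => ¬ Regular D S₀ y s ρ n a X), added S₀ y a X ≤
      (∑ X ∈ D, added S₀ y a X) / 2 := by
  set C := ∑ X ∈ D, added S₀ y a X with hC
  set K : ℕ → Finset U := fun τ => D.filter fun X => IsCaptor S₀ y τ a X ∧
    IsIsolated D X (dist X (y τ)) ∧
    dist X (y τ) * mass D X (dist X (y τ) / 16) < 64 * s τ with hK
  have hn : (0 : ℝ) < n := by exact_mod_cast G.n_pos
  have hC0 : 0 < C := G.cost_pos ha
  have h0 : ∀ X, 0 ≤ added S₀ y a X := added_nonneg G.nonneg a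
  have hKsum : ∀ τ, ∑ X ∈ K τ, added S₀ y a X ≤ 96 * s τ := by
    intro τ
    rcases (K τ).eq_empty_or_nonempty with he | hne
    · rw [he, Finset.sum_empty]
      linarith [G.slack_nonneg τ]
    · obtain ⟨X, hX, hmax, hcard⟩ := exists_card_le_mass (Finset.filter_subset _ _) hne (y τ)
        fun X hX => (Finset.mem_filter.1 hX).2.2.1
      have h1 : ∑ Y ∈ K τ, added S₀ y a Y ≤ (K τ).card * dist X (y τ) := by
        rw [← nsmul_eq_mul, ← Finset.sum_const]
        refine Finset.sum_le_sum fun Y hY => ?_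
        rw [(Finset.mem_filter.1 hY).2.1.2.1]
        exact hmax Y hY
      have h2 := mul_le_mul_of_nonneg_right hcard (dist_nonneg (x := X) (y := y τ))
      have h3 := (Finset.mem_filter.1 hX).2.2.2
      linarith
  have hpt : ∀ X ∈ D.filter (fun X => ¬ Regular D S₀ y s ρ n a X), added S₀ y a X ≤
      16 * ρ X + C / (16 * n) + ∑ τ ∈ Finset.range a, if X ∈ K τ then added S₀ y a X else 0 := by
    intro X hX
    obtain ⟨hXD, hreg⟩ := Finset.mem_filter.1 hX
    have hρ := G.ρ_nonneg X hXD
    have hCn : 0 ≤ C / (16 * n) := by positivity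
    have hs : 0 ≤ ∑ τ ∈ Finset.range a, if X ∈ K τ then added S₀ y a X else 0 :=
      Finset.sum_nonneg fun τ _ => by split_ifs; exacts [h0 X, le_rfl]
    by_cases h1 : 16 * ρ X ≤ added S₀ y a X
    · by_cases h2 : C / (16 * n) ≤ added S₀ y a X
      · have h3 : ∃ τ, IsCaptor S₀ y τ a X ∧ IsIsolated D X (dist X (y τ)) ∧
            dist X (y τ) * mass D X (dist X (y τ) / 16) < 64 * s τ := by
          by_contra hcon
          push Not at hcon
          exact hreg ⟨h1, h2, hcon⟩
        obtain ⟨τ, hτ⟩ := h3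
        have h4 : X ∈ K τ := Finset.mem_filter.2 ⟨hXD, hτ⟩
        have h5 := Finset.single_le_sum
          (f := fun τ => if X ∈ K τ then added S₀ y a X else 0) (s := Finset.range a)
          (fun τ _ => by split_ifs; exacts [h0 X, le_rfl]) (Finset.mem_range.2 hτ.1.1)
        simp only [h4, if_true] at h5
        linarith
      · linarith
    · linarith
  have hsum := (Finset.sum_le_sum hpt).trans (Finset.sum_le_sum_of_subset_of_nonneg
    (Finset.filter_subset _ _) fun X hXD _ => by
      have hρ := G.ρ_nonneg X hXD
      have hCn : 0 ≤ C / (16 * n) := by positivity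
      have hs : 0 ≤ ∑ τ ∈ Finset.range a, if X ∈ K τ then added S₀ y a X else 0 :=
        Finset.sum_nonneg fun τ _ => by split_ifs; exacts [h0 X, le_rfl]
      linarith)
  rw [Finset.sum_add_distrib, Finset.sum_add_distrib, ← Finset.mul_sum, Finset.sum_const,
    nsmul_eq_mul, Finset.sum_comm] at hsum
  have h1 : (D.card : ℝ) * (C / (16 * n)) ≤ C / 16 := by
    have h2 : (D.card : ℝ) ≤ n := by exact_mod_cast G.card_le
    calc (D.card : ℝ) * (C / (16 * n)) ≤ n * (C / (16 * n)) :=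
          mul_le_mul_of_nonneg_right h2 (by positivity)
      _ = C / 16 := by field_simp
  have h2 : ∑ τ ∈ Finset.range a, ∑ X ∈ D, (if X ∈ K τ then added S₀ y a X else 0) ≤ 96 * H := by
    have h3 : ∀ τ ∈ Finset.range a, ∑ X ∈ D, (if X ∈ K τ then added S₀ y a X else 0) ≤
        96 * s τ := by
      intro τ _
      rw [← Finset.sum_filter]
      refine le_trans (le_of_eq (Finset.sum_congr ?_ fun _ _ => rfl)) (hKsum τ)
      ext X
      simp [hK]
    refine (Finset.sum_le_sum h3).trans ?_
    rw [← Finset.mul_sum]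
    refine mul_le_mul_of_nonneg_left (le_trans ?_ G.sum_slack) (by norm_num)
    exact Finset.sum_le_sum_of_subset_of_nonneg
      (Finset.range_subset_range.2 ha) fun t _ _ => G.slack_nonneg t
  have h3 := G.sum_ρ
  have h4 := G.lt_cost ha
  have h5 := G.A_nonneg
  have h6 := G.H_nonneg
  rw [← hC] at h4
  linarith

end SlowGreedy

end SlowGreedy

/-- A discrete version of ∫ dx / x. As each drop is at least δ, adding δ to the denominator at most
doubles it; each term is then bounded by twice an increment of log (δ + z a - z t), and these
increments telescope. -/
theorem sum_div_le_log {z : ℕ → ℝ} (hz : Antitone z) {a b : ℕ} (hab : a ≤ b) {I : Finset ℕ}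
    (hI : I ⊆ Finset.Ico a b) {δ : ℝ} (hδ : 0 < δ) (h : ∀ τ ∈ I, δ ≤ z τ - z (τ + 1)) :
    ∑ τ ∈ I, (z τ - z (τ + 1)) / (z a - z (τ + 1)) ≤ 2 * Real.log (1 + (z a - z b) / δ) := by
  set ψ : ℕ → ℝ := fun t => Real.log (δ + (z a - z t)) with hψ
  have hpos : ∀ t, a ≤ t → 0 < δ + (z a - z t) := fun t ht => by linarith [hz ht]
  have h1 : ∀ τ ∈ I, (z τ - z (τ + 1)) / (z a - z (τ + 1)) ≤ 2 * (ψ (τ + 1) - ψ τ) := by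
    intro τ hτ
    have ha := (Finset.mem_Ico.1 (hI hτ)).1
    have h2 := h τ hτ
    have h3 := hz ha
    have h4 := hpos τ ha
    have h5 := hpos (τ + 1) (by omega)
    have h6 : 0 < z a - z (τ + 1) := by linarith
    have h7 : ψ (τ + 1) - ψ τ = -Real.log ((δ + (z a - z τ)) / (δ + (z a - z (τ + 1)))) := by
      rw [Real.log_div h4.ne' h5.ne']
      ring
    have h8 := Real.log_le_sub_one_of_pos (div_pos h4 h5)
    have h9 : (δ + (z a - z τ)) / (δ + (z a - z (τ + 1))) - 1 =
        -((z τ - z (τ + 1)) / (δ + (z a - z (τ + 1)))) := by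
      field_simp
      ring
    have h10 : (z τ - z (τ + 1)) / (2 * (z a - z (τ + 1))) ≤
        (z τ - z (τ + 1)) / (δ + (z a - z (τ + 1))) :=
      div_le_div_of_nonneg_left (by linarith) h5 (by linarith)
    have h11 : (z τ - z (τ + 1)) / (2 * (z a - z (τ + 1))) =
        (z τ - z (τ + 1)) / (z a - z (τ + 1)) / 2 := by
      field_simp
    rw [h7]
    linarith
  refine (Finset.sum_le_sum h1).trans ?_
  have h2 : ∑ τ ∈ I, 2 * (ψ (τ + 1) - ψ τ) ≤ ∑ τ ∈ Finset.Ico a b, 2 * (ψ (τ + 1) - ψ τ) := by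
    refine Finset.sum_le_sum_of_subset_of_nonneg hI fun τ hτ _ => ?_
    have ha := (Finset.mem_Ico.1 hτ).1
    have : ψ τ ≤ ψ (τ + 1) :=
      Real.log_le_log (hpos τ ha) (by linarith [hz (Nat.le_succ τ)])
    linarith
  refine h2.trans (le_of_eq ?_)
  rw [← Finset.mul_sum, Finset.sum_Ico_sub ψ hab]
  have h3 : ψ a = Real.log δ := by simp [hψ]
  have h4 : ψ b = Real.log (1 + (z a - z b) / δ) + Real.log δ := by
    rw [← Real.log_mul (by
        have := hz hab
        have : 0 ≤ (z a - z b) / δ := div_nonneg (by linarith) hδ.le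
        positivity)
      hδ.ne']
    simp only [hψ]
    congr 1
    field_simp
  rw [h3, h4]
  ring

/-! ### Isolated clients and the gains far away from them. -/

section SlowGreedy

variable {U : Type*} [MetricSpace U] [Fintype U]
variable {D : Finset U} {S₀ : U → ℝ} {y : ℕ → U} {T : ℕ}
variable {s : ℕ → ℝ} {h ρ : U → ℝ} {n : ℕ} {κ A H : ℝ}

/-- The levels at whose start the pair `(j, X)` is regular and `X` is served by `y τ`. -/
def servedLevels (D : Finset U) (S₀ : U → ℝ) (y : ℕ → U) (s : ℕ → ℝ) (ρ : U → ℝ) (T n τ : ℕ)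
    (X : U) : Finset ℤ :=
  (levels D S₀ y T).filter fun j =>
    IsCaptor S₀ y τ (start D S₀ y j) X ∧ SlowGreedy.Regular D S₀ y s ρ n (start D S₀ y j) X

/-- The mass of the ball around `X` of a sixteenth of the distance to `y τ`. -/
def coreMass (D : Finset U) (y : ℕ → U) (τ : ℕ) (X : U) : ℝ := mass D X (dist X (y τ) / 16)

/-- The power of `3 / 2` that bounds `coreMass` from above. -/
def coreBound (D : Finset U) (y : ℕ → U) (τ : ℕ) (X : U) : ℝ :=
  (3 / 2) ^ (bin (coreMass D y τ X) + 1)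

/-- The least radius of a ball around `X` of mass at least `w`. -/
def massRadius (D : Finset U) (X : U) (w : ℝ) : ℝ := sInf {r | 0 ≤ r ∧ w ≤ mass D X r}

theorem mass_lt_of_lt_massRadius {X : U} {w r : ℝ} (hr : 0 ≤ r) (h : r < massRadius D X w) :
    mass D X r < w := by
  by_contra hcon
  push Not at hcon
  exact absurd (csInf_le ⟨0, fun _ hx => hx.1⟩ (show r ∈ {r | 0 ≤ r ∧ w ≤ mass D X r} from
    ⟨hr, hcon⟩)) (not_le.2 h)

theorem gain_le_cost {S : U → ℝ} (hS : ∀ X, 0 ≤ S X) (z : U) : gain D S z ≤ ∑ X ∈ D, S X :=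
  Finset.sum_le_sum fun X _ => max_le (by linarith [dist_nonneg (x := X) (y := z)]) (hS X)

namespace SlowGreedy

/-- Greedy chose `y τ` although `X` was available. On the core, `X` beats `y τ` by 14/16 u per
client. On the remaining clients within `r`, at most W / 2 of them, `X` loses at most u each, and
the slack is at most u W / 64. The balance (56 - 32 - 1) / 64 · u W must come from clients beyond
`r`, where the advantage of `y τ` is at most its gain truncated at u. -/
theorem far_gain (G : SlowGreedy D S₀ y s h ρ T n κ A H) {τ : ℕ} (hτ : τ < T) {X : U}
    (hcap : dist X (y τ) < added S₀ y τ X)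
    (hs : 64 * s τ ≤ dist X (y τ) * coreMass D y τ X) {r : ℝ} (hr : dist X (y τ) / 16 ≤ r)
    (hmass : mass D X r ≤ 3 / 2 * coreMass D y τ X) :
    23 / 64 * (dist X (y τ) * coreMass D y τ X) ≤
      ∑ Y ∈ D.filter (fun Y => r < dist Y X),
        min (max (added S₀ y τ Y - dist Y (y τ)) 0) (dist X (y τ)) := by
  set u := dist X (y τ) with hu
  set W := coreMass D y τ X with hW
  have hu0 : 0 ≤ u := dist_nonneg
  have hpt : ∀ Y ∈ D, max (added S₀ y τ Y - dist Y (y τ)) 0 +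
      14 / 16 * u * (if dist Y X ≤ u / 16 then 1 else 0) ≤ max (added S₀ y τ Y - dist Y X) 0 +
      u * ((if dist Y X ≤ r then 1 else 0) - (if dist Y X ≤ u / 16 then 1 else 0)) +
      (if r < dist Y X then min (max (added S₀ y τ Y - dist Y (y τ)) 0) u else 0) := by
    intro Y _
    have h1 := dist_triangle Y X (y τ)
    have h2 := dist_triangle_left X (y τ) Y
    have h3 := added_lip (y := y) G.lip τ X Y
    rw [dist_comm X Y] at h3
    by_cases hc1 : dist Y X ≤ u / 16
    · have hc2 : dist Y X ≤ r := hc1.trans hr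
      rw [if_pos hc1, if_pos hc2, if_neg (not_lt.2 hc2)]
      have h4 := le_max_left (added S₀ y τ Y - dist Y X) 0
      have h5 : max (added S₀ y τ Y - dist Y (y τ)) 0 ≤ added S₀ y τ Y - 15 / 16 * u :=
        max_le (by linarith) (by linarith)
      linarith
    · rw [if_neg hc1]
      have h6 : max (added S₀ y τ Y - dist Y (y τ)) 0 ≤ max (added S₀ y τ Y - dist Y X) 0 + u := by
        refine max_le ?_ (by positivity)
        have h4 := le_max_left (added S₀ y τ Y - dist Y X) 0
        have h5 := dist_triangle_right Y X (y τ)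
        linarith
      by_cases hc2 : dist Y X ≤ r
      · rw [if_pos hc2, if_neg (not_lt.2 hc2)]
        linarith
      · rw [if_neg hc2, if_pos (not_le.1 hc2)]
        have h7 := le_max_right (added S₀ y τ Y - dist Y X) 0
        rcases min_choice (max (added S₀ y τ Y - dist Y (y τ)) 0) u with h8 | h8 <;> rw [h8] <;>
          linarith
  have hsum := Finset.sum_le_sum hpt
  simp only [Finset.sum_add_distrib, ← Finset.mul_sum, Finset.sum_sub_distrib] at hsum
  rw [← Finset.sum_filter (fun Y => r < dist Y X)] at hsum
  simp only [Finset.sum_boole] at hsum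
  have h1 := G.slack τ hτ X
  have h2 : ((D.filter fun Y => dist Y X ≤ u / 16).card : ℝ) = W := rfl
  have h3 : ((D.filter fun Y => dist Y X ≤ r).card : ℝ) = mass D X r := rfl
  have h4 : ∑ Y ∈ D, max (added S₀ y τ Y - dist Y (y τ)) 0 = gain D (added S₀ y τ) (y τ) := rfl
  have h5 : ∑ Y ∈ D, max (added S₀ y τ Y - dist Y X) 0 = gain D (added S₀ y τ) X := rfl
  rw [h2, h3, h4, h5] at hsum
  have h6 : u * mass D X r ≤ u * (3 / 2 * W) := mul_le_mul_of_nonneg_left hmass hu0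
  linarith

/-- The basic facts about a client `X` that is served by `y τ` at the start of level `j`. -/
theorem served_spec (G : SlowGreedy D S₀ y s h ρ T n κ A H) {τ : ℕ} {X : U} (hX : X ∈ D) {j : ℤ}
    (hj : j ∈ servedLevels D S₀ y s ρ T n τ X) :
    τ < T ∧ j < lev D S₀ y τ ∧ dist X (y τ) < added S₀ y τ X ∧
      added S₀ y (start D S₀ y j) X = dist X (y τ) ∧
      h X ≤ coreMass D y τ X ∧ dist X (y τ) * coreMass D y τ X ≤ 3 * 2 ^ j ∧
      (2 : ℝ) ^ j ≤ 16 * n * dist X (y τ) ∧ 0 < dist X (y τ) ∧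
      (IsIsolated D X (dist X (y τ)) → 64 * s τ ≤ dist X (y τ) * coreMass D y τ X) := by
  obtain ⟨hj1, hcap, hreg⟩ := Finset.mem_filter.1 hj
  obtain ⟨ha, hlev⟩ := start_spec hj1
  have hn : (0 : ℝ) < n := by exact_mod_cast G.n_pos
  have h1 : (2 : ℝ) ^ j ≤ 16 * n * dist X (y τ) := by
    have h2 := hreg.2.1
    rw [hcap.2.1, div_le_iff₀ (by positivity)] at h2
    have h3 := G.zpow_lev_le ha.le
    rw [hlev] at h3
    have h4 : maxGain D (added S₀ y (start D S₀ y j)) ≤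
        ∑ Y ∈ D, added S₀ y (start D S₀ y j) Y :=
      haveI : Nonempty U := ⟨X⟩
      ciSup_le fun z => gain_le_cost (added_nonneg G.nonneg _) z
    linarith
  have hjpos : (0 : ℝ) < 2 ^ j := by positivity
  have hcm : dist X (y τ) * coreMass D y τ X ≤ 3 * 2 ^ j := by
    have h2 := G.mass_mul_le (start D S₀ y j) X
    have h3 := G.lt_zpow_lev (start D S₀ y j)
    rw [hlev] at h3
    rw [hcap.2.1] at h2
    unfold coreMass
    linarith
  -- The bound 3 · 2^j comes from 8/7 · 2. The level of τ is strictly above j because τ precedes the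
  -- first time of level j.
  refine ⟨hcap.1.trans ha, ?_, hcap.2.2, hcap.2.1, ?_, hcm, h1, ?_, hreg.2.2 τ hcap⟩
  · refine lt_of_le_of_ne ?_ fun he => ?_
    · have := G.lev_anti hcap.1.le ha.le
      rwa [hlev] at this
    · have h2 : start D S₀ y j ≤ τ := by
        rw [he]
        exact start_lev_le τ
      exact absurd hcap.1 (not_lt.2 h2)
  · have h2 := hreg.1
    rw [hcap.2.1] at h2
    exact G.h_le_mass hX (by linarith)
  · by_contra hcon
    push Not at hcon
    have : 16 * n * dist X (y τ) ≤ 0 := mul_nonpos_of_nonneg_of_nonpos (by positivity) hcon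
    linarith

theorem one_le_coreMass {X : U} (hX : X ∈ D) (τ : ℕ) : 1 ≤ coreMass D y τ X :=
  one_le_mass hX (by have : 0 ≤ dist X (y τ) := dist_nonneg; linarith)

theorem coreBound_le {X : U} (hX : X ∈ D) (τ : ℕ) :
    coreBound D y τ X ≤ 3 / 2 * coreMass D y τ X :=
  pow_bin_succ_le (one_le_coreMass hX τ)

theorem coreBound_pos (D : Finset U) (y : ℕ → U) (X : U) (τ : ℕ) : 0 < coreBound D y τ X := by
  unfold coreBound
  positivity

/-- If `X` is served by `y τ` in an isolated way, then the ball around `X` up to the next mass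
bound is much larger than the connection cost, but not larger than the current gains. -/
theorem isolated_spec (G : SlowGreedy D S₀ y s h ρ T n κ A H) {τ : ℕ} {X : U} (hX : X ∈ D) {j : ℤ}
    (hj : j ∈ servedLevels D S₀ y s ρ T n τ X) (hiso : IsIsolated D X (dist X (y τ))) :
    4 * dist X (y τ) ≤ massRadius D X (coreBound D y τ X) ∧
      massRadius D X (coreBound D y τ X) < 8 * 2 ^ lev D S₀ y τ ∧
      23 / 64 * (dist X (y τ) * coreMass D y τ X) ≤
        ∑ Y ∈ D.filter (fun Y => massRadius D X (coreBound D y τ X) / 2 < dist Y X),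
          min (max (added S₀ y τ Y - dist Y (y τ)) 0) (dist X (y τ)) := by
  obtain ⟨hτ, -, hcap, -, -, -, -, hu, hs⟩ := G.served_spec hX hj
  have hs := hs hiso
  set u := dist X (y τ) with hudef
  set w := coreBound D y τ X with hw
  have hW1 : 1 ≤ coreMass D y τ X := one_le_coreMass hX τ
  have hwW : w ≤ 3 / 2 * coreMass D y τ X := coreBound_le hX τ
  have hpos : 0 < 23 / 64 * (u * coreMass D y τ X) := by positivity
  have hset : {r : ℝ | 0 ≤ r ∧ w ≤ mass D X r}.Nonempty := by
    by_contra hcon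
    rw [Set.not_nonempty_iff_eq_empty, Set.eq_empty_iff_forall_notMem] at hcon
    -- A radius that covers all clients. If the mass bound were never reached, `far_gain` would find
    -- a positive gain beyond it.
    set r := u / 16 + ∑ Y ∈ D, dist Y X with hr
    have hr0 : 0 ≤ ∑ Y ∈ D, dist Y X := Finset.sum_nonneg fun _ _ => dist_nonneg
    have h1 : mass D X r < w := by
      by_contra h2
      exact hcon r ⟨by positivity, not_lt.1 h2⟩
    have h2 := G.far_gain hτ hcap hs (r := r) (by linarith) (h1.le.trans hwW)
    rw [Finset.filter_eq_empty_iff.2, Finset.sum_empty] at h2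
    · linarith
    · intro Y hY
      have h3 := Finset.single_le_sum (f := fun Y => dist Y X) (fun _ _ => dist_nonneg) hY
      rw [not_lt]
      linarith
  have h4u : 4 * u ≤ massRadius D X w := by
    refine le_csInf hset fun r hr => ?_
    by_contra hcon
    push Not at hcon
    have h1 := mass_mono D X hcon.le
    have h2 : mass D X (4 * u) < w := hiso
    linarith [hr.2]
  have hfar := G.far_gain hτ hcap hs (r := massRadius D X w / 2) (by linarith)
    ((mass_lt_of_lt_massRadius (by linarith) (by linarith)).le.trans hwW)
  refine ⟨h4u, ?_, hfar⟩
  -- Some far client Y gains from `y τ`, so its distance to `y τ` is below its own connection cost,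
  -- hence below 2 · 2^lev. This distance is also at least R / 2 - u ≥ R / 4.
  have hne : ∃ Y ∈ D.filter (fun Y => massRadius D X w / 2 < dist Y X),
      0 < min (max (added S₀ y τ Y - dist Y (y τ)) 0) u := by
    by_contra hcon
    push Not at hcon
    linarith [Finset.sum_nonpos hcon]
  obtain ⟨Y, hY, hY2⟩ := hne
  obtain ⟨hYD, hYd⟩ := Finset.mem_filter.1 hY
  have h1 : 0 < added S₀ y τ Y - dist Y (y τ) := by
    rcases lt_max_iff.1 (lt_min_iff.1 hY2).1 with h | h
    · exact h
    · exact absurd h (lt_irrefl _)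
  have h2 : added S₀ y τ Y ≤ maxGain D (added S₀ y τ) := (le_gain hYD).trans (gain_le_maxGain _ _ _)
  have h3 := G.lt_zpow_lev τ
  have h4 := dist_triangle Y (y τ) X
  rw [dist_comm (y τ) X] at h4
  linarith

end SlowGreedy

end SlowGreedy

/-! ### Atypical service, charged to the cost at the start of a level. -/

section SlowGreedy

variable {U : Type*} [MetricSpace U] [Fintype U]
variable {D : Finset U} {S₀ : U → ℝ} {y : ℕ → U} {T : ℕ}
variable {s : ℕ → ℝ} {h ρ : U → ℝ} {n : ℕ} {κ A H : ℝ}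

/-- The last level at whose start the pair `(j, X)` is regular and `X` is served by `y τ`. -/
def lastLevel (D : Finset U) (S₀ : U → ℝ) (y : ℕ → U) (s : ℕ → ℝ) (ρ : U → ℝ) (T n τ : ℕ)
    (X : U) : ℤ :=
  if h : (servedLevels D S₀ y s ρ T n τ X).Nonempty then
    (servedLevels D S₀ y s ρ T n τ X).min' h else 0

theorem lastLevel_mem {τ : ℕ} {X : U} (h : (servedLevels D S₀ y s ρ T n τ X).Nonempty) :
    lastLevel D S₀ y s ρ T n τ X ∈ servedLevels D S₀ y s ρ T n τ X := by
  rw [lastLevel, dif_pos h]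
  exact Finset.min'_mem _ _

theorem lastLevel_le {τ : ℕ} {X : U} {j : ℤ} (h : j ∈ servedLevels D S₀ y s ρ T n τ X) :
    lastLevel D S₀ y s ρ T n τ X ≤ j := by
  rw [lastLevel, dif_pos ⟨j, h⟩]
  exact Finset.min'_le _ _ h

/-- The product of the mass bound and of the radius of isolation. -/
def spread (D : Finset U) (y : ℕ → U) (τ : ℕ) (X : U) : ℝ :=
  coreBound D y τ X * massRadius D X (coreBound D y τ X)

/-- `X` is served by `y τ` in an isolated way until a level that is not much below the level at
which `y τ` was added. -/
def IsAtypical (D : Finset U) (S₀ : U → ℝ) (y : ℕ → U) (s : ℕ → ℝ) (ρ : U → ℝ) (T n : ℕ) (Q : ℝ)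
    (τ : ℕ) (X : U) : Prop :=
  (servedLevels D S₀ y s ρ T n τ X).Nonempty ∧ IsIsolated D X (dist X (y τ)) ∧
    ((2 : ℝ) ^ lev D S₀ y τ) ^ 2 * Q < spread D y τ X * 2 ^ lastLevel D S₀ y s ρ T n τ X

theorem added_sub_succ (τ : ℕ) (Y : U) :
    added S₀ y τ Y - added S₀ y (τ + 1) Y = max (added S₀ y τ Y - dist Y (y τ)) 0 := by
  show _ - min _ _ = _
  rcases le_total (added S₀ y τ Y) (dist Y (y τ)) with h | h
  · rw [min_eq_left h, max_eq_right (by linarith)]; ring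
  · rw [min_eq_right h, max_eq_left (by linarith)]

namespace SlowGreedy

/-- The far clients that gain from `y τ` had connection cost at least R / 4 already at the start of
the level, so R times their gain is paid by that cost. Gains below δ and clients with a large
cumulative decrease are discarded at the price of 1/64 and 2/64 of u W, leaving 20/64 of the 23/64.
The bound on the cumulative decrease is what later limits the number of clients `X` charging one
`Y`. -/
theorem atypical_client (G : SlowGreedy D S₀ y s h ρ T n κ A H) {Q : ℝ} (hQ : 1 ≤ Q) {τ : ℕ}
    {X : U} (hX : X ∈ D) (hat : IsAtypical D S₀ y s ρ T n Q τ X) :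
    dist X (y τ) * coreMass D y τ X * massRadius D X (coreBound D y τ X) ≤
      64 / 5 * ∑ Y ∈ D.filter (fun Y =>
        (2 : ℝ) ^ lev D S₀ y τ / (12288 * n ^ 3) ≤ added S₀ y τ Y - added S₀ y (τ + 1) Y ∧
        (added S₀ y (start D S₀ y (lev D S₀ y τ)) Y - added S₀ y (τ + 1) Y) * coreMass D y τ X ≤
          64 * 2 ^ lev D S₀ y τ),
        added S₀ y (start D S₀ y (lev D S₀ y τ)) Y *
          (added S₀ y τ Y - added S₀ y (τ + 1) Y) := by
  obtain ⟨hne, hiso, hat⟩ := hat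
  have hmem := lastLevel_mem hne
  obtain ⟨hτ, hlt, hcap, -, -, hcm, h2j, hu, hs⟩ := G.served_spec hX hmem
  obtain ⟨h4u, hR8, hfar⟩ := G.isolated_spec hX hmem hiso
  have hW1 : 1 ≤ coreMass D y τ X := one_le_coreMass hX τ
  have hwW : coreBound D y τ X ≤ 3 / 2 * coreMass D y τ X := coreBound_le hX τ
  have hWn : coreMass D y τ X ≤ n :=
    (mass_le_card D X _).trans (by exact_mod_cast G.card_le)
  have hw0 := coreBound_pos D y X τ
  have hn : (1 : ℝ) ≤ n := by exact_mod_cast G.n_pos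
  unfold spread at hat
  set g' : ℝ := (2 : ℝ) ^ lev D S₀ y τ with hg'
  set g : ℝ := (2 : ℝ) ^ lastLevel D S₀ y s ρ T n τ X with hg
  set u := dist X (y τ) with hudef
  set W := coreMass D y τ X with hW
  set w := coreBound D y τ X with hw
  set R := massRadius D X w with hR
  set a' := start D S₀ y (lev D S₀ y τ) with ha'
  have hg'0 : 0 < g' := by positivity
  have hg0 : 0 < g := by positivity
  -- the levels involved are polynomially related
  have hgg : g' < 12 * n * g := by
    have h1 : w * R * g ≤ 3 / 2 * n * (8 * g') * g := by
      have : w ≤ 3 / 2 * n := by linarith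
      have : 0 ≤ R := by linarith
      gcongr
    have h2 : g' ^ 2 ≤ g' ^ 2 * Q := le_mul_of_one_le_right (by positivity) hQ
    have h3 : g' * g' < 12 * n * g * g' := by nlinarith
    exact lt_of_mul_lt_mul_right h3 hg'0.le
  -- The threshold δ is so small that n gains below it are negligible against u W. Here g' ≤ 12 n g
  -- and g ≤ 16 n u give g' ≤ 192 n² u.
  have hδu : n * (g' / (12288 * n ^ 3)) ≤ u * W / 64 := by
    have h1 : g' / (12288 * n ^ 3) = g' / (12288 * n ^ 2) / n := by field_simp
    have h2 : n * (g' / (12288 * n ^ 3)) = g' / (12288 * n ^ 2) := by rw [h1]; field_simp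
    rw [h2, div_le_iff₀ (by positivity)]
    have h3 : g' ≤ 192 * n ^ 2 * u := by nlinarith
    have h4 : u ≤ u * W := le_mul_of_one_le_right hu.le hW1
    have h5 : 192 * (n : ℝ) ^ 2 * u ≤ 192 * n ^ 2 * (u * W) :=
      mul_le_mul_of_nonneg_left h4 (by positivity)
    linarith
  set δ := g' / (12288 * n ^ 3) with hδ
  have hδ0 : 0 < δ := by positivity
  set new : U → ℝ := fun Y => added S₀ y τ Y - added S₀ y (τ + 1) Y with hnew
  set c : U → ℝ := fun Y => added S₀ y a' Y - added S₀ y (τ + 1) Y with hc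
  set far := D.filter fun Y => R / 2 < dist Y X with hfardef
  have ha'τ : a' ≤ τ := start_lev_le τ
  have hnew0 : ∀ Y, 0 ≤ new Y := fun Y => by
    have := added_anti (S₀ := S₀) (y := y) (Nat.le_succ τ) Y
    simp only [hnew]
    linarith
  -- only few clients have a large cumulative decrease
  have hlarge : ((far.filter fun Y => 64 * g' < c Y * W ∧ δ ≤ new Y).card : ℝ) ≤ W / 32 := by
    have h1 : ((far.filter fun Y => 64 * g' < c Y * W ∧ δ ≤ new Y).card : ℝ) * (64 * g' / W) ≤
        gain D (added S₀ y a') (y τ) := by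
      rw [← nsmul_eq_mul, ← Finset.sum_const]
      refine le_trans (Finset.sum_le_sum
        (g := fun Y => max (added S₀ y a' Y - dist Y (y τ)) 0) fun Y hY => ?_)
        (Finset.sum_le_sum_of_subset_of_nonneg ((Finset.filter_subset _ _).trans
          (Finset.filter_subset _ _)) fun _ _ _ => le_max_right _ _)
      obtain ⟨-, hY2, hY3⟩ := Finset.mem_filter.1 hY
      refine le_max_of_le_left ?_
      rw [div_le_iff₀ (by linarith)]
      -- A gain of at least δ > 0 means that Y is served by `y τ` afterwards. Its cumulative
      -- decrease is then what `y τ` would have gained on Y at the start of the level, and these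
      -- gains sum to less than 2 g'.
      have h2 : new Y = max (added S₀ y τ Y - dist Y (y τ)) 0 := added_sub_succ τ Y
      have h3 : new Y = added S₀ y τ Y - dist Y (y τ) := by
        rcases max_choice (added S₀ y τ Y - dist Y (y τ)) 0 with h | h <;> rw [h] at h2
        · exact h2
        · linarith
      have h4 : added S₀ y (τ + 1) Y = dist Y (y τ) := by
        simp only [hnew] at h3
        linarith
      simp only [hc, h4] at hY2
      exact hY2.le
    have h2 : gain D (added S₀ y a') (y τ) < 2 * g' := by
      have h3 := G.lt_zpow_lev a'
      have h4 : lev D S₀ y a' = lev D S₀ y τ := (start_spec (lev_mem_levels hτ)).2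
      rw [h4] at h3
      exact (gain_le_maxGain _ _ _).trans_lt h3
    have h3 := h1.trans h2.le
    rw [← mul_div_assoc, div_le_iff₀ (by linarith)] at h3
    have h4 : ((far.filter fun Y => 64 * g' < c Y * W ∧ δ ≤ new Y).card : ℝ) * g' ≤
        W / 32 * g' := by linarith
    exact le_of_mul_le_mul_right h4 hg'0
  have hpt : ∀ Y ∈ far, min (max (added S₀ y τ Y - dist Y (y τ)) 0) u ≤
      δ + u * (if 64 * g' < c Y * W ∧ δ ≤ new Y then 1 else 0) +
      (if δ ≤ new Y ∧ c Y * W ≤ 64 * g' then new Y else 0) := by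
    intro Y _
    have h1 : new Y = max (added S₀ y τ Y - dist Y (y τ)) 0 := added_sub_succ τ Y
    rw [← h1]
    by_cases h2 : δ ≤ new Y
    · by_cases h3 : c Y * W ≤ 64 * g'
      · rw [if_neg (by rintro ⟨h4, -⟩; linarith), if_pos ⟨h2, h3⟩]
        linarith [min_le_left (new Y) u]
      · rw [if_pos ⟨not_le.1 h3, h2⟩, if_neg (by rintro ⟨-, h4⟩; exact h3 h4)]
        linarith [min_le_right (new Y) u]
    · rw [if_neg (by rintro ⟨-, h4⟩; exact h2 h4), if_neg (by rintro ⟨h4, -⟩; exact h2 h4)]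
      linarith [min_le_left (new Y) u]
  have hsum := hfar.trans (Finset.sum_le_sum hpt)
  rw [Finset.sum_add_distrib, Finset.sum_add_distrib, ← Finset.mul_sum, Finset.sum_boole,
    Finset.sum_const, nsmul_eq_mul, ← Finset.sum_filter] at hsum
  have h1 : (far.card : ℝ) * δ ≤ u * W / 64 := by
    refine le_trans (mul_le_mul_of_nonneg_right ?_ hδ0.le) hδu
    exact_mod_cast (Finset.card_le_card (Finset.filter_subset _ _)).trans G.card_le
  have h2 := mul_le_mul_of_nonneg_left hlarge hu.le
  have h3 : 20 / 64 * (u * W) ≤ ∑ Y ∈ far.filter (fun Y => δ ≤ new Y ∧ c Y * W ≤ 64 * g'),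
      new Y := by linarith
  have hR0 : 0 ≤ R := by linarith
  have h4 : R * (∑ Y ∈ far.filter (fun Y => δ ≤ new Y ∧ c Y * W ≤ 64 * g'), new Y) ≤
      4 * ∑ Y ∈ D.filter (fun Y => δ ≤ new Y ∧ c Y * W ≤ 64 * g'), added S₀ y a' Y * new Y := by
    rw [Finset.mul_sum, Finset.mul_sum]
    refine le_trans (Finset.sum_le_sum
      (g := fun Y => 4 * (added S₀ y a' Y * new Y)) fun Y hY => ?_)
      (Finset.sum_le_sum_of_subset_of_nonneg
        (Finset.filter_subset_filter _ (Finset.filter_subset _ _)) fun Y _ _ => ?_)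
    · obtain ⟨hY1, hY2, -⟩ := Finset.mem_filter.1 hY
      have hY4 := (Finset.mem_filter.1 hY1).2
      have h5 : new Y = max (added S₀ y τ Y - dist Y (y τ)) 0 := added_sub_succ τ Y
      have h6 : 0 < added S₀ y τ Y - dist Y (y τ) := by
        rcases lt_max_iff.1 (hδ0.trans_le (h5 ▸ hY2)) with h | h
        · exact h
        · exact absurd h (lt_irrefl _)
      have h7 := dist_triangle Y (y τ) X
      rw [dist_comm (y τ) X] at h7
      have h8 : added S₀ y τ Y ≤ added S₀ y a' Y := added_anti ha'τ Y
      have h9 : R ≤ 4 * added S₀ y a' Y := by linarith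
      have h10 := mul_le_mul_of_nonneg_right h9 (hnew0 Y)
      linarith
    · have := added_nonneg (y := y) G.nonneg a' Y
      have := hnew0 Y
      positivity
  have h5 := mul_le_mul_of_nonneg_left h3 hR0
  have h6 : u * W * R = 64 / 20 * (R * (20 / 64 * (u * W))) := by ring
  rw [h6]
  linarith

/-- For an atypical pair, u / g is at most a multiple of u W R / (g'² Q), where g = 2^ℓ for the last
level ℓ served. By `atypical_client`, u W R is charged to far clients Y. Exchanging the sums, each Y
is charged by O(g' / c) clients, c being its cumulative decrease, and the ratios new / c sum to
O(log n) over a level by `sum_div_le_log`. The choice of Q absorbs this logarithm. -/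
theorem atypical_sum_le (G : SlowGreedy D S₀ y s h ρ T n κ A H) {Q : ℝ} (hQ : 1 ≤ Q)
    (hQn : 65536 * Real.log (1 + 24576 * n ^ 3) ≤ Q) {j : ℤ} (hj : j ∈ levels D S₀ y T) :
    ∑ τ ∈ (Finset.range T).filter (fun τ => lev D S₀ y τ = j),
      ∑ X ∈ D.filter (fun X => IsAtypical D S₀ y s ρ T n Q τ X),
        2 * (dist X (y τ) * ((2 : ℝ) ^ lastLevel D S₀ y s ρ T n τ X)⁻¹) ≤
      1 / 8 * ((∑ X ∈ D, added S₀ y (start D S₀ y j) X) * ((2 : ℝ) ^ j)⁻¹) := by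
  set g' : ℝ := (2 : ℝ) ^ j with hg'
  have hg'0 : 0 < g' := by positivity
  have hn : (1 : ℝ) ≤ n := by exact_mod_cast G.n_pos
  set δ := g' / (12288 * n ^ 3) with hδ
  have hδ0 : 0 < δ := by positivity
  set a' := start D S₀ y j with ha'
  obtain ⟨ha'T, hleva'⟩ := start_spec hj
  set I := (Finset.range T).filter (fun τ => lev D S₀ y τ = j) with hI
  set new : ℕ → U → ℝ := fun τ Y => added S₀ y τ Y - added S₀ y (τ + 1) Y with hnew
  set c : ℕ → U → ℝ := fun τ Y => added S₀ y a' Y - added S₀ y (τ + 1) Y with hc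
  have hnew0 : ∀ τ Y, 0 ≤ new τ Y := fun τ Y => by
    have := added_anti (S₀ := S₀) (y := y) (Nat.le_succ τ) Y
    simp only [hnew]
    linarith
  have hS0 : ∀ Y, 0 ≤ added S₀ y a' Y := added_nonneg G.nonneg a'
  have hlog0 : 0 ≤ Real.log (1 + 24576 * n ^ 3) :=
    Real.log_nonneg (by have : (0 : ℝ) ≤ 24576 * n ^ 3 := by positivity
                        linarith)
  -- the sum of `u * W * R` for one center
  have hone : ∀ τ ∈ I, ∑ X ∈ D.filter (fun X => IsAtypical D S₀ y s ρ T n Q τ X),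
      dist X (y τ) * coreMass D y τ X * massRadius D X (coreBound D y τ X) ≤
      64 / 5 * 96 * g' * ∑ Y ∈ D, added S₀ y a' Y *
        (if δ ≤ new τ Y then new τ Y / c τ Y else 0) := by
    intro τ hτ
    obtain ⟨hτT, hτj⟩ := Finset.mem_filter.1 hτ
    set Hτ := D.filter (fun X => IsAtypical D S₀ y s ρ T n Q τ X) with hH
    have h1 : ∀ X ∈ Hτ, dist X (y τ) * coreMass D y τ X * massRadius D X (coreBound D y τ X) ≤
        64 / 5 * ∑ Y ∈ D, if δ ≤ new τ Y ∧ c τ Y * coreMass D y τ X ≤ 64 * g' then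
          added S₀ y a' Y * new τ Y else 0 := by
      intro X hX
      obtain ⟨hXD, hXa⟩ := Finset.mem_filter.1 hX
      have h2 := G.atypical_client hQ hXD hXa
      rw [hτj] at h2
      rw [← Finset.sum_filter]
      exact h2
    refine (Finset.sum_le_sum h1).trans ?_
    have hR : 64 / 5 * 96 * g' * ∑ Y ∈ D, added S₀ y a' Y *
        (if δ ≤ new τ Y then new τ Y / c τ Y else 0) = 64 / 5 * ∑ Y ∈ D, 96 * (g' *
        (added S₀ y a' Y * (if δ ≤ new τ Y then new τ Y / c τ Y else 0))) := by
      rw [← Finset.mul_sum, ← Finset.mul_sum]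
      ring
    rw [← Finset.mul_sum, Finset.sum_comm, hR]
    refine mul_le_mul_of_nonneg_left (Finset.sum_le_sum fun Y _ => ?_) (by norm_num)
    by_cases hδY : δ ≤ new τ Y
    · simp only [hδY, true_and, if_true]
      rw [← Finset.sum_filter, Finset.sum_const, nsmul_eq_mul]
      have hcpos : 0 < c τ Y := by
        have h2 : added S₀ y τ Y ≤ added S₀ y a' Y := by
          refine added_anti ?_ Y
          rw [ha', ← hτj]
          exact start_lev_le τ
        have h3 : c τ Y = (added S₀ y a' Y - added S₀ y τ Y) + new τ Y := by
          simp only [hc, hnew]; ring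
        linarith
      set K := Hτ.filter (fun X => c τ Y * coreMass D y τ X ≤ 64 * g') with hK
      -- These clients are isolated and share the server `y τ`, so their number is at most 3/2 of
      -- the core mass of the farthest one, which is at most 64 g' / c.
      have hKc : (K.card : ℝ) ≤ 96 * (g' / c τ Y) := by
        rcases K.eq_empty_or_nonempty with he | hKne
        · rw [he, Finset.card_empty, Nat.cast_zero]
          positivity
        · obtain ⟨X, hX, -, hcard⟩ := exists_card_le_mass
            ((Finset.filter_subset _ _).trans (Finset.filter_subset _ _)) hKne (y τ)
            fun X hX => (Finset.mem_filter.1 (Finset.mem_filter.1 hX).1).2.2.1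
          have h2 := (Finset.mem_filter.1 hX).2
          have h3 : coreMass D y τ X ≤ 64 * g' / c τ Y := by
            rw [le_div_iff₀ hcpos]
            linarith
          have h4 : mass D X (dist X (y τ) / 16) = coreMass D y τ X := rfl
          rw [h4] at hcard
          have h5 : 64 * g' / c τ Y = 64 * (g' / c τ Y) := by ring
          linarith
      have h2 : 0 ≤ added S₀ y a' Y * new τ Y := mul_nonneg (hS0 Y) (hnew0 τ Y)
      calc (K.card : ℝ) * (added S₀ y a' Y * new τ Y)
          ≤ 96 * (g' / c τ Y) * (added S₀ y a' Y * new τ Y) :=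
            mul_le_mul_of_nonneg_right hKc h2
        _ = 96 * (g' * (added S₀ y a' Y * (new τ Y / c τ Y))) := by
            field_simp
    · simp [hδY]
  -- the sum over the centers of the level
  have hlogsum : ∀ Y ∈ D, ∑ τ ∈ I, (if δ ≤ new τ Y then new τ Y / c τ Y else 0) ≤
      2 * Real.log (1 + 24576 * n ^ 3) := by
    intro Y hY
    rw [← Finset.sum_filter]
    have h1 := sum_div_le_log (z := fun t => added S₀ y t Y)
      (fun t t' htt => added_anti htt Y) ha'T.le
      (I := I.filter fun τ => δ ≤ new τ Y) (δ := δ) ?_ hδ0 ?_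
    · refine h1.trans ?_
      refine mul_le_mul_of_nonneg_left (Real.log_le_log ?_ ?_) (by norm_num)
      · have : added S₀ y T Y ≤ added S₀ y a' Y := added_anti ha'T.le Y
        have : 0 ≤ (added S₀ y a' Y - added S₀ y T Y) / δ := div_nonneg (by linarith) hδ0.le
        linarith
      · have h2 : added S₀ y a' Y < 2 * g' := by
          have h3 := G.lt_zpow_lev a'
          rw [hleva'] at h3
          exact ((le_gain hY).trans (gain_le_maxGain _ _ _)).trans_lt h3
        have h3 := added_nonneg (y := y) G.nonneg T Y
        have h4 : (added S₀ y a' Y - added S₀ y T Y) / δ ≤ 24576 * n ^ 3 := by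
          rw [div_le_iff₀ hδ0, hδ]
          have : 24576 * (n : ℝ) ^ 3 * (g' / (12288 * n ^ 3)) = 2 * g' := by
            field_simp; norm_num
          linarith
        linarith
    · intro τ hτ
      obtain ⟨hτI, -⟩ := Finset.mem_filter.1 hτ
      obtain ⟨hτT, hτj⟩ := Finset.mem_filter.1 hτI
      refine Finset.mem_Ico.2 ⟨?_, Finset.mem_range.1 hτT⟩
      rw [← hτj]
      exact start_lev_le τ
    · intro τ hτ
      exact (Finset.mem_filter.1 hτ).2
  have hall : ∑ τ ∈ I, ∑ X ∈ D.filter (fun X => IsAtypical D S₀ y s ρ T n Q τ X),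
      dist X (y τ) * coreMass D y τ X * massRadius D X (coreBound D y τ X) ≤
      64 / 5 * 96 * g' * ((∑ Y ∈ D, added S₀ y a' Y) *
        (2 * Real.log (1 + 24576 * n ^ 3))) := by
    refine (Finset.sum_le_sum hone).trans ?_
    rw [← Finset.mul_sum, Finset.sum_comm, Finset.sum_mul]
    refine mul_le_mul_of_nonneg_left (Finset.sum_le_sum fun Y hY => ?_) (by positivity)
    rw [← Finset.mul_sum]
    exact mul_le_mul_of_nonneg_left (hlogsum Y hY) (hS0 Y)
  -- from `u * W * R` to `u / g`
  have hterm : ∀ τ ∈ I, ∀ X ∈ D.filter (fun X => IsAtypical D S₀ y s ρ T n Q τ X),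
      2 * (dist X (y τ) * ((2 : ℝ) ^ lastLevel D S₀ y s ρ T n τ X)⁻¹) ≤
      3 / (g' ^ 2 * Q) *
        (dist X (y τ) * coreMass D y τ X * massRadius D X (coreBound D y τ X)) := by
    intro τ hτ X hX
    obtain ⟨hXD, hne, hiso, hXa⟩ := Finset.mem_filter.1 hX
    obtain ⟨hτT, hτj⟩ := Finset.mem_filter.1 hτ
    have hmem := lastLevel_mem hne
    obtain ⟨-, -, -, -, -, -, -, hu, -⟩ := G.served_spec hXD hmem
    obtain ⟨h4u, -, -⟩ := G.isolated_spec hXD hmem hiso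
    have hwW : coreBound D y τ X ≤ 3 / 2 * coreMass D y τ X := coreBound_le hXD τ
    rw [hτj] at hXa
    unfold spread at hXa
    set g : ℝ := (2 : ℝ) ^ lastLevel D S₀ y s ρ T n τ X with hg
    have hg0 : 0 < g := by positivity
    have hR0 : 0 ≤ massRadius D X (coreBound D y τ X) := by linarith
    have h1 : g' ^ 2 * Q ≤
        3 / 2 * coreMass D y τ X * massRadius D X (coreBound D y τ X) * g :=
      hXa.le.trans (by gcongr)
    have hgQ : 0 < g' ^ 2 * Q := by positivity
    rw [div_mul_eq_mul_div, le_div_iff₀ hgQ, ← div_eq_mul_inv, ← mul_div_assoc, div_mul_eq_mul_div,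
      div_le_iff₀ hg0]
    have h2 := mul_le_mul_of_nonneg_left h1 hu.le
    linarith
  calc ∑ τ ∈ I, ∑ X ∈ D.filter (fun X => IsAtypical D S₀ y s ρ T n Q τ X),
        2 * (dist X (y τ) * ((2 : ℝ) ^ lastLevel D S₀ y s ρ T n τ X)⁻¹)
      ≤ ∑ τ ∈ I, ∑ X ∈ D.filter (fun X => IsAtypical D S₀ y s ρ T n Q τ X), 3 / (g' ^ 2 * Q) *
        (dist X (y τ) * coreMass D y τ X * massRadius D X (coreBound D y τ X)) :=
        Finset.sum_le_sum fun τ hτ => Finset.sum_le_sum (hterm τ hτ)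
    _ = 3 / (g' ^ 2 * Q) * ∑ τ ∈ I, ∑ X ∈ D.filter (fun X => IsAtypical D S₀ y s ρ T n Q τ X),
        dist X (y τ) * coreMass D y τ X * massRadius D X (coreBound D y τ X) := by
        simp_rw [Finset.mul_sum]
    _ ≤ 3 / (g' ^ 2 * Q) * (64 / 5 * 96 * g' * ((∑ Y ∈ D, added S₀ y a' Y) *
        (2 * Real.log (1 + 24576 * n ^ 3)))) :=
        mul_le_mul_of_nonneg_left hall (by positivity)
    _ ≤ 1 / 8 * ((∑ X ∈ D, added S₀ y a' X) * g'⁻¹) := by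
        set C := ∑ X ∈ D, added S₀ y a' X with hC
        have hC0 : 0 ≤ C := Finset.sum_nonneg fun X _ => hS0 X
        have h1 : 3 / (g' ^ 2 * Q) * (64 / 5 * 96 * g' * (C *
            (2 * Real.log (1 + 24576 * n ^ 3)))) =
            (36864 / 5 * Real.log (1 + 24576 * n ^ 3) / Q) * (C * g'⁻¹) := by
          field_simp
          ring
        rw [h1]
        refine mul_le_mul_of_nonneg_right ?_ (by positivity)
        rw [div_le_iff₀ (by linarith)]
        linarith

end SlowGreedy

end SlowGreedy

/-- Geometric: the smallest exponent contributes at most 3/2 · h⁻¹, and the series of ratio 2/3 adds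
the factor 3. -/
theorem sum_inv_pow_le {I : Finset ℕ} {h : ℝ} (hh : 0 < h)
    (hI : ∀ i ∈ I, h ≤ (3 / 2 : ℝ) ^ (i + 1)) :
    ∑ i ∈ I, ((3 / 2 : ℝ) ^ i)⁻¹ ≤ 9 / 2 * h⁻¹ := by
  rcases I.eq_empty_or_nonempty with rfl | hne
  · rw [Finset.sum_empty]
    positivity
  set m := I.min' hne with hm
  have h1 : ∀ i ∈ I, ((3 / 2 : ℝ) ^ i)⁻¹ = ((3 / 2 : ℝ) ^ m)⁻¹ * (2 / 3) ^ (i - m) := by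
    intro i hi
    have h2 : i = m + (i - m) := (Nat.add_sub_cancel' (I.min'_le i hi)).symm
    conv_lhs => rw [h2, pow_add, mul_inv]
    congr 1
    rw [← inv_pow]
    norm_num
  have hinj : Set.InjOn (fun i => i - m) I := by
    intro i hi j hj hij
    have h3 := I.min'_le i hi
    have h4 := I.min'_le j hj
    rw [← hm] at h3 h4
    simp only at hij
    omega
  rw [Finset.sum_congr rfl h1, ← Finset.mul_sum, ← Finset.sum_image (s := I)
    (g := fun i => i - m) (f := fun k => (2 / 3 : ℝ) ^ k) hinj]
  have h2 : ∑ k ∈ I.image (fun i => i - m), (2 / 3 : ℝ) ^ k ≤ 3 := by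
    have h3 := (summable_geometric_of_lt_one (r := (2 / 3 : ℝ)) (by norm_num)
      (by norm_num)).sum_le_tsum (I.image (fun i => i - m)) fun _ _ => by positivity
    rw [tsum_geometric_of_lt_one (by norm_num) (by norm_num)] at h3
    linarith
  have h3 := hI m (I.min'_mem hne)
  have h4 : ((3 / 2 : ℝ) ^ m)⁻¹ ≤ 3 / 2 * h⁻¹ := by
    rw [← div_eq_mul_inv, le_div_iff₀ hh, inv_mul_le_iff₀ (by positivity)]
    rw [pow_succ] at h3
    linarith
  calc ((3 / 2 : ℝ) ^ m)⁻¹ * ∑ k ∈ I.image (fun i => i - m), (2 / 3 : ℝ) ^ k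
      ≤ (3 / 2 * h⁻¹) * 3 := mul_le_mul h4 h2
        (Finset.sum_nonneg fun _ _ => by positivity) (by positivity)
    _ = 9 / 2 * h⁻¹ := by ring

/-- A sequence of numbers, each at least the square of the one before, that starts above `2` has at
most doubly logarithmic length. -/
theorem card_le_of_sq_le {I : Finset ℕ} {x : ℕ → ℝ} {b : ℕ} (hx : ∀ τ ∈ I, 2 ≤ x τ)
    (hsq : ∀ τ ∈ I, ∀ τ' ∈ I, τ < τ' → x τ ^ 2 ≤ x τ')
    (hb : ∀ τ ∈ I, ∀ τ' ∈ I, τ < τ' → x τ < 2 ^ 2 ^ b) : I.card ≤ b + 1 := by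
  rcases I.eq_empty_or_nonempty with rfl | hne
  · simp
  set m := I.max' hne with hm
  have hlt : ∀ τ ∈ I.erase m, τ < m := fun τ hτ =>
    lt_of_le_of_ne (I.le_max' τ (Finset.mem_of_mem_erase hτ)) (Finset.ne_of_mem_erase hτ)
  set φ : ℕ → ℝ := fun τ => Real.logb 2 (Real.logb 2 (x τ)) with hφ
  have hl1 : ∀ τ ∈ I, 1 ≤ Real.logb 2 (x τ) := fun τ hτ => by
    rw [Real.le_logb_iff_rpow_le (by norm_num) (by linarith [hx τ hτ]), Real.rpow_one]
    exact hx τ hτ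
  have hφ0 : ∀ τ ∈ I, 0 ≤ φ τ := fun τ hτ => Real.logb_nonneg (by norm_num) (hl1 τ hτ)
  have hstep : ∀ τ ∈ I, ∀ τ' ∈ I, τ < τ' → φ τ + 1 ≤ φ τ' := by
    intro τ hτ τ' hτ' h
    have h1 := hsq τ hτ τ' hτ' h
    have hxτ := hx τ hτ
    have h2 : 2 * Real.logb 2 (x τ) ≤ Real.logb 2 (x τ') := by
      have h3 : Real.logb 2 (x τ ^ 2) = 2 * Real.logb 2 (x τ) := by
        rw [Real.logb_pow]; norm_num
      rw [← h3]
      exact Real.logb_le_logb_of_le (by norm_num) (by positivity) h1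
    -- Squaring doubles the logarithm, so the iterated logarithm increases by at least one and its
    -- integer parts are distinct numbers below b. The last element is left out because it need not
    -- satisfy the upper bound.
    have h4 : Real.logb 2 (2 * Real.logb 2 (x τ)) = φ τ + 1 := by
      rw [Real.logb_mul (by norm_num) (by linarith [hl1 τ hτ]), Real.logb_self_eq_one (by norm_num)]
      ring
    rw [← h4]
    exact Real.logb_le_logb_of_le (by norm_num) (by linarith [hl1 τ hτ]) h2
  have hcard : (I.erase m).card ≤ (Finset.range b).card := by
    refine Finset.card_le_card_of_injOn (fun τ => ⌊φ τ⌋₊) (fun τ hτ => ?_) ?_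
    · have hτI := Finset.mem_of_mem_erase hτ
      have h1 := hb τ hτI m (I.max'_mem hne) (hlt τ hτ)
      have h2 : Real.logb 2 (x τ) < 2 ^ b := by
        rw [Real.logb_lt_iff_lt_rpow (by norm_num) (by linarith [hx τ hτI])]
        exact_mod_cast h1
      have h3 : φ τ < b := by
        rw [hφ]
        simp only
        rw [Real.logb_lt_iff_lt_rpow (by norm_num) (by linarith [hl1 τ hτI])]
        exact_mod_cast h2
      simp only [Finset.coe_range, Set.mem_Iio]
      exact (Nat.floor_lt (hφ0 τ hτI)).2 h3
    · have hmono : ∀ τ ∈ I, ∀ τ' ∈ I, τ < τ' → ⌊φ τ⌋₊ < ⌊φ τ'⌋₊ := by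
        intro τ hτ τ' hτ' h
        have h1 := Nat.floor_mono (hstep τ hτ τ' hτ' h)
        rw [Nat.floor_add_one (hφ0 τ hτ)] at h1
        omega
      intro τ hτ τ' hτ' he
      have hτ := Finset.mem_of_mem_erase hτ
      have hτ' := Finset.mem_of_mem_erase hτ'
      simp only at he
      rcases lt_trichotomy τ τ' with h | h | h
      · exact absurd he (hmono τ hτ τ' hτ' h).ne
      · exact h
      · exact absurd he (hmono τ' hτ' τ hτ h).ne'
  rw [Finset.card_range, Finset.card_erase_of_mem (I.max'_mem hne)] at hcard
  omega

/-! ### Non-isolated and typical service; the length of a slow greedy addition. -/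

section SlowGreedy

variable {U : Type*} [MetricSpace U] [Fintype U]
variable {D : Finset U} {S₀ : U → ℝ} {y : ℕ → U} {T : ℕ}
variable {s : ℕ → ℝ} {h ρ : U → ℝ} {n : ℕ} {κ A H : ℝ}

namespace SlowGreedy

/-- The centers that serve `X` in a regular way at the start of some level. -/
def servers (D : Finset U) (S₀ : U → ℝ) (y : ℕ → U) (s : ℕ → ℝ) (ρ : U → ℝ) (T n : ℕ) (X : U) :
    Finset ℕ :=
  (Finset.range T).filter fun τ => (servedLevels D S₀ y s ρ T n τ X).Nonempty

/-- The service by τ' begins after the start of the last level served by τ, and levels decrease in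
time. This drives the squaring in `typical_sum_le`. -/
theorem lev_le_lastLevel (G : SlowGreedy D S₀ y s h ρ T n κ A H) {X : U} {τ τ' : ℕ}
    (hτ : τ ∈ servers D S₀ y s ρ T n X) (hτ' : τ' ∈ servers D S₀ y s ρ T n X) (hlt : τ < τ') :
    lev D S₀ y τ' ≤ lastLevel D S₀ y s ρ T n τ X := by
  have h1 := lastLevel_mem (Finset.mem_filter.1 hτ).2
  have h2 := lastLevel_mem (Finset.mem_filter.1 hτ').2
  obtain ⟨h3, h4, -⟩ := Finset.mem_filter.1 h1
  obtain ⟨-, h5, -⟩ := Finset.mem_filter.1 h2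
  have h6 := h4.lt_of_ne h5 hlt
  have h7 := G.lev_anti h6 (Finset.mem_range.1 (Finset.mem_filter.1 hτ').1).le
  rwa [(start_spec h3).2] at h7

theorem injOn_lastLevel (X : U) :
    Set.InjOn (fun τ => lastLevel D S₀ y s ρ T n τ X) (servers D S₀ y s ρ T n X) := by
  intro τ hτ τ' hτ' he
  have h1 := lastLevel_mem (Finset.mem_filter.1 hτ).2
  have h2 := lastLevel_mem (Finset.mem_filter.1 hτ').2
  simp only at he
  rw [← he] at h2
  exact (Finset.mem_filter.1 h1).2.1.unique (Finset.mem_filter.1 h2).2.1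

theorem sum_inv_lastLevel_le {X : U} {I : Finset ℕ} (hI : I ⊆ servers D S₀ y s ρ T n X) {m : ℤ}
    (hm : ∀ τ ∈ I, m ≤ lastLevel D S₀ y s ρ T n τ X) :
    ∑ τ ∈ I, ((2 : ℝ) ^ lastLevel D S₀ y s ρ T n τ X)⁻¹ ≤ 2 * ((2 : ℝ) ^ m)⁻¹ :=
  sum_two_zpow_neg_le I _ ((injOn_lastLevel X).mono hI) m hm

/-- Summation over the bins of the masses. -/
theorem sum_le_of_bins (G : SlowGreedy D S₀ y s h ρ T n κ A H) {X : U} (hX : X ∈ D) {I : Finset ℕ}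
    (hI : I ⊆ servers D S₀ y s ρ T n X) {f : ℕ → ℝ} {K : ℝ} (hK : 0 ≤ K)
    (hf : ∀ i, ∑ τ ∈ I.filter (fun τ => bin (coreMass D y τ X) = i), f τ ≤
      K * ((3 / 2 : ℝ) ^ i)⁻¹) : ∑ τ ∈ I, f τ ≤ 9 / 2 * K * (h X)⁻¹ := by
  have hmaps : ∀ τ ∈ I, bin (coreMass D y τ X) ∈ I.image fun τ => bin (coreMass D y τ X) :=
    fun τ hτ => Finset.mem_image_of_mem _ hτ
  rw [← Finset.sum_fiberwise_of_maps_to hmaps]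
  refine (Finset.sum_le_sum fun i _ => hf i).trans ?_
  rw [← Finset.mul_sum]
  have h1 := sum_inv_pow_le (I := I.image fun τ => bin (coreMass D y τ X)) (G.h_pos X hX) ?_
  · have := mul_le_mul_of_nonneg_left h1 hK
    linarith
  · intro i hi
    obtain ⟨τ, hτ, rfl⟩ := Finset.mem_image.1 hi
    have h2 := lastLevel_mem (Finset.mem_filter.1 (hI hτ)).2
    exact (G.served_spec hX h2).2.2.2.2.1.trans (lt_pow_bin (one_le_coreMass hX τ)).le

theorem term_le (G : SlowGreedy D S₀ y s h ρ T n κ A H) {X : U} (hX : X ∈ D) {τ : ℕ}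
    (hτ : τ ∈ servers D S₀ y s ρ T n X) :
    dist X (y τ) * ((2 : ℝ) ^ lastLevel D S₀ y s ρ T n τ X)⁻¹ ≤
      3 * ((3 / 2 : ℝ) ^ bin (coreMass D y τ X))⁻¹ := by
  have h1 := lastLevel_mem (Finset.mem_filter.1 hτ).2
  obtain ⟨-, -, -, -, -, h2, -⟩ := G.served_spec hX h1
  have h3 := pow_bin_le (one_le_coreMass (y := y) hX τ)
  have h4 : 0 ≤ dist X (y τ) := dist_nonneg
  rw [← div_eq_mul_inv, ← div_eq_mul_inv, div_le_div_iff₀ (by positivity) (by positivity)]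
  exact (mul_le_mul_of_nonneg_left h3 h4).trans h2

/-- Within one bin, compare with the server σ of lowest last level. A server more than 64 times as
far would have a core containing the ball of radius 4 · dist X (y σ), whose mass already exceeds the
bin. So all distances are comparable, and the last levels are distinct, which makes the sum
geometric: 64 · 2 · 3 = 384. -/
theorem static_sum_le (G : SlowGreedy D S₀ y s h ρ T n κ A H) {X : U} (hX : X ∈ D) :
    ∑ τ ∈ (servers D S₀ y s ρ T n X).filter (fun τ => ¬ IsIsolated D X (dist X (y τ))),
      dist X (y τ) * ((2 : ℝ) ^ lastLevel D S₀ y s ρ T n τ X)⁻¹ ≤ 9 / 2 * 384 * (h X)⁻¹ := by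
  refine G.sum_le_of_bins hX (Finset.filter_subset _ _) (by norm_num) fun i => ?_
  set I := ((servers D S₀ y s ρ T n X).filter fun τ => ¬ IsIsolated D X (dist X (y τ))).filter
    fun τ => bin (coreMass D y τ X) = i with hI
  rcases I.eq_empty_or_nonempty with he | hne
  · rw [he, Finset.sum_empty]
    positivity
  obtain ⟨σ, hσ, hmin⟩ := I.exists_min_image (fun τ => lastLevel D S₀ y s ρ T n τ X) hne
  obtain ⟨hσ1, hσi⟩ := Finset.mem_filter.1 hσ
  obtain ⟨hσs, hσiso⟩ := Finset.mem_filter.1 hσ1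
  have hle : ∀ τ ∈ I, dist X (y τ) ≤ 64 * dist X (y σ) := by
    intro τ hτ
    obtain ⟨hτ1, hτi⟩ := Finset.mem_filter.1 hτ
    by_contra hcon
    push Not at hcon
    refine hσiso ?_
    have h1 : mass D X (4 * dist X (y σ)) ≤ coreMass D y τ X := mass_mono D X (by linarith)
    have h2 := lt_pow_bin (one_le_coreMass (y := y) hX τ)
    rw [hτi, ← hσi] at h2
    exact h1.trans_lt h2
  have hsub : I ⊆ servers D S₀ y s ρ T n X :=
    (Finset.filter_subset _ _).trans (Finset.filter_subset _ _)
  have h1 := sum_inv_lastLevel_le hsub hmin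
  have h2 := G.term_le hX hσs
  rw [hσi] at h2
  have h0 : 0 ≤ dist X (y σ) := dist_nonneg
  calc ∑ τ ∈ I, dist X (y τ) * ((2 : ℝ) ^ lastLevel D S₀ y s ρ T n τ X)⁻¹
      ≤ ∑ τ ∈ I, 64 * dist X (y σ) * ((2 : ℝ) ^ lastLevel D S₀ y s ρ T n τ X)⁻¹ :=
        Finset.sum_le_sum fun τ hτ => mul_le_mul_of_nonneg_right (hle τ hτ) (by positivity)
    _ = 64 * dist X (y σ) * ∑ τ ∈ I, ((2 : ℝ) ^ lastLevel D S₀ y s ρ T n τ X)⁻¹ := by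
        rw [Finset.mul_sum]
    _ ≤ 64 * dist X (y σ) * (2 * ((2 : ℝ) ^ lastLevel D S₀ y s ρ T n σ X)⁻¹) :=
        mul_le_mul_of_nonneg_left h1 (by positivity)
    _ ≤ 384 * ((3 / 2 : ℝ) ^ i)⁻¹ := by linarith

/-- The radius R and the spread v = w R depend only on X and the bin. Last levels above v form a
geometric series, since distances are at most R / 4. Between v / (2 Q) and v there are at most q + 2
distinct levels, where Q = 2^q. Below that, v / (2^ℓ Q) is at least squared from one server to the
next and stays under 12 n except at the last server, so b + 1 servers remain. -/
theorem typical_sum_le (G : SlowGreedy D S₀ y s h ρ T n κ A H) {q b : ℕ}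
    (hb : (12 * n : ℝ) ≤ 2 ^ 2 ^ b) {X : U} (hX : X ∈ D) :
    ∑ τ ∈ (servers D S₀ y s ρ T n X).filter (fun τ => IsIsolated D X (dist X (y τ)) ∧
        ¬ IsAtypical D S₀ y s ρ T n (2 ^ q) τ X),
      dist X (y τ) * ((2 : ℝ) ^ lastLevel D S₀ y s ρ T n τ X)⁻¹ ≤
        9 / 2 * (10 + 3 * q + 3 * b) * (h X)⁻¹ := by
  refine G.sum_le_of_bins hX (Finset.filter_subset _ _) (by positivity) fun i => ?_
  set I := ((servers D S₀ y s ρ T n X).filter fun τ => IsIsolated D X (dist X (y τ)) ∧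
    ¬ IsAtypical D S₀ y s ρ T n (2 ^ q) τ X).filter fun τ => bin (coreMass D y τ X) = i with hI
  set w : ℝ := (3 / 2) ^ (i + 1) with hw
  set R := massRadius D X w with hR
  set v := w * R with hv
  set ℓ : ℕ → ℤ := fun τ => lastLevel D S₀ y s ρ T n τ X with hℓ
  have hw0 : 0 < w := by positivity
  have hn : (1 : ℝ) ≤ n := by exact_mod_cast G.n_pos
  have hQ1 : (1 : ℝ) ≤ 2 ^ q := one_le_pow₀ (by norm_num)
  have hspec : ∀ τ ∈ I, τ ∈ servers D S₀ y s ρ T n X ∧ 4 * dist X (y τ) ≤ R ∧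
      R < 8 * 2 ^ lev D S₀ y τ ∧ 0 < dist X (y τ) ∧ w ≤ 3 / 2 * n ∧
      v * 2 ^ ℓ τ ≤ ((2 : ℝ) ^ lev D S₀ y τ) ^ 2 * 2 ^ q ∧
      dist X (y τ) * ((2 : ℝ) ^ ℓ τ)⁻¹ ≤ 3 * ((3 / 2 : ℝ) ^ i)⁻¹ := by
    intro τ hτ
    obtain ⟨hτ1, hτi⟩ := Finset.mem_filter.1 hτ
    obtain ⟨hτs, hiso, hat⟩ := Finset.mem_filter.1 hτ1
    have hne := (Finset.mem_filter.1 hτs).2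
    have hmem := lastLevel_mem hne
    obtain ⟨-, -, -, -, -, -, -, hu, -⟩ := G.served_spec hX hmem
    obtain ⟨h4u, hR8, -⟩ := G.isolated_spec hX hmem hiso
    have hcb : coreBound D y τ X = w := by rw [coreBound, hτi]
    have h1 := coreBound_le (y := y) hX τ
    have hWn : coreMass D y τ X ≤ n :=
      (mass_le_card D X _).trans (by exact_mod_cast G.card_le)
    rw [hcb] at h4u hR8 h1
    have h2 := G.term_le hX hτs
    rw [hτi] at h2
    refine ⟨hτs, h4u, hR8, hu, by linarith, ?_, h2⟩
    by_contra hcon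
    push Not at hcon
    refine hat ⟨hne, hiso, ?_⟩
    rw [spread, hcb]
    exact hcon
  have hsub : I ⊆ servers D S₀ y s ρ T n X := fun τ hτ => (hspec τ hτ).1
  set f : ℕ → ℝ := fun τ => dist X (y τ) * ((2 : ℝ) ^ ℓ τ)⁻¹ with hf
  set B : ℝ := ((3 / 2 : ℝ) ^ i)⁻¹ with hB
  have hB0 : 0 < B := by positivity
  -- levels above `v`
  have ha : ∑ τ ∈ I.filter (fun τ => v ≤ 2 ^ ℓ τ), f τ ≤ B := by
    rcases (I.filter (fun τ => v ≤ (2 : ℝ) ^ ℓ τ)).eq_empty_or_nonempty with he | hne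
    · rw [he, Finset.sum_empty]
      exact hB0.le
    obtain ⟨σ, hσ, hmin⟩ := (I.filter (fun τ => v ≤ (2 : ℝ) ^ ℓ τ)).exists_min_image ℓ hne
    obtain ⟨hσI, hσv⟩ := Finset.mem_filter.1 hσ
    obtain ⟨-, h4, -, hu, -⟩ := hspec σ hσI
    have hR0 : 0 < R := by linarith
    have h1 := sum_inv_lastLevel_le ((Finset.filter_subset _ _).trans hsub) hmin
    calc ∑ τ ∈ I.filter (fun τ => v ≤ (2 : ℝ) ^ ℓ τ), f τ
        ≤ ∑ τ ∈ I.filter (fun τ => v ≤ (2 : ℝ) ^ ℓ τ), R / 4 * ((2 : ℝ) ^ ℓ τ)⁻¹ := by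
          refine Finset.sum_le_sum fun τ hτ => mul_le_mul_of_nonneg_right ?_ (by positivity)
          have := (hspec τ (Finset.mem_filter.1 hτ).1).2.1
          linarith
      _ = R / 4 * ∑ τ ∈ I.filter (fun τ => v ≤ (2 : ℝ) ^ ℓ τ), ((2 : ℝ) ^ ℓ τ)⁻¹ := by
          rw [Finset.mul_sum]
      _ ≤ R / 4 * (2 * ((2 : ℝ) ^ ℓ σ)⁻¹) := mul_le_mul_of_nonneg_left h1 (by positivity)
      _ ≤ R / 4 * (2 * v⁻¹) := by
          have : 0 < v := by positivity
          gcongr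
      _ = 1 / 2 * w⁻¹ := by
          rw [hv]
          field_simp
          norm_num
      _ ≤ B := by
          have h2 : w⁻¹ = 2 / 3 * B := by
            rw [hw, hB, pow_succ, mul_inv]
            ring
          rw [h2]
          linarith
  -- levels between `v / (2 * Q)` and `v`
  have hbd : ∑ τ ∈ I.filter (fun τ => ¬ v ≤ 2 ^ ℓ τ ∧ v ≤ 2 ^ ℓ τ * (2 * 2 ^ q)), f τ ≤
      (q + 2) * (3 * B) := by
    set K := I.filter (fun τ => ¬ v ≤ (2 : ℝ) ^ ℓ τ ∧ v ≤ 2 ^ ℓ τ * (2 * 2 ^ q)) with hK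
    have h1 : K.card ≤ q + 2 := by
      set m := Int.log 2 v with hm
      have h2 : K.card ≤ (Finset.Icc (m - q - 1) m).card := by
        refine Finset.card_le_card_of_injOn ℓ (fun τ hτ => ?_)
          ((injOn_lastLevel X).mono ((Finset.filter_subset _ _).trans hsub))
        obtain ⟨hτI, h3, h4⟩ := Finset.mem_filter.1 hτ
        obtain ⟨-, h5, -, hu, -⟩ := hspec τ hτI
        have hv0 : 0 < v := mul_pos hw0 (by linarith)
        have h6 : (2 : ℝ) ^ m ≤ v := Int.zpow_log_le_self (b := 2) (by norm_num) hv0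
        have h7 : v < (2 : ℝ) ^ (m + 1) := Int.lt_zpow_succ_log_self (b := 2) (by norm_num) v
        have h8 : ℓ τ < m + 1 :=
          (zpow_lt_zpow_iff_right₀ (by norm_num : (1 : ℝ) < 2)).1 ((not_le.1 h3).trans h7)
        have h9 : (2 : ℝ) ^ ℓ τ * (2 * 2 ^ q) = 2 ^ (ℓ τ + (q + 1)) := by
          rw [zpow_add₀ (by norm_num), zpow_add₀ (by norm_num), zpow_one, zpow_natCast]
          ring
        rw [h9] at h4
        have h10 : m ≤ ℓ τ + (q + 1) :=
          (zpow_le_zpow_iff_right₀ (by norm_num : (1 : ℝ) < 2)).1 (h6.trans h4)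
        simp only [Finset.coe_Icc, Set.mem_Icc]
        constructor <;> omega
      refine h2.trans ?_
      rw [Int.card_Icc]
      omega
    calc ∑ τ ∈ K, f τ ≤ ∑ _ ∈ K, 3 * B :=
          Finset.sum_le_sum fun τ hτ => (hspec τ (Finset.mem_filter.1 hτ).1).2.2.2.2.2.2
      _ = K.card * (3 * B) := by rw [Finset.sum_const, nsmul_eq_mul]
      _ ≤ (q + 2) * (3 * B) := by
          refine mul_le_mul_of_nonneg_right ?_ (by positivity)
          exact_mod_cast h1
  -- levels below `v / (2 * Q)`
  have hc : ∑ τ ∈ I.filter (fun τ => ¬ v ≤ 2 ^ ℓ τ ∧ ¬ v ≤ 2 ^ ℓ τ * (2 * 2 ^ q)), f τ ≤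
      (b + 1) * (3 * B) := by
    set K := I.filter (fun τ => ¬ v ≤ (2 : ℝ) ^ ℓ τ ∧ ¬ v ≤ 2 ^ ℓ τ * (2 * 2 ^ q)) with hK
    have hKs : ∀ τ ∈ K, ∀ τ' ∈ K, τ < τ' → v / (2 ^ ℓ τ * 2 ^ q) ≤
        v / ((2 : ℝ) ^ lev D S₀ y τ' * 2 ^ q) ∧ 0 < v := by
      intro τ hτ τ' hτ' hlt
      obtain ⟨hτI, -, -⟩ := Finset.mem_filter.1 hτ
      obtain ⟨hτI', -, -⟩ := Finset.mem_filter.1 hτ'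
      obtain ⟨-, h5, -, hu, -⟩ := hspec τ hτI
      have hv0 : 0 < v := mul_pos hw0 (by linarith)
      have h1 := G.lev_le_lastLevel (hsub hτI) (hsub hτI') hlt
      refine ⟨?_, hv0⟩
      have h2 : (2 : ℝ) ^ lev D S₀ y τ' ≤ 2 ^ ℓ τ := zpow_le_zpow_right₀ (by norm_num) h1
      gcongr
    have h1 : K.card ≤ b + 1 := by
      refine card_le_of_sq_le (x := fun τ => v / (2 ^ ℓ τ * 2 ^ q)) (fun τ hτ => ?_)
        (fun τ hτ τ' hτ' hlt => ?_) (fun τ hτ τ' hτ' hlt => ?_)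
      · obtain ⟨-, -, h2⟩ := Finset.mem_filter.1 hτ
        rw [le_div_iff₀ (by positivity)]
        linarith
      -- With τ before τ', the level of τ' is at most the last level of τ, and typicality of τ'
      -- bounds v · 2^ℓ by the square of 2^lev times Q.
      · obtain ⟨h2, hv0⟩ := hKs τ hτ τ' hτ' hlt
        obtain ⟨-, -, -, -, -, h3, -⟩ := hspec τ' (Finset.mem_filter.1 hτ').1
        refine (pow_le_pow_left₀ (by positivity) h2 2).trans ?_
        rw [div_pow, div_le_div_iff₀ (by positivity) (by positivity)]
        have h4 := mul_le_mul_of_nonneg_left h3 (show 0 ≤ v * 2 ^ q by positivity)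
        linarith
      · obtain ⟨h2, hv0⟩ := hKs τ hτ τ' hτ' hlt
        obtain ⟨-, -, h8, hu, h3, -, -⟩ := hspec τ' (Finset.mem_filter.1 hτ').1
        refine h2.trans_lt (lt_of_lt_of_le ?_ hb)
        rw [div_lt_iff₀ (by positivity)]
        have h4 : v ≤ 3 / 2 * n * R := by
          rw [hv]
          refine mul_le_mul_of_nonneg_right h3 ?_
          by_contra hcon
          push Not at hcon
          exact absurd hv0 (not_lt.2 (mul_nonpos_of_nonneg_of_nonpos hw0.le hcon.le))
        have h5 : 3 / 2 * (n : ℝ) * R < 3 / 2 * n * (8 * 2 ^ lev D S₀ y τ') :=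
          mul_lt_mul_of_pos_left h8 (by positivity)
        have h6 : (0 : ℝ) < 2 ^ lev D S₀ y τ' := by positivity
        have h7 : 12 * (n : ℝ) * 2 ^ lev D S₀ y τ' * 1 ≤ 12 * n * 2 ^ lev D S₀ y τ' * 2 ^ q :=
          mul_le_mul_of_nonneg_left hQ1 (by positivity)
        linarith
    calc ∑ τ ∈ K, f τ ≤ ∑ _ ∈ K, 3 * B :=
          Finset.sum_le_sum fun τ hτ => (hspec τ (Finset.mem_filter.1 hτ).1).2.2.2.2.2.2
      _ = K.card * (3 * B) := by rw [Finset.sum_const, nsmul_eq_mul]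
      _ ≤ (b + 1) * (3 * B) := by
          refine mul_le_mul_of_nonneg_right ?_ (by positivity)
          exact_mod_cast h1
  have hsplit : ∑ τ ∈ I, f τ = ∑ τ ∈ I.filter (fun τ => v ≤ 2 ^ ℓ τ), f τ +
      (∑ τ ∈ I.filter (fun τ => ¬ v ≤ 2 ^ ℓ τ ∧ v ≤ 2 ^ ℓ τ * (2 * 2 ^ q)), f τ +
      ∑ τ ∈ I.filter (fun τ => ¬ v ≤ 2 ^ ℓ τ ∧ ¬ v ≤ 2 ^ ℓ τ * (2 * 2 ^ q)), f τ) := by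
    rw [← Finset.filter_filter, ← Finset.filter_filter, Finset.sum_filter_add_sum_filter_not,
      Finset.sum_filter_add_sum_filter_not]
  show ∑ τ ∈ I, f τ ≤ _
  rw [hsplit]
  linarith

/-- The levels served by one center have a constant distance in the numerator, so they form a
geometric series dominated by twice the term of the last level. The levels at which the initial cost
of X still applies give the term 6 / h. -/
theorem regular_sum_le (G : SlowGreedy D S₀ y s h ρ T n κ A H) {X : U} (hX : X ∈ D) :
    ∑ j ∈ (levels D S₀ y T).filter (fun j => Regular D S₀ y s ρ n (start D S₀ y j) X),
      added S₀ y (start D S₀ y j) X * ((2 : ℝ) ^ j)⁻¹ ≤ 6 * (h X)⁻¹ +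
      ∑ τ ∈ servers D S₀ y s ρ T n X,
        2 * (dist X (y τ) * ((2 : ℝ) ^ lastLevel D S₀ y s ρ T n τ X)⁻¹) := by
  set L := (levels D S₀ y T).filter fun j => Regular D S₀ y s ρ n (start D S₀ y j) X with hL
  set f : ℤ → ℝ := fun j => added S₀ y (start D S₀ y j) X * ((2 : ℝ) ^ j)⁻¹ with hf
  have hf0 : ∀ j, 0 ≤ f j := fun j =>
    mul_nonneg (added_nonneg G.nonneg _ X) (by positivity)
  have hh := G.h_pos X hX
  have hinit : ∑ j ∈ L.filter (fun j => added S₀ y (start D S₀ y j) X = S₀ X), f j ≤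
      6 * (h X)⁻¹ := by
    set L' := L.filter fun j => added S₀ y (start D S₀ y j) X = S₀ X with hL'
    rcases L'.eq_empty_or_nonempty with he | hne
    · rw [he, Finset.sum_empty]
      positivity
    set m := L'.min' hne with hm
    obtain ⟨hmL, hmeq⟩ := Finset.mem_filter.1 (L'.min'_mem hne)
    obtain ⟨hml, hmr⟩ := Finset.mem_filter.1 hmL
    have h1 := sum_two_zpow_neg_le L' (fun j => j) (fun _ _ _ _ h => h) m
      fun j hj => L'.min'_le j hj
    have h2 := G.mass_mul_le (start D S₀ y m) X
    have h3 := G.lt_zpow_lev (start D S₀ y m)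
    rw [(start_spec hml).2] at h3
    rw [hmeq] at h2
    have h4 : h X ≤ mass D X (S₀ X / 16) := G.h_le_mass hX (by
      have := hmr.1
      rw [hmeq] at this
      linarith)
    have h5 := mul_le_mul_of_nonneg_right h4 (G.nonneg X)
    have h6 : S₀ X * ((2 : ℝ) ^ m)⁻¹ ≤ 3 * (h X)⁻¹ := by
      rw [← div_eq_mul_inv, ← div_eq_mul_inv, div_le_div_iff₀ (by positivity) hh]
      have : (0 : ℝ) < 2 ^ m := by positivity
      linarith
    calc ∑ j ∈ L', f j = S₀ X * ∑ j ∈ L', ((2 : ℝ) ^ j)⁻¹ := by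
          rw [Finset.mul_sum]
          refine Finset.sum_congr rfl fun j hj => ?_
          simp only [hf]
          rw [(Finset.mem_filter.1 hj).2]
      _ ≤ S₀ X * (2 * ((2 : ℝ) ^ m)⁻¹) := mul_le_mul_of_nonneg_left h1 (G.nonneg X)
      _ ≤ 6 * (h X)⁻¹ := by linarith
  have hrest : ∑ j ∈ L.filter (fun j => ¬ added S₀ y (start D S₀ y j) X = S₀ X), f j ≤
      ∑ τ ∈ servers D S₀ y s ρ T n X,
        2 * (dist X (y τ) * ((2 : ℝ) ^ lastLevel D S₀ y s ρ T n τ X)⁻¹) := by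
    calc ∑ j ∈ L.filter (fun j => ¬ added S₀ y (start D S₀ y j) X = S₀ X), f j
        ≤ ∑ j ∈ L.filter (fun j => ¬ added S₀ y (start D S₀ y j) X = S₀ X),
          ∑ τ ∈ servers D S₀ y s ρ T n X,
            if j ∈ servedLevels D S₀ y s ρ T n τ X then f j else 0 := by
          refine Finset.sum_le_sum fun j hj => ?_
          obtain ⟨hjL, hne⟩ := Finset.mem_filter.1 hj
          obtain ⟨hjl, hreg⟩ := Finset.mem_filter.1 hjL
          obtain ⟨τ, hτ⟩ := exists_isCaptor hne
          have hmem : j ∈ servedLevels D S₀ y s ρ T n τ X :=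
            Finset.mem_filter.2 ⟨hjl, hτ, hreg⟩
          have hτs : τ ∈ servers D S₀ y s ρ T n X :=
            Finset.mem_filter.2 ⟨Finset.mem_range.2 (G.served_spec hX hmem).1, ⟨j, hmem⟩⟩
          have h1 := Finset.single_le_sum
            (f := fun τ => if j ∈ servedLevels D S₀ y s ρ T n τ X then f j else 0)
            (fun τ _ => by split_ifs; exacts [hf0 j, le_rfl]) hτs
          simp only [hmem, if_true] at h1
          exact h1
      _ = ∑ τ ∈ servers D S₀ y s ρ T n X,
          ∑ j ∈ L.filter (fun j => ¬ added S₀ y (start D S₀ y j) X = S₀ X),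
            if j ∈ servedLevels D S₀ y s ρ T n τ X then f j else 0 := Finset.sum_comm
      _ ≤ _ := by
          refine Finset.sum_le_sum fun τ hτ => ?_
          rw [← Finset.sum_filter]
          have h1 := sum_two_zpow_neg_le (servedLevels D S₀ y s ρ T n τ X) (fun j => j)
            (fun _ _ _ _ h => h) (lastLevel D S₀ y s ρ T n τ X) fun j hj => lastLevel_le hj
          have h0 : 0 ≤ dist X (y τ) := dist_nonneg
          calc _ ≤ ∑ j ∈ servedLevels D S₀ y s ρ T n τ X, dist X (y τ) * ((2 : ℝ) ^ j)⁻¹ := by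
                refine le_trans (Finset.sum_le_sum
                  (g := fun j => dist X (y τ) * ((2 : ℝ) ^ j)⁻¹) fun j hj => ?_)
                  (Finset.sum_le_sum_of_subset_of_nonneg
                    (fun j hj => (Finset.mem_filter.1 hj).2) fun _ _ _ => by positivity)
                have h2 := (G.served_spec hX (Finset.mem_filter.1 hj).2).2.2.2.1
                simp only [hf]
                rw [h2]
            _ = dist X (y τ) * ∑ j ∈ servedLevels D S₀ y s ρ T n τ X, ((2 : ℝ) ^ j)⁻¹ := by
                rw [Finset.mul_sum]
            _ ≤ dist X (y τ) * (2 * ((2 : ℝ) ^ lastLevel D S₀ y s ρ T n τ X)⁻¹) :=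
                mul_le_mul_of_nonneg_left h1 h0
            _ = _ := by ring
  rw [← Finset.sum_filter_add_sum_filter_not L fun j => added S₀ y (start D S₀ y j) X = S₀ X]
  linarith

/-- Greedy addition of centers cannot remain slow for a long time. -/
theorem length_le (G : SlowGreedy D S₀ y s h ρ T n κ A H) {q b : ℕ}
    (hq : 65536 * Real.log (1 + 24576 * n ^ 3) ≤ 2 ^ q) (hb : (12 * n : ℝ) ≤ 2 ^ 2 ^ b) :
    (T : ℝ) ≤ κ * (18945 + 144 * (q + b)) := by
  set N := ∑ j ∈ levels D S₀ y T,
    (∑ X ∈ D, added S₀ y (start D S₀ y j) X) * ((2 : ℝ) ^ j)⁻¹ with hN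
  have hQ1 : (1 : ℝ) ≤ 2 ^ q := one_le_pow₀ (by norm_num)
  have hT : (T : ℝ) ≤ κ + 2 * N := G.steps_le
  have hN1 : N ≤ 2 * ∑ X ∈ D, ∑ j ∈ (levels D S₀ y T).filter
      (fun j => Regular D S₀ y s ρ n (start D S₀ y j) X),
      added S₀ y (start D S₀ y j) X * ((2 : ℝ) ^ j)⁻¹ := by
    have h1 : ∑ X ∈ D, ∑ j ∈ (levels D S₀ y T).filter
        (fun j => Regular D S₀ y s ρ n (start D S₀ y j) X),
        added S₀ y (start D S₀ y j) X * ((2 : ℝ) ^ j)⁻¹ =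
        ∑ j ∈ levels D S₀ y T, (∑ X ∈ D.filter
          (fun X => Regular D S₀ y s ρ n (start D S₀ y j) X),
          added S₀ y (start D S₀ y j) X) * ((2 : ℝ) ^ j)⁻¹ := by
      simp_rw [Finset.sum_filter, Finset.sum_mul]
      rw [Finset.sum_comm]
      refine Finset.sum_congr rfl fun j _ => Finset.sum_congr rfl fun X _ => ?_
      split_ifs <;> simp
    rw [h1, Finset.mul_sum]
    refine Finset.sum_le_sum fun j hj => ?_
    rw [← mul_assoc]
    refine mul_le_mul_of_nonneg_right ?_ (by positivity)
    have h2 := G.sum_not_regular_le (start_spec hj).1.le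
    have h3 := Finset.sum_filter_add_sum_filter_not D
      (fun X => Regular D S₀ y s ρ n (start D S₀ y j) X)
      fun X => added S₀ y (start D S₀ y j) X
    linarith
  have hat : ∑ X ∈ D, ∑ τ ∈ (servers D S₀ y s ρ T n X).filter
      (fun τ => IsAtypical D S₀ y s ρ T n (2 ^ q) τ X),
      2 * (dist X (y τ) * ((2 : ℝ) ^ lastLevel D S₀ y s ρ T n τ X)⁻¹) ≤ 1 / 8 * N := by
    have h1 : ∀ X ∈ D, (servers D S₀ y s ρ T n X).filter
        (fun τ => IsAtypical D S₀ y s ρ T n (2 ^ q) τ X) =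
        (Finset.range T).filter fun τ => IsAtypical D S₀ y s ρ T n (2 ^ q) τ X := by
      intro X _
      ext τ
      simp only [servers, Finset.mem_filter]
      exact ⟨fun h => ⟨h.1.1, h.2⟩, fun h => ⟨⟨h.1, h.2.1⟩, h.2⟩⟩
    rw [Finset.sum_congr rfl fun X hX => by rw [h1 X hX]]
    simp_rw [Finset.sum_filter]
    rw [Finset.sum_comm]
    simp_rw [← Finset.sum_filter]
    have hmaps : ∀ τ ∈ Finset.range T, lev D S₀ y τ ∈ levels D S₀ y T := fun τ hτ =>
      lev_mem_levels (Finset.mem_range.1 hτ)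
    rw [← Finset.sum_fiberwise_of_maps_to hmaps, hN, Finset.mul_sum]
    exact Finset.sum_le_sum fun j hj => G.atypical_sum_le hQ1 hq hj
  have hX : ∀ X ∈ D, ∑ j ∈ (levels D S₀ y T).filter
      (fun j => Regular D S₀ y s ρ n (start D S₀ y j) X),
      added S₀ y (start D S₀ y j) X * ((2 : ℝ) ^ j)⁻¹ ≤
      (3552 + 27 * (q + b)) * (h X)⁻¹ + ∑ τ ∈ (servers D S₀ y s ρ T n X).filter
      (fun τ => IsAtypical D S₀ y s ρ T n (2 ^ q) τ X),
      2 * (dist X (y τ) * ((2 : ℝ) ^ lastLevel D S₀ y s ρ T n τ X)⁻¹) := by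
    intro X hX
    have h1 := G.regular_sum_le hX
    have h2 := G.static_sum_le hX
    have h3 := G.typical_sum_le (q := q) hb hX
    set f : ℕ → ℝ := fun τ => dist X (y τ) * ((2 : ℝ) ^ lastLevel D S₀ y s ρ T n τ X)⁻¹ with hf
    have h4 : ∑ τ ∈ servers D S₀ y s ρ T n X, f τ =
        ∑ τ ∈ (servers D S₀ y s ρ T n X).filter
          (fun τ => IsAtypical D S₀ y s ρ T n (2 ^ q) τ X), f τ +
        (∑ τ ∈ (servers D S₀ y s ρ T n X).filter (fun τ => IsIsolated D X (dist X (y τ)) ∧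
          ¬ IsAtypical D S₀ y s ρ T n (2 ^ q) τ X), f τ +
        ∑ τ ∈ (servers D S₀ y s ρ T n X).filter
          (fun τ => ¬ IsIsolated D X (dist X (y τ))), f τ) := by
      rw [← Finset.sum_filter_add_sum_filter_not (servers D S₀ y s ρ T n X)
        fun τ => IsIsolated D X (dist X (y τ)),
        ← Finset.sum_filter_add_sum_filter_not ((servers D S₀ y s ρ T n X).filter
          fun τ => IsIsolated D X (dist X (y τ)))
          fun τ => IsAtypical D S₀ y s ρ T n (2 ^ q) τ X, Finset.filter_filter,
        Finset.filter_filter, add_assoc]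
      congr 2
      refine Finset.filter_congr fun τ _ => ?_
      exact ⟨fun h => h.2, fun h => ⟨h.2.1, h⟩⟩
    -- The constants: 6 + 2 · 9/2 · (384 + 10) = 3552 and 2 · 9/2 · 3 = 27.
    rw [← Finset.mul_sum] at h1 ⊢
    rw [h4] at h1
    linarith
  -- The sum N occurs on both sides: N ≤ 2 ((3552 + 27 (q + b)) κ + N / 8), which is solved for N
  -- and inserted into T ≤ κ + 2 N.
  have hsum := Finset.sum_le_sum hX
  rw [Finset.sum_add_distrib, ← Finset.mul_sum] at hsum
  have h1 : (3552 + 27 * ((q : ℝ) + b)) * ∑ X ∈ D, (h X)⁻¹ ≤ (3552 + 27 * (q + b)) * κ :=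
    mul_le_mul_of_nonneg_left G.sum_h (by positivity)
  linarith

end SlowGreedy

end SlowGreedy

/-! ### Swaps and reference centers -/

/-- The pairing of local search for k-median, with η o the current center closest to o. A reference
center that is alone at its η o is paired with it. The others are distributed over the current
centers that attract no reference center, at most two to each. -/
theorem exists_pairing {U : Type*} {M F : Finset U} (hM : M.card ≤ F.card) (η : U → U)
    (hη : ∀ o ∈ M, η o ∈ F) :
    ∃ f : U → U, (∀ o ∈ M, f o ∈ F) ∧ (∀ o ∈ M, ∀ o' ∈ M, o' ≠ o → η o' ≠ f o) ∧
      ∀ x, (M.filter fun o => f o = x).card ≤ 2 := by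
  set cap : U → Finset U := fun x => M.filter fun o => η o = x with hcap
  set B := M.filter fun o => 2 ≤ (cap (η o)).card with hB
  set Z := F.filter fun x => (cap x).card = 0 with hZ
  have hcard : B.card ≤ 2 * Z.card := by
    have h1 : M.card = ∑ x ∈ F, (cap x).card := Finset.card_eq_sum_card_fiberwise hη
    have h2 : B.card = ∑ x ∈ F, if 2 ≤ (cap x).card then (cap x).card else 0 := by
      rw [Finset.card_eq_sum_card_fiberwise (f := η) (t := F)
        fun o ho => hη o (Finset.mem_filter.1 ho).1]
      refine Finset.sum_congr rfl fun x _ => ?_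
      split_ifs with h
      · congr 1
        ext o
        simp only [hcap, Finset.mem_filter]
        constructor
        · rintro ⟨⟨h3, -⟩, h4⟩
          exact ⟨h3, h4⟩
        · rintro ⟨h3, h4⟩
          refine ⟨⟨h3, ?_⟩, h4⟩
          rw [h4]
          exact h
      · rw [Finset.card_eq_zero, Finset.filter_eq_empty_iff]
        intro o ho h3
        refine h ?_
        rw [← h3]
        exact (Finset.mem_filter.1 ho).2
    have h3 : Z.card = ∑ x ∈ F, if (cap x).card = 0 then 1 else 0 := by
      rw [hZ, Finset.card_filter]
    -- Summed over F, this counts |B| + 2 |F| ≤ 2 |Z| + 2 |M|, so |M| ≤ |F| leaves enough free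
    -- centers.
    have h4 : ∀ x ∈ F, (if 2 ≤ (cap x).card then (cap x).card else 0) + 2 ≤
        2 * (if (cap x).card = 0 then 1 else 0) + 2 * (cap x).card := by
      intro x _
      split_ifs <;> omega
    have h5 := Finset.sum_le_sum h4
    rw [Finset.sum_add_distrib, Finset.sum_add_distrib, ← Finset.mul_sum, ← Finset.mul_sum, ← h1,
      ← h2, ← h3, Finset.sum_const, smul_eq_mul] at h5
    omega
  obtain ⟨g⟩ : Nonempty (B ↪ (Z ×ˢ (Finset.univ : Finset (Fin 2)) : Finset (U × Fin 2))) := by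
    refine Function.Embedding.nonempty_of_card_le ?_
    rw [Fintype.card_coe, Fintype.card_coe, Finset.card_product, Finset.card_univ, Fintype.card_fin]
    omega
  have hg : ∀ o (h : o ∈ B), (g ⟨o, h⟩).1.1 ∈ Z := fun o h =>
    (Finset.mem_product.1 (g ⟨o, h⟩).2).1
  set f : U → U := fun o => if h : o ∈ B then (g ⟨o, h⟩).1.1 else η o with hf
  have hfB : ∀ o (h : o ∈ B), f o = (g ⟨o, h⟩).1.1 := fun o h => dif_pos h
  have hfn : ∀ o, o ∉ B → f o = η o := fun o h => dif_neg h
  have hsingle : ∀ o ∈ M, o ∉ B → (cap (η o)).card ≤ 1 := fun o ho h => by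
    by_contra hcon
    exact h (Finset.mem_filter.2 ⟨ho, by omega⟩)
  refine ⟨f, fun o ho => ?_, fun o ho o' ho' hne he => ?_, fun x => ?_⟩
  · by_cases h : o ∈ B
    · rw [hfB o h]
      exact (Finset.mem_filter.1 (hg o h)).1
    · rw [hfn o h]
      exact hη o ho
  · by_cases h : o ∈ B
    · rw [hfB o h] at he
      have h1 := (Finset.mem_filter.1 (hg o h)).2
      rw [Finset.card_eq_zero] at h1
      have h2 : o' ∈ cap (g ⟨o, h⟩).1.1 := Finset.mem_filter.2 ⟨ho', he⟩
      rw [h1] at h2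
      exact absurd h2 (Finset.notMem_empty _)
    · rw [hfn o h] at he
      exact hne (Finset.card_le_one.1 (hsingle o ho h) o' (Finset.mem_filter.2 ⟨ho', he⟩) o
        (Finset.mem_filter.2 ⟨ho, rfl⟩))
  · by_cases hx : ∃ o ∈ M, o ∉ B ∧ f o = x
    · obtain ⟨o, ho, hoB, rfl⟩ := hx
      have h1 := hsingle o ho hoB
      refine (Finset.card_le_card (t := cap (η o)) fun o' ho' => ?_).trans (by omega)
      obtain ⟨ho'M, he⟩ := Finset.mem_filter.1 ho'
      refine Finset.mem_filter.2 ⟨ho'M, ?_⟩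
      rw [hfn o hoB] at he
      by_cases h : o' ∈ B
      · rw [hfB o' h] at he
        have h2 := (Finset.mem_filter.1 (hg o' h)).2
        rw [he, Finset.card_eq_zero] at h2
        have h3 : o ∈ cap (η o) := Finset.mem_filter.2 ⟨ho, rfl⟩
        rw [h2] at h3
        exact absurd h3 (Finset.notMem_empty _)
      · rwa [hfn o' h] at he
    · push Not at hx
      have hall : ∀ o ∈ M.filter (fun o => f o = x), o ∈ B := fun o ho => by
        obtain ⟨h1, h2⟩ := Finset.mem_filter.1 ho
        by_contra h3
        exact hx o h1 h3 h2
      refine (Finset.card_le_card_of_injOn (t := (Finset.univ : Finset (Fin 2)))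
        (fun o => if h : o ∈ B then (g ⟨o, h⟩).1.2 else 0) (fun _ _ => Finset.mem_univ _)
        fun o ho o' ho' he => ?_).trans (by simp)
      have h1 := hall o ho
      have h2 := hall o' ho'
      simp only [dif_pos h1, dif_pos h2] at he
      have h3 := (Finset.mem_filter.1 ho).2
      have h4 := (Finset.mem_filter.1 ho').2
      rw [hfB o h1] at h3
      rw [hfB o' h2] at h4
      have h5 : g ⟨o, h1⟩ = g ⟨o', h2⟩ := Subtype.ext (Prod.ext (h3.trans h4.symm) he)
      exact congrArg Subtype.val (g.injective h5)

section Swap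

variable {U : Type*} [MetricSpace U] [Fintype U]

/-- A point of `M` that is closest to `X`. -/
def nearest (M : Finset U) (X : U) : U :=
  if h : ∃ z ∈ M, dist X z = Metric.infDist X (M : Set U) then h.choose else X

theorem nearest_spec {M : Finset U} (hM : M.Nonempty) (X : U) :
    nearest M X ∈ M ∧ dist X (nearest M X) = Metric.infDist X (M : Set U) := by
  have h : ∃ z ∈ M, dist X z = Metric.infDist X (M : Set U) := by
    obtain ⟨z, hz, he⟩ := M.finite_toSet.isCompact.exists_infDist_eq_dist hM X
    exact ⟨z, hz, he.symm⟩
  rw [nearest, dif_pos h]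
  exact h.choose_spec

theorem infDist_le {M : Finset U} {z : U} (hz : z ∈ M) (X : U) :
    Metric.infDist X (M : Set U) ≤ dist X z :=
  Metric.infDist_le_dist_of_mem hz

theorem cost_nonneg (F D : Finset U) : 0 ≤ cost F D :=
  Finset.sum_nonneg fun _ _ => Metric.infDist_nonneg

theorem cost_anti {F F' D : Finset U} (h : F ⊆ F') (hF : F.Nonempty) : cost F' D ≤ cost F D :=
  Finset.sum_le_sum fun _ _ =>
    Metric.infDist_le_infDist_of_subset (by exact_mod_cast h) (by exact_mod_cast hF)

/-- When `x` does not serve the reference center of `X`, then `X` can do without `x`. -/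
theorem dist_nearest_nearest_le {M F : Finset U} (hM : M.Nonempty) (hF : F.Nonempty) (X : U) :
    dist X (nearest F (nearest M X)) ≤
      Metric.infDist X (F : Set U) + 2 * Metric.infDist X (M : Set U) := by
  have h1 := dist_triangle X (nearest M X) (nearest F (nearest M X))
  have h2 := (nearest_spec hF (nearest M X)).2
  have h3 := infDist_le (nearest_spec hF X).1 (nearest M X)
  have h4 := dist_triangle_left (nearest M X) (nearest F X) X
  have h5 := (nearest_spec hM X).2
  have h6 := (nearest_spec hF X).2
  linarith

/-- An upper bound by an explicit reassignment: clients of o move to o, the other clients of x move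
to the current center closest to their reference center, and all others stay. -/
theorem infDist_swap_le {M F : Finset U} (hM : M.Nonempty) (hF : F.Nonempty) {o x : U}
    (hx : ∀ o' ∈ M, o' ≠ o → nearest F o' ≠ x) (X : U) :
    Metric.infDist X (swap F (x, o) : Set U) ≤ if nearest M X = o then
      Metric.infDist X (M : Set U) else Metric.infDist X (F : Set U) +
        if nearest F X = x then 2 * Metric.infDist X (M : Set U) else 0 := by
  split_ifs with h1 h2
  · rw [← (nearest_spec hM X).2, h1]
    exact infDist_le (Finset.mem_insert_self _ _) X
  · refine (infDist_le ?_ X).trans (dist_nearest_nearest_le hM hF X)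
    exact Finset.mem_insert_of_mem (Finset.mem_erase.2
      ⟨hx _ (nearest_spec hM X).1 h1, (nearest_spec hF _).1⟩)
  · rw [add_zero, ← (nearest_spec hF X).2]
    exact infDist_le (Finset.mem_insert_of_mem (Finset.mem_erase.2
      ⟨h2, (nearest_spec hF X).1⟩)) X

/-- The swaps that bring in the reference centers of the set `P` have a large total gain. -/
theorem exists_swaps {M F : Finset U} (hM : M.Nonempty) (hcard : M.card ≤ F.card) (D : Finset U) :
    ∃ f : U → U, (∀ o ∈ M, f o ∈ F) ∧ ∀ P ⊆ M,
      ∑ X ∈ D.filter (fun X => nearest M X ∈ P), Metric.infDist X (F : Set U) ≤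
        ∑ o ∈ P, (cost F D - cost (swap F (f o, o)) D) + 5 * cost M D := by
  have hF : F.Nonempty := Finset.card_pos.1 ((Finset.card_pos.2 hM).trans_le hcard)
  obtain ⟨f, hf1, hf2, hf3⟩ := exists_pairing hcard (nearest F) fun o _ => (nearest_spec hF o).1
  refine ⟨f, hf1, fun P hP => ?_⟩
  set S : U → ℝ := fun X => Metric.infDist X (F : Set U) with hS
  set O : U → ℝ := fun X => Metric.infDist X (M : Set U) with hO
  have hO0 : ∀ X, 0 ≤ O X := fun X => Metric.infDist_nonneg
  have hS0 : ∀ X, 0 ≤ S X := fun X => Metric.infDist_nonneg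
  have h1 : ∀ o ∈ P, cost (swap F (f o, o)) D - cost F D ≤
      ∑ X ∈ D, ((if nearest M X = o then O X - S X else 0) +
        if f o = nearest F X then 2 * O X else 0) := by
    intro o ho
    unfold cost
    rw [← Finset.sum_sub_distrib]
    refine Finset.sum_le_sum fun X _ => ?_
    have h2 := infDist_swap_le hM hF (hf2 o (hP ho)) X
    have h3 := hO0 X
    simp only [hO, hS] at h3 ⊢
    split_ifs at h2 ⊢ with h4 h5 h6 h7 h8
    all_goals first | linarith | exact absurd (Eq.symm ‹_›) ‹_›
  have h2 := Finset.sum_le_sum h1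
  rw [Finset.sum_comm] at h2
  -- Each client is moved to its reference center at most once and rerouted at extra cost 2 O X at
  -- most twice, since a current center is used in at most two swaps. This gives 1 + 2 · 2 = 5.
  have h3 : ∀ X ∈ D, ∑ o ∈ P, ((if nearest M X = o then O X - S X else 0) +
      if f o = nearest F X then 2 * O X else 0) ≤
      5 * O X - if nearest M X ∈ P then S X else 0 := by
    intro X _
    rw [Finset.sum_add_distrib, Finset.sum_ite_eq, ← Finset.sum_filter, Finset.sum_const,
      nsmul_eq_mul]
    have h4 : ((P.filter fun o => f o = nearest F X).card : ℝ) ≤ 2 := by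
      exact_mod_cast (Finset.card_le_card (Finset.filter_subset_filter _ hP)).trans
        (hf3 (nearest F X))
    have h5 := mul_le_mul_of_nonneg_right h4 (hO0 X)
    have h6 := hO0 X
    split_ifs <;> linarith
  have h4 := h2.trans (Finset.sum_le_sum h3)
  rw [Finset.sum_sub_distrib (s := D), ← Finset.mul_sum, ← Finset.sum_filter] at h4
  have h5 : ∑ o ∈ P, (cost F D - cost (swap F (f o, o)) D) =
      -∑ o ∈ P, (cost (swap F (f o, o)) D - cost F D) := by
    rw [← Finset.sum_neg_distrib]
    exact Finset.sum_congr rfl fun _ _ => by ring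
  have h6 : ∑ X ∈ D, O X = cost M D := rfl
  rw [h6] at h4
  rw [h5]
  linarith

/-- Some center can be removed at low cost. -/
theorem exists_removal {M G : Finset U} (hM : M.Nonempty) (hlt : M.card < G.card) (D : Finset U) :
    ∃ x ∈ G, cost (G.erase x) D ≤ cost G D + 2 * cost M D / (G.card - M.card) := by
  have hG : G.Nonempty := Finset.card_pos.1 (by omega)
  -- The centers of G that serve no reference center. Each client is rerouted only when its own
  -- center is removed, so all these removals together cost at most 2 cost M and one of them at most
  -- the average.
  set Z := G.filter fun x => ∀ o ∈ M, nearest G o ≠ x with hZ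
  have hZcard : G.card - M.card ≤ Z.card := by
    have h1 : G \ M.image (nearest G) ⊆ Z := by
      intro x hx
      obtain ⟨h2, h3⟩ := Finset.mem_sdiff.1 hx
      exact Finset.mem_filter.2 ⟨h2, fun o ho he => h3 (Finset.mem_image.2 ⟨o, ho, he⟩)⟩
    have h2 := Finset.le_card_sdiff (M.image (nearest G)) G
    have h3 := Finset.card_le_card h1
    have h4 : (M.image (nearest G)).card ≤ M.card := Finset.card_image_le
    omega
  have hZpos : 0 < Z.card := by omega
  have hA := cost_nonneg M D
  have hsum : ∑ x ∈ Z, (cost (G.erase x) D - cost G D) ≤ 2 * cost M D := by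
    have h1 : ∀ x ∈ Z, cost (G.erase x) D - cost G D ≤
        ∑ X ∈ D, if nearest G X = x then 2 * Metric.infDist X (M : Set U) else 0 := by
      intro x hx
      unfold cost
      rw [← Finset.sum_sub_distrib]
      refine Finset.sum_le_sum fun X _ => ?_
      split_ifs with h2
      · have h3 := dist_nearest_nearest_le hM hG X
        have h4 := infDist_le (M := G.erase x) (z := nearest G (nearest M X))
          (Finset.mem_erase.2 ⟨(Finset.mem_filter.1 hx).2 _ (nearest_spec hM X).1,
            (nearest_spec hG _).1⟩) X
        linarith
      · have h4 := infDist_le (M := G.erase x) (z := nearest G X)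
          (Finset.mem_erase.2 ⟨h2, (nearest_spec hG _).1⟩) X
        rw [(nearest_spec hG X).2] at h4
        linarith
    refine (Finset.sum_le_sum h1).trans ?_
    rw [Finset.sum_comm]
    unfold cost
    rw [Finset.mul_sum]
    refine Finset.sum_le_sum fun X _ => ?_
    rw [Finset.sum_ite_eq]
    have : 0 ≤ Metric.infDist X (M : Set U) := Metric.infDist_nonneg
    split_ifs <;> linarith
  have hsum' : ∑ x ∈ Z, (cost (G.erase x) D - cost G D) ≤ ∑ _ ∈ Z, 2 * cost M D / Z.card := by
    rw [Finset.sum_const, nsmul_eq_mul, mul_div_cancel₀ _ (by positivity)]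
    exact hsum
  obtain ⟨x, hx, hle⟩ := Finset.exists_le_of_sum_le (Finset.card_pos.1 hZpos) hsum'
  refine ⟨x, (Finset.mem_filter.1 hx).1, ?_⟩
  have h1 : 2 * cost M D / Z.card ≤ 2 * cost M D / (G.card - M.card) := by
    have h2 : (0 : ℝ) < G.card - M.card := by
      have : (M.card : ℝ) < G.card := by exact_mod_cast hlt
      linarith
    have h3 : (G.card : ℝ) - M.card ≤ Z.card := by
      have : (G.card : ℝ) ≤ Z.card + M.card := by
        exact_mod_cast (by omega : G.card ≤ Z.card + M.card)
      linarith
    exact div_le_div_of_nonneg_left (by positivity) h2 h3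
  linarith

/-- A run of the best-swap local search with additive errors at most `e`. -/
structure SwapRun (D : Finset U) (F : ℕ → Finset U) (x y : ℕ → U) (k T : ℕ) (e : ℝ) : Prop where
  k_pos : 0 < k
  e_nonneg : 0 ≤ e
  card : ∀ t ≤ T, (F t).card = k
  mem : ∀ t < T, x t ∈ F t
  step : ∀ t < T, F (t + 1) = swap (F t) (x t, y t)
  near_opt : ∀ t < T, ∀ x' ∈ F t, ∀ y', cost (F (t + 1)) D ≤ cost (swap (F t) (x', y')) D + e

namespace SwapRun

variable {D : Finset U} {F : ℕ → Finset U} {x y : ℕ → U} {k T : ℕ} {e : ℝ}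

theorem shift (R : SwapRun D F x y k T e) {a T' : ℕ} (h : a + T' ≤ T) :
    SwapRun D (fun t => F (a + t)) (fun t => x (a + t)) (fun t => y (a + t)) k T' e where
  k_pos := R.k_pos
  e_nonneg := R.e_nonneg
  card := fun t ht => R.card _ (by omega)
  mem := fun t ht => R.mem (a + t) (by omega)
  step := fun t ht => R.step (a + t) (by omega)
  near_opt := fun t ht => R.near_opt (a + t) (by omega)

theorem nonempty (R : SwapRun D F x y k T e) {t : ℕ} (ht : t ≤ T) : (F t).Nonempty :=
  Finset.card_pos.1 (by rw [R.card t ht]; exact R.k_pos)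

/-- The gain of a step is at least the average gain of the swaps with reference centers. -/
theorem sum_le (R : SwapRun D F x y k T e) {t : ℕ} (ht : t < T) {M P : Finset U}
    (hM : M.Nonempty) (hMk : M.card ≤ k) (hP : P ⊆ M) :
    ∑ X ∈ D.filter (fun X => nearest M X ∈ P), Metric.infDist X (F t : Set U) ≤
      P.card * (cost (F t) D - cost (F (t + 1)) D + e) + 5 * cost M D := by
  obtain ⟨f, hf, hsum⟩ := exists_swaps hM (F := F t) (by rwa [R.card t ht.le]) D
  refine (hsum P hP).trans ?_
  rw [← nsmul_eq_mul, ← Finset.sum_const]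
  gcongr with o ho
  linarith [R.near_opt t ht (f o) (hf o (hP ho)) o]

/-- Each step decreases the cost almost as much as the addition of the best center. -/
theorem cost_succ_le (R : SwapRun D F x y k T e) {t : ℕ} (ht : t < T) {M : Finset U}
    (hM : M.Nonempty) (hMk : M.card ≤ k) (y' : U) :
    cost (F (t + 1)) D ≤
      cost (insert y' (F t)) D + 2 * cost M D / (k - M.card + 1) + e := by
  have hcard := R.card t ht.le
  have hA := cost_nonneg M D
  have hkM : (M.card : ℝ) ≤ k := by exact_mod_cast hMk
  have hq : 0 ≤ 2 * cost M D / (k - M.card + 1) := div_nonneg (by positivity) (by linarith)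
  obtain ⟨x₀, hx₀⟩ := R.nonempty ht.le
  have hself : ∀ z ∈ F t, cost (F (t + 1)) D ≤ cost (F t) D + e := by
    intro z hz
    have h1 := R.near_opt t ht z hz z
    rwa [swap, Finset.insert_erase hz] at h1
  by_cases hy : y' ∈ F t
  · rw [Finset.insert_eq_self.2 hy]
    linarith [hself y' hy]
  · have hG : (insert y' (F t)).card = k + 1 := by rw [Finset.card_insert_of_notMem hy, hcard]
    obtain ⟨x', hx', hle⟩ := exists_removal hM (G := insert y' (F t)) (by omega) D
    have hden : ((insert y' (F t)).card : ℝ) - M.card = k - M.card + 1 := by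
      rw [hG]; push_cast; ring
    rw [hden] at hle
    rcases Finset.mem_insert.1 hx' with rfl | hx'F
    · rw [Finset.erase_insert hy] at hle
      linarith [hself x₀ hx₀]
    · have h1 := R.near_opt t ht x' hx'F y'
      have h2 : swap (F t) (x', y') = (insert y' (F t)).erase x' := by
        rw [swap, Finset.erase_insert_of_ne]
        rintro rfl
        exact hy hx'F
      rw [h2] at h1
      linarith

end SwapRun

end Swap

/-! ### From swaps to greedy addition. -/

section Steps

variable {U : Type*} [MetricSpace U] [Fintype U] {D : Finset U}

theorem sum_min_eq_sub_gain (S : U → ℝ) (z : U) :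
    ∑ X ∈ D, min (S X) (dist X z) = ∑ X ∈ D, S X - gain D S z := by
  unfold gain
  rw [← Finset.sum_sub_distrib]
  refine Finset.sum_congr rfl fun X _ => ?_
  rcases le_total (S X) (dist X z) with h | h
  · rw [min_eq_left h, max_eq_right (by linarith)]; ring
  · rw [min_eq_right h, max_eq_left (by linarith)]; ring

/-- If each step decreases the total cost almost as much as the addition of the best center, then
the total cost cannot remain large for a long time. -/
theorem sum_le_of_steps {S : ℕ → U → ℝ} {y : ℕ → U} {h ρ : U → ℝ} {T n : ℕ} {κ A η : ℝ}
    (nonneg : ∀ X, 0 ≤ S 0 X) (lip : ∀ X Y, S 0 X ≤ S 0 Y + dist X Y) (hη : 0 ≤ η)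
    (hmin : ∀ t < T, ∀ X, min (S t X) (dist X (y t)) ≤ S (t + 1) X)
    (hstep : ∀ t < T, ∀ z, ∑ X ∈ D, S (t + 1) X ≤ ∑ X ∈ D, min (S t X) (dist X z) + η)
    (card_le : D.card ≤ n) (h_pos : ∀ X ∈ D, 0 < h X) (ρ_nonneg : ∀ X ∈ D, 0 ≤ ρ X)
    (h_le : ∀ X ∈ D, h X ≤ mass D X (ρ X)) (sum_h : ∑ X ∈ D, (h X)⁻¹ ≤ κ)
    (sum_ρ : ∑ X ∈ D, ρ X ≤ A) {q b : ℕ}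
    (hq : 65536 * Real.log (1 + 24576 * n ^ 3) ≤ 2 ^ q) (hb : (12 * n : ℝ) ≤ 2 ^ 2 ^ b)
    (hT : κ * (18945 + 144 * (q + b)) < T) :
    ∑ X ∈ D, S T X ≤ 256 * A + 513 * (T * η) := by
  set S' : ℕ → U → ℝ := added (S 0) y with hS'
  have hle : ∀ t ≤ T, ∀ X, S' t X ≤ S t X := by
    intro t
    induction t with
    | zero => exact fun _ X => le_rfl
    | succ t ih =>
      intro ht X
      exact (min_le_min_right _ (ih (by omega) X)).trans (hmin t (by omega) X)
  -- The virtual costs S' only add the centers `y t` and never remove one, so they are at most S.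
  -- Passing from S to S' loses the gain g t, and these losses are paid by the total error T η.
  set g : ℕ → ℝ := fun t => gain D (S t) (y t) - gain D (S' t) (y t) with hg
  have hg0 : ∀ t < T, 0 ≤ g t := fun t ht => sub_nonneg.2 (gain_mono (hle t ht.le) _)
  have hdef : ∀ t ≤ T, ∑ X ∈ D, S t X - ∑ X ∈ D, S' t X + ∑ τ ∈ Finset.range t, g τ ≤ t * η := by
    intro t
    induction t with
    | zero => intro _; simp [hS', added]
    | succ t ih =>
      intro ht
      have h1 := ih (by omega)
      have h2 := hstep t (by omega) (y t)
      rw [sum_min_eq_sub_gain] at h2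
      have h3 := sum_added_succ (D := D) (S₀ := S 0) (y := y) t
      rw [Finset.sum_range_succ]
      simp only [hg, hS'] at h1 h2 h3 ⊢
      push_cast
      linarith
  have hT1 := hdef T le_rfl
  have hdiff : ∑ X ∈ D, S' T X ≤ ∑ X ∈ D, S T X :=
    Finset.sum_le_sum fun X _ => hle T le_rfl X
  have hgsum : 0 ≤ ∑ τ ∈ Finset.range T, g τ :=
    Finset.sum_nonneg fun τ hτ => hg0 τ (Finset.mem_range.1 hτ)
  by_contra hcon
  push Not at hcon
  -- The slacks η + g t sum to at most 2 T η, and S' T is within T η of S T; hence 256 · 2 + 1 =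
  -- 513.
  have G : SlowGreedy D (S 0) y (fun t => if t < T then η + g t else 0) h ρ T n κ A
      (2 * (T * η)) :=
    { nonneg := nonneg
      lip := lip
      slack_nonneg := fun t => by
        split_ifs with ht
        · linarith [hg0 t ht]
        · exact le_rfl
      sum_slack := by
        rw [Finset.sum_congr rfl fun t ht => if_pos (Finset.mem_range.1 ht),
          Finset.sum_add_distrib, Finset.sum_const, Finset.card_range, nsmul_eq_mul]
        linarith
      slack := fun t ht z => by
        rw [if_pos ht]
        have h1 := hstep t ht z
        rw [sum_min_eq_sub_gain] at h1
        have h2 : ∑ X ∈ D, S t X - gain D (S t) (y t) ≤ ∑ X ∈ D, S (t + 1) X := by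
          rw [← sum_min_eq_sub_gain]
          exact Finset.sum_le_sum fun X _ => hmin t ht X
        have h3 : gain D (S' t) z ≤ gain D (S t) z := gain_mono (hle t ht.le) z
        simp only [hg]
        linarith
      card_le := card_le
      h_pos := h_pos
      ρ_nonneg := ρ_nonneg
      h_le := h_le
      sum_h := sum_h
      sum_ρ := sum_ρ
      large := by
        simp only [hS'] at hT1
        linarith }
  exact absurd (G.length_le hq hb) (not_le.2 hT)

/-- The clients whose closest reference center is `o`. -/
def cell (D M : Finset U) (o : U) : Finset U := D.filter fun X => nearest M X = o

theorem sum_cells (M : Finset U) (P : Finset U) (f : U → ℝ) :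
    ∑ X ∈ D.filter (fun X => nearest M X ∈ P), f X = ∑ o ∈ P, ∑ X ∈ cell D M o, f X := by
  have hmaps : ∀ X ∈ D.filter (fun X => nearest M X ∈ P), nearest M X ∈ P :=
    fun X hX => (Finset.mem_filter.1 hX).2
  rw [← Finset.sum_fiberwise_of_maps_to hmaps]
  refine Finset.sum_congr rfl fun o ho => Finset.sum_congr ?_ fun _ _ => rfl
  ext X
  simp only [cell, Finset.mem_filter]
  constructor
  · rintro ⟨⟨h1, -⟩, h2⟩
    exact ⟨h1, h2⟩
  · rintro ⟨h1, h2⟩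
    exact ⟨⟨h1, h2 ▸ ho⟩, h2⟩

theorem sum_all_cells {M : Finset U} (hM : M.Nonempty) (f : U → ℝ) :
    ∑ X ∈ D, f X = ∑ o ∈ M, ∑ X ∈ cell D M o, f X := by
  rw [← sum_cells M, Finset.filter_true_of_mem fun X _ => (nearest_spec hM X).1]

/-- Markov's inequality: at least half of the cell of X lies within twice the average distance of
its reference center, and X is one step away from that center. -/
theorem half_card_le_mass {M : Finset U} (hM : M.Nonempty) {X : U} (hX : X ∈ D) :
    ((cell D M (nearest M X)).card : ℝ) / 2 ≤ mass D X (Metric.infDist X (M : Set U) +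
      2 * ((∑ Y ∈ cell D M (nearest M X), Metric.infDist Y (M : Set U)) /
        (cell D M (nearest M X)).card)) := by
  set o := nearest M X with ho
  set A := ∑ Y ∈ cell D M o, Metric.infDist Y (M : Set U) with hA
  set w : ℝ := ((cell D M o).card : ℝ) with hw
  have hw0 : 0 < w := by
    rw [hw]
    exact_mod_cast Finset.card_pos.2
      ⟨X, show X ∈ cell D M (nearest M X) from Finset.mem_filter.2 ⟨hX, rfl⟩⟩
  have hO0 : ∀ Y, 0 ≤ Metric.infDist Y (M : Set U) := fun Y => Metric.infDist_nonneg
  have hA0 : 0 ≤ A := Finset.sum_nonneg fun Y _ => hO0 Y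
  set far := (cell D M o).filter fun Y => ¬ Metric.infDist Y (M : Set U) ≤ 2 * (A / w) with hfar
  set near := (cell D M o).filter fun Y => Metric.infDist Y (M : Set U) ≤ 2 * (A / w) with hnear
  have hsplit : w = near.card + far.card := by
    rw [hw, hnear, hfar, ← Nat.cast_add, Finset.card_filter_add_card_filter_not]
  have hnearle : (near.card : ℝ) ≤ mass D X (Metric.infDist X (M : Set U) + 2 * (A / w)) := by
    unfold mass
    refine mod_cast Finset.card_le_card fun Y hY => ?_
    obtain ⟨hY1, hY2⟩ := Finset.mem_filter.1 hY
    obtain ⟨hY3, hY4⟩ := Finset.mem_filter.1 hY1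
    refine Finset.mem_filter.2 ⟨hY3, ?_⟩
    have h1 := dist_triangle_right Y X o
    have h2 := (nearest_spec hM X).2
    have h3 := (nearest_spec hM Y).2
    rw [← ho] at h2
    rw [hY4] at h3
    linarith
  have hfarle : (far.card : ℝ) ≤ w / 2 := by
    rcases hA0.eq_or_lt with h0 | hpos
    · have : far = ∅ := by
        rw [hfar, Finset.filter_eq_empty_iff]
        intro Y hY
        have h1 := Finset.single_le_sum (f := fun Y => Metric.infDist Y (M : Set U))
          (fun Y _ => hO0 Y) hY
        rw [not_not, ← h0, zero_div, mul_zero]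
        rw [← hA, ← h0] at h1
        exact h1
      rw [this, Finset.card_empty, Nat.cast_zero]
      linarith
    · have h1 : (far.card : ℝ) * (2 * (A / w)) ≤ A := by
        rw [← nsmul_eq_mul, ← Finset.sum_const]
        refine (Finset.sum_le_sum fun Y hY => (not_le.1 (Finset.mem_filter.1 hY).2).le).trans ?_
        exact Finset.sum_le_sum_of_subset_of_nonneg (Finset.filter_subset _ _) fun Y _ _ => hO0 Y
      have h2 : (far.card : ℝ) * (2 * (A / w)) = far.card * 2 / w * A := by ring
      rw [h2] at h1
      have h3 : (far.card : ℝ) * 2 / w ≤ 1 := by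
        by_contra hcon
        push Not at hcon
        nlinarith
      rw [div_le_one hw0] at h3
      linarith
  linarith

namespace SwapRun

variable {F : ℕ → Finset U} {x y : ℕ → U} {k T : ℕ} {e : ℝ}

theorem infDist_succ_ge (R : SwapRun D F x y k T e) {t : ℕ} (ht : t < T) (X : U) :
    min (Metric.infDist X (F t : Set U)) (dist X (y t)) ≤ Metric.infDist X (F (t + 1) : Set U) := by
  have hne := R.nonempty (t := t + 1) ht
  obtain ⟨h1, h2⟩ := nearest_spec hne X
  rw [← h2]
  rw [R.step t ht] at h1 ⊢
  rcases Finset.mem_insert.1 h1 with h3 | h3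
  · exact min_le_of_right_le (by rw [h3])
  · exact min_le_of_left_le (infDist_le (Finset.mem_of_mem_erase h3) X)

/-- Here h X is half the cell size of X, so that each cell contributes at most 2 to the sum of the 1
/ h. The radii from `half_card_le_mass` sum to at most 3 cost M, which gives 768 = 256 · 3. -/
theorem cost_le (R : SwapRun D F x y k T e) {n : ℕ} (hn : D.card ≤ n) {M : Finset U}
    (hM : M.Nonempty) (hMk : M.card ≤ k) {q b : ℕ}
    (hq : 65536 * Real.log (1 + 24576 * n ^ 3) ≤ 2 ^ q) (hb : (12 * n : ℝ) ≤ 2 ^ 2 ^ b)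
    (hT : 2 * M.card * (18945 + 144 * ((q : ℝ) + b)) < T) :
    cost (F T) D ≤
      768 * cost M D + 513 * (T * (2 * cost M D / (k - M.card + 1) + e)) := by
  have hA := cost_nonneg M D
  have hkM : (M.card : ℝ) ≤ k := by exact_mod_cast hMk
  have hq' : 0 ≤ 2 * cost M D / (k - M.card + 1) := div_nonneg (by positivity) (by linarith)
  set w : U → ℝ := fun o => ((cell D M o).card : ℝ) with hw
  set a : U → ℝ := fun o => ∑ Y ∈ cell D M o, Metric.infDist Y (M : Set U) with ha
  have hO0 : ∀ Y, 0 ≤ Metric.infDist Y (M : Set U) := fun Y => Metric.infDist_nonneg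
  have ha0 : ∀ o, 0 ≤ a o := fun o => Finset.sum_nonneg fun Y _ => hO0 Y
  have hcell : ∀ X ∈ D, 0 < w (nearest M X) := fun X hX => by
    simp only [hw]
    exact_mod_cast Finset.card_pos.2
      ⟨X, show X ∈ cell D M (nearest M X) from Finset.mem_filter.2 ⟨hX, rfl⟩⟩
  have hconst : ∀ (f : U → ℝ), ∑ X ∈ D, f (nearest M X) = ∑ o ∈ M, w o * f o := by
    intro f
    rw [sum_all_cells hM]
    refine Finset.sum_congr rfl fun o _ => ?_
    rw [Finset.sum_congr rfl (g := fun _ => f o) fun X hX => by rw [(Finset.mem_filter.1 hX).2],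
      Finset.sum_const, nsmul_eq_mul]
  have h := sum_le_of_steps (D := D) (S := fun t X => Metric.infDist X (F t : Set U)) (y := y)
    (h := fun X => w (nearest M X) / 2)
    (ρ := fun X => Metric.infDist X (M : Set U) + 2 * (a (nearest M X) / w (nearest M X)))
    (T := T) (n := n) (κ := 2 * M.card) (A := 3 * cost M D)
    (η := 2 * cost M D / (k - M.card + 1) + e) (fun X => Metric.infDist_nonneg)
    (fun X Y => Metric.infDist_le_infDist_add_dist) (add_nonneg hq' R.e_nonneg)
    (fun t ht X => R.infDist_succ_ge ht X) (fun t ht z => ?_) hn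
    (fun X hX => half_pos (hcell X hX))
    (fun X hX => add_nonneg (hO0 X)
      (mul_nonneg zero_le_two (div_nonneg (ha0 _) (hcell X hX).le)))
    (fun X hX => half_card_le_mass hM hX) ?_ ?_ hq hb (by exact_mod_cast hT)
  · unfold cost at h ⊢
    linarith
  · have h1 := R.cost_succ_le ht hM hMk z
    have h2 : cost (insert z (F t)) D ≤
        ∑ X ∈ D, min (Metric.infDist X (F t : Set U)) (dist X z) := by
      refine Finset.sum_le_sum fun X _ => le_min ?_ (infDist_le (Finset.mem_insert_self _ _) X)
      rw [← (nearest_spec (R.nonempty ht.le) X).2]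
      exact infDist_le (Finset.mem_insert_of_mem (nearest_spec (R.nonempty ht.le) X).1) X
    have h3 : cost (F (t + 1)) D = ∑ X ∈ D, Metric.infDist X (F (t + 1) : Set U) := rfl
    rw [← h3]
    linarith
  · rw [hconst fun o => (w o / 2)⁻¹]
    have h1 : ∀ o ∈ M, w o * (w o / 2)⁻¹ ≤ 2 := by
      intro o _
      rcases (show 0 ≤ w o by simp only [hw]; positivity).eq_or_lt with h0 | hpos
      · rw [← h0]; norm_num
      · rw [inv_div, mul_div_cancel₀ _ hpos.ne']
    refine (Finset.sum_le_sum h1).trans ?_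
    rw [Finset.sum_const, nsmul_eq_mul, mul_comm]
  · rw [Finset.sum_add_distrib, ← Finset.mul_sum, hconst fun o => a o / w o]
    have h1 : ∀ o ∈ M, w o * (a o / w o) ≤ a o := by
      intro o _
      rcases (show 0 ≤ w o by simp only [hw]; positivity).eq_or_lt with h0 | hpos
      · rw [← h0, zero_mul]; exact ha0 o
      · rw [mul_div_cancel₀ _ hpos.ne']
    have h2 := Finset.sum_le_sum h1
    have h3 : ∑ o ∈ M, a o = cost M D := (sum_all_cells hM _).symm
    have h4 : ∑ X ∈ D, Metric.infDist X (M : Set U) = cost M D := rfl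
    linarith

end SwapRun

end Steps

/-- The largest sum of `c` over at most `m` elements of `V`. -/
def topSum {U : Type*} (c : U → ℝ) (m : ℕ) (V : Finset U) : ℝ :=
  (V.powerset.filter fun P => P.card ≤ m).sup'
    ⟨∅, Finset.mem_filter.2 ⟨Finset.empty_mem_powerset V, by simp⟩⟩ fun P => ∑ o ∈ P, c o

section TopSum

variable {U : Type*} {c : U → ℝ} {m : ℕ}

theorem le_topSum {V P : Finset U} (hP : P ⊆ V) (hm : P.card ≤ m) :
    ∑ o ∈ P, c o ≤ topSum c m V :=
  Finset.le_sup' (fun P => ∑ o ∈ P, c o) (Finset.mem_filter.2 ⟨Finset.mem_powerset.2 hP, hm⟩)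

theorem exists_topSum_eq (c : U → ℝ) (m : ℕ) (V : Finset U) :
    ∃ P ⊆ V, P.card ≤ m ∧ topSum c m V = ∑ o ∈ P, c o := by
  obtain ⟨P, hP, he⟩ := Finset.exists_mem_eq_sup' (s := V.powerset.filter fun P => P.card ≤ m)
    ⟨∅, Finset.mem_filter.2 ⟨Finset.empty_mem_powerset V, by simp⟩⟩ fun P => ∑ o ∈ P, c o
  obtain ⟨h1, h2⟩ := Finset.mem_filter.1 hP
  exact ⟨P, Finset.mem_powerset.1 h1, h2, he⟩

theorem topSum_nonneg (c : U → ℝ) (m : ℕ) (V : Finset U) : 0 ≤ topSum c m V := by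
  simpa using le_topSum (c := c) (m := m) (Finset.empty_subset V) (by simp)

/-- An element exceeds the decrease of the largest sums by at most an average value. -/
theorem le_topSum_sub {V : Finset U} {o : U} (ho : o ∈ V) {g a : ℝ} (hg : 0 ≤ g) (ha : 0 ≤ a)
    (hm : 0 < m) (h : ∀ P ⊆ V, ∑ i ∈ P, c i ≤ P.card * g + a) :
    c o ≤ topSum c m V - topSum c m (V.erase o) + (g + a / m) := by
  obtain ⟨P, hP, hPm, he⟩ := exists_topSum_eq c m (V.erase o)
  have hoP : o ∉ P := fun h => Finset.notMem_erase o V (hP h)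
  have hPV : P ⊆ V := hP.trans (Finset.erase_subset _ _)
  have ham : 0 ≤ a / m := by positivity
  rw [he]
  rcases hPm.lt_or_eq with hlt | heq
  · have h1 := le_topSum (c := c) (m := m) (V := V) (P := insert o P)
      (Finset.insert_subset ho hPV) (by rw [Finset.card_insert_of_notMem hoP]; omega)
    rw [Finset.sum_insert hoP] at h1
    linarith
  · have hPne : P.Nonempty := Finset.card_pos.1 (by omega)
    -- A best set with m elements contains one that is at most its average; exchanging that element
    -- for o gives a competitor in V.
    obtain ⟨p, hp, hple⟩ : ∃ p ∈ P, c p ≤ g + a / m := by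
      by_contra hcon
      push Not at hcon
      have h1 := Finset.sum_lt_sum_of_nonempty hPne hcon
      rw [Finset.sum_const, nsmul_eq_mul, heq] at h1
      have h2 := h P hPV
      rw [heq] at h2
      have h3 : (m : ℝ) * (g + a / m) = m * g + a := by field_simp
      linarith
    have hoP' : o ∉ P.erase p := fun h => hoP (Finset.mem_of_mem_erase h)
    have h1 := le_topSum (c := c) (m := m) (V := V) (P := insert o (P.erase p))
      (Finset.insert_subset ho ((Finset.erase_subset _ _).trans hPV))
      (by rw [Finset.card_insert_of_notMem hoP', Finset.card_erase_of_mem hp]; omega)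
    rw [Finset.sum_insert hoP'] at h1
    have h2 := Finset.add_sum_erase P c hp
    linarith

end TopSum

/-! ### Times of small gain and untouched reference centers. -/

section Rounds

variable {U : Type*} [MetricSpace U] [Fintype U] {D : Finset U}

/-- The truncated connection cost of the clients that are close to the reference center `o`. -/
def coreCost (D M : Finset U) (r : U → ℝ) (o : U) (F : Finset U) : ℝ :=
  ∑ X ∈ (cell D M o).filter (fun X => Metric.infDist X (M : Set U) ≤ r o / 32),
    min (Metric.infDist X (F : Set U)) (r o / 16)

theorem coreCost_le {M : Finset U} (r : U → ℝ) (o : U) (F : Finset U) :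
    coreCost D M r o F ≤ ∑ X ∈ cell D M o, Metric.infDist X (F : Set U) :=
  (Finset.sum_le_sum fun _ _ => min_le_left _ _).trans
    (Finset.sum_le_sum_of_subset_of_nonneg (Finset.filter_subset _ _)
      fun _ _ _ => Metric.infDist_nonneg)

theorem sum_coreCost_le {M : Finset U} (hM : M.Nonempty) (r : U → ℝ) (F : Finset U) {P : Finset U}
    (hP : P ⊆ M) : ∑ o ∈ P, coreCost D M r o F ≤ cost F D := by
  refine (Finset.sum_le_sum fun o _ => coreCost_le r o F).trans ?_
  exact (Finset.sum_le_sum_of_subset_of_nonneg hP fun o _ _ =>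
    Finset.sum_nonneg fun X _ => (Metric.infDist_nonneg : 0 ≤ Metric.infDist X (F : Set U))).trans_eq
    (sum_all_cells hM _).symm

namespace SwapRun

variable {F : ℕ → Finset U} {x y : ℕ → U} {k T : ℕ} {e : ℝ}

theorem cost_succ_le_add (R : SwapRun D F x y k T e) {t : ℕ} (ht : t < T) :
    cost (F (t + 1)) D ≤ cost (F t) D + e := by
  obtain ⟨z, hz⟩ := R.nonempty ht.le
  have h1 := R.near_opt t ht z hz z
  rwa [swap, Finset.insert_erase hz] at h1

/-- The new center is farther than r / 8 from o, so it is farther than 3 r / 32 from the core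
clients, which are within r / 32 of o. The truncation at r / 16 hides it. -/
theorem coreCost_succ (R : SwapRun D F x y k T e) {t : ℕ} (ht : t < T) {M : Finset U}
    (hM : M.Nonempty) {r : U → ℝ} {o : U} (ho : r o / 8 < dist (y t) o) (hr : 0 < r o) :
    coreCost D M r o (F t) ≤ coreCost D M r o (F (t + 1)) := by
  refine Finset.sum_le_sum fun X hX => ?_
  obtain ⟨h1, h2⟩ := Finset.mem_filter.1 hX
  have h3 := (nearest_spec hM X).2
  rw [(Finset.mem_filter.1 h1).2] at h3
  have h4 := dist_triangle_left (y t) o X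
  have h5 := R.infDist_succ_ge ht X
  refine le_min ?_ (min_le_right _ _)
  rcases min_le_iff.1 h5 with h6 | h6
  · exact (min_le_left _ _).trans h6
  · exact (min_le_right _ _).trans (le_trans (by linarith) h6)

/-- If the reference centers are well separated and have heavy cells, then at a time of small gain
most of the cost stems from the clients close to the reference centers. -/
theorem cost_sub_coreCost_le (R : SwapRun D F x y k T e) (hT : 0 < T) {M : Finset U}
    (hM : M.Nonempty) (hMk : M.card ≤ k) {r : U → ℝ} {θ : ℝ}
    (hθ : ∀ o ∈ M, θ ≤ (cell D M o).card * r o)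
    (hslow : cost (F 0) D - cost (F 1) D + e ≤ θ / 64) :
    cost (F 0) D - ∑ o ∈ M, coreCost D M r o (F 0) ≤ 14 * cost M D := by
  set S : U → ℝ := fun X => Metric.infDist X (F 0 : Set U) with hS
  set O : U → ℝ := fun X => Metric.infDist X (M : Set U) with hO
  have hO0 : ∀ X, 0 ≤ O X := fun X => Metric.infDist_nonneg
  have hS0 : ∀ X, 0 ≤ S X := fun X => Metric.infDist_nonneg
  have hA : ∑ o ∈ M, ∑ X ∈ cell D M o, O X = cost M D := (sum_all_cells hM O).symm
  have hdist : ∀ o, ∀ X ∈ cell D M o, dist X o = O X := fun o X hX => by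
    rw [← (Finset.mem_filter.1 hX).2]
    exact (nearest_spec hM X).2
  -- The reference centers that are badly served. Each has weighted cost at least 2 g, while
  -- `sum_le` bounds the cost of their cells by |E| g + 5 cost M; so |E| g ≤ 6 cost M.
  set E := M.filter fun o => r o / 32 < S o with hE
  have h1 := R.sum_le hT (P := E) hM hMk (Finset.filter_subset _ _)
  rw [sum_cells] at h1
  set g := cost (F 0) D - cost (F (0 + 1)) D + e with hg
  have hEA : ∑ o ∈ E, ∑ X ∈ cell D M o, O X ≤ cost M D := by
    rw [← hA]
    exact Finset.sum_le_sum_of_subset_of_nonneg (Finset.filter_subset _ _)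
      fun o _ _ => Finset.sum_nonneg fun X _ => hO0 X
  have h2 : ∀ o ∈ E, (cell D M o).card * S o ≤
      ∑ X ∈ cell D M o, S X + ∑ X ∈ cell D M o, O X := by
    intro o _
    rw [← nsmul_eq_mul, ← Finset.sum_const, ← Finset.sum_add_distrib]
    refine Finset.sum_le_sum fun X hX => ?_
    have h3 : S o ≤ S X + dist o X := Metric.infDist_le_infDist_add_dist
    rw [dist_comm, hdist o X hX] at h3
    exact h3
  have h3 : ∀ o ∈ E, 2 * g ≤ (cell D M o).card * S o := by
    intro o ho
    obtain ⟨hoM, hoS⟩ := Finset.mem_filter.1 ho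
    have h4 := hθ o hoM
    have h5 : ((cell D M o).card : ℝ) * (r o / 32) ≤ (cell D M o).card * S o :=
      mul_le_mul_of_nonneg_left hoS.le (by positivity)
    simp only [hg, zero_add]
    linarith
  have h4 := Finset.sum_le_sum h3
  have h5 := Finset.sum_le_sum h2
  rw [Finset.sum_add_distrib] at h5
  rw [Finset.sum_const, nsmul_eq_mul] at h4
  have h6 : ∑ o ∈ E, ∑ X ∈ cell D M o, S X ≤
      12 * cost M D + ∑ o ∈ E, ∑ X ∈ cell D M o, O X := by
    have h7 : ∀ o ∈ E, ∑ X ∈ cell D M o, S X ≤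
        (cell D M o).card * S o + ∑ X ∈ cell D M o, O X := by
      intro o _
      rw [← nsmul_eq_mul, ← Finset.sum_const, ← Finset.sum_add_distrib]
      refine Finset.sum_le_sum fun X hX => ?_
      have h8 : S X ≤ S o + dist X o := Metric.infDist_le_infDist_add_dist
      rw [hdist o X hX] at h8
      exact h8
    have h8 := Finset.sum_le_sum h7
    rw [Finset.sum_add_distrib] at h8
    linarith
  have h7 : ∀ o ∈ M, o ∉ E → ∑ X ∈ cell D M o, S X - coreCost D M r o (F 0) ≤
      2 * ∑ X ∈ cell D M o, O X := by
    intro o hoM hoE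
    have ho : S o ≤ r o / 32 := by
      by_contra hcon
      exact hoE (Finset.mem_filter.2 ⟨hoM, not_le.1 hcon⟩)
    rw [← Finset.sum_filter_add_sum_filter_not (cell D M o) fun X => O X ≤ r o / 32,
      Finset.mul_sum, ← Finset.sum_filter_add_sum_filter_not (cell D M o)
        (fun X => O X ≤ r o / 32) fun X => 2 * O X]
    have h8 : ∑ X ∈ (cell D M o).filter (fun X => O X ≤ r o / 32), S X ≤
        coreCost D M r o (F 0) := by
      refine Finset.sum_le_sum fun X hX => le_min le_rfl ?_
      obtain ⟨h9, h10⟩ := Finset.mem_filter.1 hX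
      have h11 : S X ≤ S o + dist X o := Metric.infDist_le_infDist_add_dist
      rw [hdist o X h9] at h11
      linarith
    have h9 : ∑ X ∈ (cell D M o).filter (fun X => ¬ O X ≤ r o / 32), S X ≤
        ∑ X ∈ (cell D M o).filter (fun X => ¬ O X ≤ r o / 32), 2 * O X := by
      refine Finset.sum_le_sum fun X hX => ?_
      obtain ⟨h9, h10⟩ := Finset.mem_filter.1 hX
      have h11 : S X ≤ S o + dist X o := Metric.infDist_le_infDist_add_dist
      rw [hdist o X h9] at h11
      linarith
    have h10 : 0 ≤ ∑ X ∈ (cell D M o).filter (fun X => O X ≤ r o / 32), 2 * O X :=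
      Finset.sum_nonneg fun X _ => by linarith [hO0 X]
    linarith
  have h8 : cost (F 0) D = ∑ o ∈ M, ∑ X ∈ cell D M o, S X := sum_all_cells hM S
  have hcore0 : ∀ o ∈ E, 0 ≤ coreCost D M r o (F 0) := by
    intro o ho
    by_cases hr : 0 ≤ r o
    · exact Finset.sum_nonneg fun X _ => le_min (hS0 X) (by linarith)
    · unfold coreCost
      rw [Finset.filter_eq_empty_iff.2, Finset.sum_empty]
      intro X _
      have := hO0 X
      push Not at hr ⊢
      simp only [hO] at this
      linarith
  rw [h8, ← Finset.sum_sub_distrib, ← Finset.sum_filter_add_sum_filter_not M fun o => o ∈ E]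
  have hfE : M.filter (fun o => o ∈ E) = E := by
    ext o
    simp only [Finset.mem_filter, hE]
    tauto
  rw [hfE]
  have h9 : ∑ o ∈ E, (∑ X ∈ cell D M o, S X - coreCost D M r o (F 0)) ≤
      ∑ o ∈ E, ∑ X ∈ cell D M o, S X :=
    Finset.sum_le_sum fun o ho => by linarith [hcore0 o ho]
  have h10 : ∑ o ∈ M.filter (fun o => o ∉ E), (∑ X ∈ cell D M o, S X - coreCost D M r o (F 0)) ≤
      ∑ o ∈ M.filter (fun o => o ∉ E), 2 * ∑ X ∈ cell D M o, O X :=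
    Finset.sum_le_sum fun o ho => h7 o (Finset.mem_filter.1 ho).1 (Finset.mem_filter.1 ho).2
  have h11 := Finset.sum_filter_add_sum_filter_not M (fun o => o ∈ E)
    fun o => ∑ X ∈ cell D M o, O X
  rw [hfE, hA] at h11
  rw [← Finset.mul_sum] at h10
  have h12 : 0 ≤ ∑ o ∈ E, ∑ X ∈ cell D M o, O X :=
    Finset.sum_nonneg fun o _ => Finset.sum_nonneg fun X _ => hO0 X
  have h13 := cost_nonneg M D
  have h14 : 0 ≤ ∑ o ∈ M.filter (fun o => o ∉ E), ∑ X ∈ cell D M o, O X :=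
    Finset.sum_nonneg fun o _ => Finset.sum_nonneg fun X _ => hO0 X
  linarith

/-- The reference centers near which no center has been added before time `t`. -/
def untouched (M : Finset U) (r : U → ℝ) (y : ℕ → U) (t : ℕ) : Finset U :=
  M.filter fun o => ∀ τ < t, r o / 8 < dist (y τ) o

/-- Starting from a time of small gain, the gains soon become much smaller. -/
theorem gain_le (R : SwapRun D F x y k T e) (hT : 0 < T) {M : Finset U}
    (hM : M.Nonempty) (hMk : M.card ≤ k) {r : U → ℝ} (hr : ∀ o ∈ M, 0 < r o)
    (hsep : ∀ o ∈ M, ∀ o' ∈ M, o ≠ o' → r o ≤ dist o o') {θ : ℝ}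
    (hθ : ∀ o ∈ M, θ ≤ (cell D M o).card * r o)
    (hslow : cost (F 0) D - cost (F 1) D + e ≤ θ / 64) {m : ℕ} (hm : 0 < m) {g : ℝ} (hg0 : 0 ≤ g)
    (hg : ∀ t < T, g ≤ cost (F t) D - cost (F (t + 1)) D) :
    ((T : ℝ) - k) * g ≤ 19 * cost M D + m * (cost (F 0) D - cost (F 1) D + e) +
      k * (e + 5 * cost M D / m) := by
  set V := untouched M r y with hV
  set c : U → ℝ := fun o => coreCost D M r o (F 0) with hc
  set A := cost M D with hA
  have hA0 : 0 ≤ A := cost_nonneg M D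
  have hVM : ∀ t, V t ⊆ M := fun t => Finset.filter_subset _ _
  have hVsub : ∀ t, V (t + 1) ⊆ V t := fun t o ho => by
    obtain ⟨h1, h2⟩ := Finset.mem_filter.1 ho
    exact Finset.mem_filter.2 ⟨h1, fun τ hτ => h2 τ (by omega)⟩
  have hV0 : V 0 = M := Finset.filter_true_of_mem fun o _ τ hτ => absurd hτ (Nat.not_lt_zero τ)
  have hmono : ∀ t ≤ T, ∀ o ∈ V t, c o ≤ coreCost D M r o (F t) := by
    intro t
    induction t with
    | zero => exact fun _ o _ => le_rfl
    | succ t ih =>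
      intro ht o ho
      refine (ih (by omega) o (hVsub t ho)).trans ?_
      obtain ⟨h1, h2⟩ := Finset.mem_filter.1 ho
      exact R.coreCost_succ (by omega) hM (h2 t (Nat.lt_succ_self t)) (hr o h1)
  have hsum : ∀ t < T, ∀ P ⊆ V t, ∑ o ∈ P, c o ≤
      P.card * (cost (F t) D - cost (F (t + 1)) D + e) + 5 * A := by
    intro t ht P hP
    have h1 := R.sum_le ht hM hMk (hP.trans (hVM t))
    rw [sum_cells] at h1
    refine le_trans (Finset.sum_le_sum fun o ho => ?_) h1
    exact (hmono t ht.le o (hP ho)).trans (coreCost_le r o _)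
  -- each step adds a center near at most one reference center
  have hdich : ∀ t, V (t + 1) = V t ∨ ∃ o ∈ V t, V (t + 1) = (V t).erase o := by
    intro t
    by_cases h : ∃ o ∈ V t, dist (y t) o ≤ r o / 8
    · obtain ⟨o, ho, hd⟩ := h
      refine Or.inr ⟨o, ho, ?_⟩
      ext o'
      rw [Finset.mem_erase]
      constructor
      · intro ho'
        refine ⟨?_, hVsub t ho'⟩
        rintro rfl
        exact absurd hd (not_le.2 ((Finset.mem_filter.1 ho').2 t (Nat.lt_succ_self t)))
      · rintro ⟨hne, ho'⟩
        obtain ⟨h1, h2⟩ := Finset.mem_filter.1 ho'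
        refine Finset.mem_filter.2 ⟨h1, fun τ hτ => ?_⟩
        rcases Nat.lt_succ_iff_lt_or_eq.1 hτ with h3 | rfl
        · exact h2 τ h3
        · by_contra hcon
          push Not at hcon
          have h4 := hsep o (hVM _ ho) o' h1 hne.symm
          have h5 := hsep o' h1 o (hVM _ ho) hne
          rw [dist_comm] at h5
          have h6 := dist_triangle_left o o' (y τ)
          have h7 := hr o (hVM _ ho)
          linarith
    · push Not at h
      refine Or.inl (Finset.Subset.antisymm (hVsub t) fun o ho => ?_)
      obtain ⟨h1, h2⟩ := Finset.mem_filter.1 ho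
      refine Finset.mem_filter.2 ⟨h1, fun τ hτ => ?_⟩
      rcases Nat.lt_succ_iff_lt_or_eq.1 hτ with h3 | rfl
      · exact h2 τ h3
      · exact h o ho
  -- The potential is the cost minus the initial core costs of the untouched centers. A step that
  -- touches none lowers it by at least g. A step touching o adds c o, which by `le_topSum_sub`
  -- exceeds the step's own gain by at most e + 5 A / m and a decrease of `topSum`, and these
  -- decreases telescope.
  have hmain : ∀ t ≤ T, cost (F t) D - ∑ o ∈ V t, c o + (t - (M.card - (V t).card)) * g ≤
      cost (F 0) D - ∑ o ∈ M, c o + (topSum c m M - topSum c m (V t)) +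
        (M.card - (V t).card) * (e + 5 * A / m) := by
    intro t
    induction t with
    | zero => intro _; rw [hV0]; simp
    | succ t ih =>
      intro ht
      have h1 := ih (by omega)
      have h2 := hg t (by omega)
      rcases hdich t with h3 | ⟨o, ho, h3⟩
      · rw [h3]
        push_cast
        linarith
      · have h4 := R.cost_succ_le_add (t := t) (by omega)
        have h5 := le_topSum_sub (c := c) ho
          (g := cost (F t) D - cost (F (t + 1)) D + e) (a := 5 * A) (by linarith) (by linarith) hm
          (hsum t (by omega))
        have h6 := Finset.add_sum_erase (V t) c ho
        have h7 : (((V t).erase o).card : ℝ) = (V t).card - 1 := by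
          rw [Finset.card_erase_of_mem ho, Nat.cast_sub (Finset.card_pos.2 ⟨o, ho⟩), Nat.cast_one]
        rw [h3, h7]
        push_cast
        linarith
  have h1 := hmain T le_rfl
  have h2 := R.cost_sub_coreCost_le hT hM hMk hθ hslow
  have h3 : ∑ o ∈ V T, c o ≤ cost (F T) D :=
    (Finset.sum_le_sum (hmono T le_rfl)).trans (sum_coreCost_le hM r _ (hVM T))
  have h4 : topSum c m M ≤ m * (cost (F 0) D - cost (F 1) D + e) + 5 * A := by
    obtain ⟨P, hP, hPm, he⟩ := exists_topSum_eq c m M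
    rw [he]
    refine (hsum 0 hT P (by rw [hV0]; exact hP)).trans ?_
    have h5 := R.cost_succ_le_add hT
    have h6 : (P.card : ℝ) ≤ m := by exact_mod_cast hPm
    have h7 := mul_le_mul_of_nonneg_right h6
      (show 0 ≤ cost (F 0) D - cost (F (0 + 1)) D + e by linarith)
    simp only [zero_add] at h7 ⊢
    linarith
  have h5 := topSum_nonneg c m (V T)
  have h6 : ((M.card : ℝ) - (V T).card) ≤ k := by
    have : (M.card : ℝ) ≤ k := by exact_mod_cast hMk
    have : (0 : ℝ) ≤ (V T).card := by positivity
    linarith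
  have h7 : ((M.card : ℝ) - (V T).card) * (e + 5 * A / m) ≤ k * (e + 5 * A / m) :=
    mul_le_mul_of_nonneg_right h6 (add_nonneg R.e_nonneg (by positivity))
  have h8 : ((T : ℝ) - k) * g ≤ (T - (M.card - (V T).card)) * g :=
    mul_le_mul_of_nonneg_right (by linarith) hg0
  linarith

end SwapRun

end Rounds

/-! ### Convergence of the best-swap local search. -/

section Convergence

variable {U : Type*} [MetricSpace U] [Fintype U] {D : Finset U}

/-- The centers of a cheapest set, with a price `θ` on each center, are well separated and have
heavy cells. -/
theorem exists_separation {M : Finset U} (hM : M.Nonempty) (hD : D.Nonempty) {θ : ℝ} (hθ : 0 < θ)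
    (hmin : ∀ M' ⊆ M, M'.Nonempty → cost M D + θ * M.card ≤ cost M' D + θ * M'.card) :
    ∃ r : U → ℝ, (∀ o ∈ M, 0 < r o) ∧ (∀ o ∈ M, ∀ o' ∈ M, o ≠ o' → r o ≤ dist o o') ∧
      ∀ o ∈ M, θ ≤ (cell D M o).card * r o := by
  rcases Finset.card_pos.2 hM |>.nat_succ_le |>.eq_or_lt with h1 | h1
  · obtain ⟨c, rfl⟩ := Finset.card_eq_one.1 h1.symm
    refine ⟨fun _ => θ, fun _ _ => hθ, fun o ho o' ho' hne => ?_, fun o ho => ?_⟩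
    · rw [Finset.mem_singleton] at ho ho'
      exact absurd (ho.trans ho'.symm) hne
    · have h2 : cell D {c} o = D := by
        refine Finset.filter_true_of_mem fun X _ => ?_
        have h3 := (nearest_spec hM X).1
        rw [Finset.mem_singleton] at h3 ho
        rw [h3, ho]
      rw [h2]
      have h3 : (1 : ℝ) ≤ D.card := by exact_mod_cast Finset.card_pos.2 hD
      exact le_mul_of_one_le_left hθ.le h3
  · have herase : ∀ o ∈ M, (M.erase o).Nonempty := fun o ho => by
      rw [← Finset.card_pos, Finset.card_erase_of_mem ho]
      omega
    have hw : ∀ o ∈ M, θ ≤ (cell D M o).card * Metric.infDist o (M.erase o : Set U) := by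
      intro o ho
      have h2 := hmin (M.erase o) (Finset.erase_subset _ _) (herase o ho)
      have h3 : ((M.erase o).card : ℝ) = M.card - 1 := by
        rw [Finset.card_erase_of_mem ho, Nat.cast_sub (by omega), Nat.cast_one]
      -- Dropping o sends its cell to the nearest other center. Minimality says that this costs at
      -- least the saved price θ.
      have h4 : cost (M.erase o) D ≤
          cost M D + (cell D M o).card * Metric.infDist o (M.erase o : Set U) := by
        unfold cost cell
        rw [← nsmul_eq_mul, ← Finset.sum_const, Finset.sum_filter, ← Finset.sum_add_distrib]
        refine Finset.sum_le_sum fun X _ => ?_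
        have h5 := nearest_spec hM X
        split_ifs with h6
        · have h7 : Metric.infDist X (M.erase o : Set U) ≤
              Metric.infDist o (M.erase o : Set U) + dist X o :=
            Metric.infDist_le_infDist_add_dist
          rw [← h5.2, h6, add_comm]
          simpa using h7
        · rw [add_zero, ← h5.2]
          exact infDist_le (Finset.mem_erase.2 ⟨h6, h5.1⟩) X
      rw [h3] at h2
      linarith
    refine ⟨fun o => Metric.infDist o (M.erase o : Set U), fun o ho => ?_,
      fun o ho o' ho' hne => infDist_le (Finset.mem_erase.2 ⟨hne.symm, ho'⟩) o, hw⟩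
    rcases Metric.infDist_nonneg (x := o) (s := (M.erase o : Set U)) |>.eq_or_lt with h0 | hpos
    · have h2 := hw o ho
      rw [← h0, mul_zero] at h2
      linarith
    · exact hpos

theorem exists_cost_eq_opt {k : ℕ} (hk : k ≤ Fintype.card U) (D : Finset U) :
    ∃ O : Finset U, O.card = k ∧ cost O D = opt k D := by
  obtain ⟨O₀, -, hO₀⟩ := Finset.exists_subset_card_eq (s := (Finset.univ : Finset U)) (n := k)
    (by rwa [Finset.card_univ])
  have : Nonempty {F : Finset U // F.card = k} := ⟨⟨O₀, hO₀⟩⟩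
  obtain ⟨O, hO⟩ := exists_eq_ciInf_of_finite
    (f := fun F : {F : Finset U // F.card = k} => cost F.1 D)
  exact ⟨O.1, O.2, hO⟩

theorem opt_nonneg (k : ℕ) (D : Finset U) : 0 ≤ opt k D :=
  Real.iInf_nonneg fun F => cost_nonneg F.1 D

namespace SwapRun

variable {F : ℕ → Finset U} {x y : ℕ → U} {k T : ℕ} {e : ℝ}

/-- All of the cost is at most k (gain + e) + 5 OPT, and beyond the goal 5 OPT + k e is at most 5/6
of the cost. -/
theorem gain_ge (R : SwapRun D F x y k T e) (hk : k ≤ Fintype.card U)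
    (hlarge : ∀ t ≤ T, 6 * opt k D + 12 * (k * e) < cost (F t) D) {t : ℕ} (ht : t < T) :
    cost (F t) D / (6 * k) ≤ cost (F t) D - cost (F (t + 1)) D := by
  obtain ⟨O, hOk, hO⟩ := exists_cost_eq_opt hk D
  have hOne : O.Nonempty := Finset.card_pos.1 (by rw [hOk]; exact R.k_pos)
  have hk0 : (0 : ℝ) < k := by exact_mod_cast R.k_pos
  have h1 := R.sum_le ht hOne hOk.le (le_refl O)
  rw [Finset.filter_true_of_mem fun X _ => (nearest_spec hOne X).1, hOk, hO] at h1
  have h2 : ∑ X ∈ D, Metric.infDist X (F t : Set U) = cost (F t) D := rfl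
  rw [h2] at h1
  have h3 := hlarge t ht.le
  have h4 : 0 ≤ k * e := mul_nonneg hk0.le R.e_nonneg
  rw [div_le_iff₀ (by positivity)]
  linarith

theorem antitoneOn (R : SwapRun D F x y k T e) (hk : k ≤ Fintype.card U)
    (hlarge : ∀ t ≤ T, 6 * opt k D + 12 * (k * e) < cost (F t) D) {t t' : ℕ} (h : t ≤ t')
    (ht : t' ≤ T) : cost (F t') D ≤ cost (F t) D := by
  induction h with
  | refl => exact le_rfl
  | @step s _ ih =>
    have h1 := R.gain_ge hk hlarge (t := s) ht
    have h2 : 0 ≤ cost (F s) D / (6 * k) := div_nonneg (cost_nonneg _ _) (by positivity)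
    exact le_trans (by linarith) (ih (by omega))

theorem cost_le_div_two_pow (R : SwapRun D F x y k T e) (hk : k ≤ Fintype.card U)
    (hlarge : ∀ t ≤ T, 6 * opt k D + 12 * (k * e) < cost (F t) D) {t p : ℕ}
    (ht : t + 6 * k * p ≤ T) : cost (F (t + 6 * k * p)) D ≤ cost (F t) D / 2 ^ p := by
  have hk0 : (0 : ℝ) < k := by exact_mod_cast R.k_pos
  have h1 : ∀ s, t + s ≤ T →
      cost (F (t + s)) D ≤ cost (F t) D * Real.exp (-(1 / (6 * k))) ^ s := by
    intro s
    induction s with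
    | zero => intro _; simp
    | succ s ih =>
      intro hs
      have h2 := R.gain_ge hk hlarge (t := t + s) (by omega)
      have h3 := Real.add_one_le_exp (-(1 / (6 * (k : ℝ))))
      have h4 := cost_nonneg (F (t + s)) D
      have h5 := mul_le_mul_of_nonneg_left h3 h4
      have h6 := mul_le_mul_of_nonneg_right (ih (by omega)) (Real.exp_pos (-(1 / (6 * (k : ℝ))))).le
      have h7 : cost (F (t + s)) D * (-(1 / (6 * k)) + 1) =
          cost (F (t + s)) D - cost (F (t + s)) D / (6 * k) := by ring
      have h8 : cost (F (t + (s + 1))) D ≤ cost (F (t + s)) D - cost (F (t + s)) D / (6 * k) := by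
        have : t + (s + 1) = t + s + 1 := rfl
        rw [this]
        linarith
      rw [pow_succ, ← mul_assoc]
      linarith
  refine (h1 _ ht).trans ?_
  rw [div_eq_mul_inv (cost (F t) D)]
  refine mul_le_mul_of_nonneg_left ?_ (cost_nonneg _ _)
  rw [← Real.exp_nat_mul, ← inv_pow]
  have h2 : ((6 * k * p : ℕ) : ℝ) * -(1 / (6 * k)) = p * (-1) := by
    push_cast
    field_simp
  rw [h2, Real.exp_nat_mul]
  refine pow_le_pow_left₀ (Real.exp_pos _).le ?_ p
  rw [Real.exp_neg]
  exact inv_anti₀ (by norm_num) (by linarith [Real.add_one_le_exp (1 : ℝ)])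

/-- If the ratio of the cost to the goal is at most `K * Y ^ 2`, then `3 * k` steps later it is at
most `K * Y`. -/
theorem round (R : SwapRun D F x y k T e) (hk : k ≤ Fintype.card U)
    (hlarge : ∀ t ≤ T, 6 * opt k D + 12 * (k * e) < cost (F t) D) {M : Finset U}
    (hM : M.Nonempty) (hMk : M.card ≤ k) (hMopt : cost M D ≤ 2 * opt k D) {r : U → ℝ}
    (hr : ∀ o ∈ M, 0 < r o) (hsep : ∀ o ∈ M, ∀ o' ∈ M, o ≠ o' → r o ≤ dist o o') {θ : ℝ}
    (hθ : ∀ o ∈ M, θ ≤ (cell D M o).card * r o) {t : ℕ} (ht : t + 3 * k ≤ T)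
    (hsmall : 13 / 12 * (cost (F t) D / k) ≤ θ / 64) {Λ Y : ℝ} (hΛ : 1 ≤ Λ) (hY : 1 ≤ Y)
    (hC1 : cost (F t) D ≤ 1794 * k * Λ * (opt k D + k * e))
    (hC2 : cost (F t) D ≤ 100000 * Λ * (opt k D + k * e) * Y ^ 2) :
    cost (F (t + 3 * k)) D ≤ 100000 * Λ * (opt k D + k * e) * Y := by
  have hk1 := R.k_pos
  have hk0 : (0 : ℝ) < k := by exact_mod_cast hk1
  have he := R.e_nonneg
  have hke : 0 ≤ k * e := mul_nonneg hk0.le he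
  have hopt := opt_nonneg k D
  set G := opt k D + k * e with hG
  set C := cost (F t) D with hC
  have hCpos : 0 < C := lt_of_le_of_lt (by positivity) (hlarge t (by omega))
  have hGpos : 0 < G := by
    by_contra hcon
    push Not at hcon
    have : 1794 * k * Λ * G ≤ 0 := mul_nonpos_of_nonneg_of_nonpos (by positivity) hcon
    linarith
  by_contra hcon
  push Not at hcon
  -- a time of small gain
  obtain ⟨s, hs, hsle⟩ : ∃ s ∈ Finset.range k,
      cost (F (t + s)) D - cost (F (t + s + 1)) D ≤ C / k := by
    refine Finset.exists_le_of_sum_le ⟨0, Finset.mem_range.2 hk1⟩ ?_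
    rw [Finset.sum_const, Finset.card_range, nsmul_eq_mul, mul_div_cancel₀ _ hk0.ne']
    have h1 := Finset.sum_range_sub' (fun s => cost (F (t + s)) D) k
    simp only [add_zero] at h1
    have h2 : ∀ s, t + s + 1 = t + (s + 1) := fun s => rfl
    simp only [h2]
    rw [h1]
    linarith [cost_nonneg (F (t + k)) D]
  rw [Finset.mem_range] at hs
  have R' := R.shift (a := t + s) (T' := 2 * k) (by omega)
  have hgain : ∀ τ < 2 * k, 100000 * Λ * G * Y / (6 * k) ≤
      cost (F (t + s + τ)) D - cost (F (t + s + (τ + 1))) D := by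
    intro τ hτ
    refine le_trans ?_ (R.gain_ge hk hlarge (t := t + s + τ) (by omega))
    refine div_le_div_of_nonneg_right ?_ (by positivity)
    exact hcon.le.trans (R.antitoneOn hk hlarge (by omega) ht)
  have heC : e ≤ 1 / 12 * (C / k) := by
    rw [← mul_div_assoc, le_div_iff₀ hk0]
    linarith [hlarge t (by omega)]
  -- The parameter m balances the two error terms: m C / k ≤ K Y / 12 for C ≤ K Y² stays below the
  -- left side K Y / 6, and 5 k cost M / m ≤ 120 Y OPT. Rounding up costs C / k, which the first
  -- bound on the cost controls.
  set α : ℝ := k / (12 * Y) with hα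
  have hα0 : 0 < α := by positivity
  set m := ⌈α⌉₊ with hm
  have hm0 : 0 < m := Nat.ceil_pos.2 hα0
  have hm1 : α ≤ m := Nat.le_ceil α
  have hm2 : (m : ℝ) ≤ α + 1 := (Nat.ceil_lt_add_one hα0.le).le
  have h1 := R'.gain_le (by omega) hM hMk hr hsep hθ
    (by simp only [add_zero]; linarith) hm0 (g := 100000 * Λ * G * Y / (6 * k)) (by positivity)
    hgain
  simp only [add_zero] at h1
  push_cast at h1
  have h2 : (2 * (k : ℝ) - k) * (100000 * Λ * G * Y / (6 * k)) = 100000 * Λ * G * Y / 6 := by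
    field_simp
    ring
  have h3 : (m : ℝ) * (cost (F (t + s)) D - cost (F (t + s + 1)) D + e) ≤
      13 / 12 * (100000 * Λ * G * Y / 12 + 1794 * Λ * G) := by
    have h4 : (m : ℝ) * (cost (F (t + s)) D - cost (F (t + s + 1)) D + e) ≤
        (α + 1) * (13 / 12 * (C / k)) := by
      refine (mul_le_mul_of_nonneg_left (by linarith) (by positivity)).trans
        (mul_le_mul_of_nonneg_right hm2 (by positivity))
    have h5 : α * (C / k) ≤ 100000 * Λ * G * Y / 12 := by
      have : α * (C / k) = C / (12 * Y) := by
        rw [hα]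
        field_simp
      rw [this, div_le_div_iff₀ (by positivity) (by norm_num)]
      linarith
    have h6 : C / k ≤ 1794 * Λ * G := by
      rw [div_le_iff₀ hk0]
      linarith
    linarith
  have h4 : (k : ℝ) * (e + 5 * cost M D / m) ≤ k * e + 120 * Y * opt k D := by
    have h5 : 5 * cost M D / m ≤ 5 * cost M D / α :=
      div_le_div_of_nonneg_left (by linarith [cost_nonneg M D]) hα0 hm1
    have h6 : (k : ℝ) * (5 * cost M D / α) = 60 * Y * cost M D := by
      rw [hα]
      field_simp
      ring
    have h7 : 60 * Y * cost M D ≤ 60 * Y * (2 * opt k D) :=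
      mul_le_mul_of_nonneg_left hMopt (by positivity)
    have h8 := mul_le_mul_of_nonneg_left h5 hk0.le
    linarith
  rw [h2] at h1
  have h5 : opt k D ≤ G := by linarith
  have h6 : k * e ≤ G := by linarith
  have h7 : Y * opt k D ≤ Y * G := mul_le_mul_of_nonneg_left h5 (by linarith)
  have h8 : G ≤ Λ * G * Y := by
    have : 1 ≤ Λ * Y := one_le_mul_of_one_le_of_one_le hΛ hY
    nlinarith
  have h9 : Λ * G ≤ Λ * G * Y := le_mul_of_one_le_right (by positivity) hY
  have h10 : Y * G ≤ Λ * G * Y := by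
    have := le_mul_of_one_le_left (show 0 ≤ Y * G by positivity) hΛ
    linarith
  linarith

/-- The local search reaches a constant approximation, up to the errors, in a number of steps that
is doubly logarithmic for each center. -/
theorem exists_cost_le (R : SwapRun D F x y k T e) (hk : k ≤ Fintype.card U) {q b : ℕ}
    (hq : 65536 * Real.log (1 + 24576 * (Fintype.card U : ℝ) ^ 3) ≤ 2 ^ q)
    (hb : (12 * Fintype.card U : ℝ) ≤ 2 ^ 2 ^ b)
    (hT : 17 * k * (37891 + 288 * (q + b)) ≤ T) :
    ∃ t ≤ T, cost (F t) D ≤ 6 * opt k D + 12 * (k * e) := by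
  by_contra hcon
  push Not at hcon
  have hk1 := R.k_pos
  have hk0 : (0 : ℝ) < k := by exact_mod_cast hk1
  have hk1' : (1 : ℝ) ≤ k := by exact_mod_cast hk1
  have he := R.e_nonneg
  have hke : 0 ≤ k * e := mul_nonneg hk0.le he
  have hopt := opt_nonneg k D
  set G := opt k D + k * e with hG
  obtain ⟨l, hl⟩ : ∃ l : ℕ, l = 37891 + 288 * (q + b) := ⟨_, rfl⟩
  rw [← hl] at hT
  set Λ : ℝ := (l : ℝ) with hΛ
  have hΛ1 : (1 : ℝ) ≤ Λ := by
    rw [hΛ]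
    exact_mod_cast (by omega : 1 ≤ l)
  have hlb : b ≤ l := by omega
  have hDcard : D.card ≤ Fintype.card U := Finset.card_le_univ D
  set T₁ := k * l with hT₁
  have hkl : k ≤ T₁ := Nat.le_mul_of_pos_right k (by omega)
  have hTT₁ : 17 * T₁ ≤ T := by rw [hT₁]; linarith
  have h19 : 19 * k ≤ T₁ := by
    rw [hT₁, mul_comm]
    exact Nat.mul_le_mul_left k (by omega)
  have hkb : k * b ≤ T₁ := Nat.mul_le_mul_left k hlb
  have hRT₁ : ∀ M : Finset U, M.Nonempty → M.card ≤ k → cost (F T₁) D ≤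
      768 * cost M D + 513 * (T₁ * (2 * cost M D / (k - M.card + 1) + e)) := by
    intro M hM hMk
    have R' := R.shift (a := 0) (T' := T₁) (by omega)
    have h1 := R'.cost_le hDcard hM hMk hq hb ?_
    · simpa only [zero_add] using h1
    · have h2 : (M.card : ℝ) ≤ k := by exact_mod_cast hMk
      have h3 : 2 * (M.card : ℝ) * (18945 + 144 * ((q : ℝ) + b)) ≤
          2 * k * (18945 + 144 * (q + b)) := by gcongr
      rw [hT₁, hl]
      push_cast
      linarith
  set C := cost (F T₁) D with hC
  have hT₁' : (T₁ : ℝ) = k * Λ := by rw [hT₁, hΛ]; push_cast; ring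
  have hT₁pos : (0 : ℝ) < T₁ := by rw [hT₁']; positivity
  have hCpos : 0 < C := lt_of_le_of_lt (by positivity) (hcon T₁ (by omega))
  obtain ⟨O, hOk, hO⟩ := exists_cost_eq_opt hk D
  have hOne : O.Nonempty := Finset.card_pos.1 (by omega)
  have hC1 : C ≤ 1794 * k * Λ * G := by
    have h1 := hRT₁ O hOne hOk.le
    rw [hO, hOk, sub_self, zero_add, div_one, hT₁'] at h1
    have h2 : opt k D ≤ k * Λ * opt k D :=
      le_mul_of_one_le_left hopt (one_le_mul_of_one_le_of_one_le hk1' hΛ1)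
    have h3 : k * Λ * e ≤ k * Λ * (k * e) :=
      mul_le_mul_of_nonneg_left (le_mul_of_one_le_left he hk1') (by positivity)
    have h4 : 0 ≤ k * Λ * (k * e) := by positivity
    rw [hG]
    linarith
  have hGpos : 0 < G := by
    by_contra h0
    push Not at h0
    have : 1794 * k * Λ * G ≤ 0 := mul_nonpos_of_nonneg_of_nonpos (by positivity) h0
    linarith
  -- the last phase
  have hpow : ∀ p : ℕ, (2 : ℝ) ^ p * Λ ≤ 2 ^ (p + l) := by
    intro p
    rw [pow_add, hΛ]
    refine mul_le_mul_of_nonneg_left ?_ (by positivity)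
    exact_mod_cast (Nat.lt_two_pow_self (n := l)).le
  -- From 200000 Λ G on, 18 + l halvings lead below G = OPT + k e, because 2^l ≥ Λ. This contradicts
  -- the assumption that the goal is never reached.
  have hlast : ∀ t, t + 6 * k * (18 + l) ≤ T → ¬ cost (F t) D ≤ 200000 * Λ * G := by
    intro t ht hle
    have h1 := R.cost_le_div_two_pow hk hcon ht
    have h2 := hcon _ ht
    have h3 : cost (F t) D / 2 ^ (18 + l) ≤ G := by
      rw [div_le_iff₀ (by positivity)]
      have h4 := mul_le_mul_of_nonneg_left (hpow 18) hGpos.le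
      have h5 : 0 ≤ Λ * G := by positivity
      linarith
    linarith
  -- If the errors make up half of the bound of phase one, the cost is already O(Λ k e) and the
  -- final phase applies at once.
  by_cases hcase : C / 2 < 513 * (T₁ * e)
  · refine hlast T₁ (by nlinarith) ?_
    rw [hT₁'] at hcase
    have h1 : Λ * (k * e) ≤ Λ * G := mul_le_mul_of_nonneg_left (by linarith) (by linarith)
    have h2 : 0 ≤ Λ * G := by positivity
    linarith
  push Not at hcase
  -- the reference centers
  set θ := C / (7200 * T₁) with hθ
  have hθpos : 0 < θ := by positivity
  have hCθ : C = 7200 * T₁ * θ := by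
    rw [hθ]
    field_simp
  obtain ⟨M, hMmem, hMmin⟩ := ((Finset.univ : Finset (Finset U)).filter
    fun M => M.Nonempty ∧ M.card ≤ k).exists_min_image (fun M => cost M D + θ * M.card)
    ⟨O, Finset.mem_filter.2 ⟨Finset.mem_univ _, hOne, hOk.le⟩⟩
  obtain ⟨-, hM, hMk⟩ := Finset.mem_filter.1 hMmem
  have hMk' : (M.card : ℝ) ≤ k := by exact_mod_cast hMk
  have hMmin' : ∀ M' : Finset U, M'.Nonempty → M'.card ≤ k →
      cost M D + θ * M.card ≤ cost M' D + θ * M'.card := fun M' h1 h2 =>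
    hMmin M' (Finset.mem_filter.2 ⟨Finset.mem_univ _, h1, h2⟩)
  -- The price θ is chosen for this: if cost M > 2 OPT, then cost M ≤ 2 θ (k - |M|), and phase one
  -- applied to M itself bounds C / 2 by (768 · 2 + 513 · 4) T₁ θ < 3600 T₁ θ = C / 2.
  have hMopt : cost M D ≤ 2 * opt k D := by
    have h1 := hMmin' O hOne hOk.le
    rw [hO, hOk] at h1
    set z : ℝ := k - M.card with hz
    have hz0 : 0 ≤ z := by linarith
    by_contra hcon2
    push Not at hcon2
    have h2 : cost M D ≤ opt k D + θ * z := by rw [hz]; linarith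
    have h3 : cost M D ≤ 2 * (θ * z) := by linarith
    have h4 := hRT₁ M hM hMk
    rw [← hz] at h4
    have h5 : 2 * cost M D / (z + 1) ≤ 4 * θ := by
      rw [div_le_iff₀ (by linarith)]
      linarith
    have h6 := mul_le_mul_of_nonneg_left h5 hT₁pos.le
    have h7 : θ * z ≤ θ * T₁ := by
      refine mul_le_mul_of_nonneg_left ?_ hθpos.le
      have h8 : z ≤ k := by rw [hz]; linarith [(Nat.cast_nonneg M.card : (0 : ℝ) ≤ M.card)]
      have h9 : (k : ℝ) ≤ T₁ := by exact_mod_cast hkl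
      linarith
    have h8 : 0 < T₁ * θ := by positivity
    linarith
  have hDne : D.Nonempty := by
    by_contra h0
    rw [Finset.not_nonempty_iff_eq_empty] at h0
    rw [hC, h0] at hCpos
    simp [cost] at hCpos
  obtain ⟨r, hr, hsep, hrθ⟩ := exists_separation hM hDne hθpos fun M' h1 h2 =>
    hMmin' M' h2 ((Finset.card_le_card h1).trans hMk)
  -- the rounds
  set t₁ := T₁ + 6 * k * (19 + l) with ht₁
  have ht₁T : t₁ + 3 * k * b ≤ T := by nlinarith
  have hCt₁ : cost (F t₁) D ≤ C / 2 ^ (19 + l) := R.cost_le_div_two_pow hk hcon (by omega)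
  have hsmall : 13 / 12 * (cost (F t₁) D / k) ≤ θ / 64 := by
    have h1 : C / 2 ^ (19 + l) ≤ C / (2 ^ 19 * Λ) :=
      div_le_div_of_nonneg_left hCpos.le (by positivity) (hpow 19)
    have h2 : 13 / 12 * (C / (2 ^ 19 * Λ) / k) ≤ θ / 64 := by
      rw [hθ, hT₁', div_div, div_div, ← mul_div_assoc, div_le_div_iff₀ (by positivity)
        (by positivity)]
      have h3 : 0 < C * (k * Λ) := by positivity
      linarith
    have h3 : cost (F t₁) D / k ≤ C / (2 ^ 19 * Λ) / k :=
      div_le_div_of_nonneg_right (hCt₁.trans h1) hk0.le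
    linarith
  have hrounds : ∀ i ≤ b, cost (F (t₁ + 3 * k * i)) D ≤
      100000 * Λ * G * 2 ^ 2 ^ (b - i) := by
    intro i
    induction i with
    | zero =>
      intro _
      have h1 : cost (F (t₁ + 3 * k * 0)) D ≤ C :=
        R.antitoneOn hk hcon (by omega) (by omega)
      have h2 : (k : ℝ) ≤ 2 ^ 2 ^ (b - 0) := by
        have h3 : (k : ℝ) ≤ Fintype.card U := by exact_mod_cast hk
        simp only [Nat.sub_zero]
        linarith [(Nat.cast_nonneg (Fintype.card U) : (0 : ℝ) ≤ Fintype.card U)]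
      have h3 := mul_le_mul_of_nonneg_left h2 (show 0 ≤ Λ * G by positivity)
      have h4 : 0 ≤ Λ * G * 2 ^ 2 ^ (b - 0) := by positivity
      linarith
    | succ i ih =>
      intro hi
      have h1 := ih (by omega)
      have hib : t₁ + 3 * k * i + 3 * k ≤ T := by
        have h2 : 3 * k * (i + 1) ≤ 3 * k * b := Nat.mul_le_mul_left _ hi
        have h3 : 3 * k * (i + 1) = 3 * k * i + 3 * k := by ring
        omega
      have h2 : cost (F (t₁ + 3 * k * i)) D ≤ cost (F t₁) D :=
        R.antitoneOn hk hcon (by omega) (by omega)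
      have h3 : b - i = b - (i + 1) + 1 := by omega
      have h4 : t₁ + 3 * k * (i + 1) = t₁ + 3 * k * i + 3 * k := by ring
      rw [h4]
      refine R.round hk hcon hM hMk hMopt hr hsep hrθ hib ?_ hΛ1
        (one_le_pow₀ (by norm_num)) ?_ ?_
      · refine le_trans ?_ hsmall
        gcongr
      · exact (R.antitoneOn hk hcon (by omega) (by omega)).trans hC1
      · rw [h3, pow_succ, pow_mul] at h1
        exact h1
  have hend := hrounds b le_rfl
  rw [Nat.sub_self, pow_zero, pow_one] at hend
  refine hlast _ ?_ (by linarith)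
  have h1 : 3 * k * b + 6 * k * (18 + l) + 6 * k * (19 + l) + T₁ ≤ T := by nlinarith
  omega

end SwapRun

end Convergence

/-! ### Utility -/

section Failure

variable {α β : Type*}

theorem toOuterMeasure_le_one (p : PMF α) (s : Set α) : p.toOuterMeasure s ≤ 1 := by
  rw [PMF.toOuterMeasure_apply, ← p.tsum_coe]
  exact ENNReal.tsum_le_tsum fun a => Set.indicator_le_self _ _ a

theorem toOuterMeasure_bind_le {p : PMF α} {f : α → PMF β} {B : Set α} {B' : Set β} {δ δ' : ℝ≥0∞}
    (hp : p.toOuterMeasure B ≤ δ) (hf : ∀ a ∉ B, (f a).toOuterMeasure B' ≤ δ') :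
    (p.bind f).toOuterMeasure B' ≤ δ + δ' := by
  rw [PMF.toOuterMeasure_bind_apply]
  have h1 : ∀ a, p a * (f a).toOuterMeasure B' ≤ B.indicator p a + p a * δ' := by
    intro a
    by_cases ha : a ∈ B
    · rw [Set.indicator_of_mem ha]
      exact le_add_right (mul_le_of_le_one_right' (toOuterMeasure_le_one _ _))
    · rw [Set.indicator_of_notMem ha, zero_add]
      gcongr
      exact hf a ha
  refine (ENNReal.tsum_le_tsum h1).trans ?_
  rw [ENNReal.tsum_add, ENNReal.tsum_mul_right, p.tsum_coe, one_mul, ← PMF.toOuterMeasure_apply]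
  gcongr

theorem one_sub_le_toOuterMeasure (p : PMF α) (s : Set α) {δ : ℝ} (hδ : 0 ≤ δ)
    (h : p.toOuterMeasure sᶜ ≤ ENNReal.ofReal δ) : ENNReal.ofReal (1 - δ) ≤ p.toOuterMeasure s := by
  have h1 : p.toOuterMeasure Set.univ ≤ p.toOuterMeasure s + p.toOuterMeasure sᶜ := by
    rw [← Set.union_compl_self s]
    exact measure_union_le _ _
  have h2 : p.toOuterMeasure Set.univ = 1 := by
    rw [PMF.toOuterMeasure_apply, Set.indicator_univ, p.tsum_coe]
  rw [h2] at h1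
  rw [ENNReal.ofReal_sub _ hδ, ENNReal.ofReal_one, tsub_le_iff_right]
  exact h1.trans (by gcongr)

variable [Fintype α]

theorem expMechanism_apply (s : Finset α) (hs : s.Nonempty) (η : ℝ) (q : α → ℝ) (a : α) :
    expMechanism s hs η q a = (if a ∈ s then ENNReal.ofReal (Real.exp (-(η * q a))) else 0) *
      (∑ b ∈ s, ENNReal.ofReal (Real.exp (-(η * q b))))⁻¹ := by
  rw [expMechanism, PMF.normalize_apply, tsum_fintype, Finset.sum_ite_mem, Finset.univ_inter]

/-- The weight of a candidate worse by e than some other one is at most exp (-η e) times the weight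
of the better one, hence of the whole sum. -/
theorem expMechanism_failure (s : Finset α) (hs : s.Nonempty) {η : ℝ} (hη : 0 ≤ η) (q : α → ℝ)
    (e : ℝ) : (expMechanism s hs η q).toOuterMeasure {a | ¬ (a ∈ s ∧ ∀ b ∈ s, q a ≤ q b + e)} ≤
      s.card * ENNReal.ofReal (Real.exp (-(η * e))) := by
  rw [PMF.toOuterMeasure_apply_fintype, ← nsmul_eq_mul, ← Finset.sum_const,
    ← Finset.sum_subset (Finset.subset_univ s)]
  · refine Finset.sum_le_sum fun a ha => ?_
    by_cases hb : a ∈ {a | ¬ (a ∈ s ∧ ∀ b ∈ s, q a ≤ q b + e)}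
    · rw [Set.indicator_of_mem hb, expMechanism_apply, if_pos ha]
      obtain ⟨b, hbs, hlt⟩ : ∃ b ∈ s, q b + e < q a := by
        by_contra hcon
        push Not at hcon
        exact hb ⟨ha, hcon⟩
      have h1 : ENNReal.ofReal (Real.exp (-(η * q b))) ≤
          ∑ b ∈ s, ENNReal.ofReal (Real.exp (-(η * q b))) :=
        Finset.single_le_sum (f := fun b => ENNReal.ofReal (Real.exp (-(η * q b))))
          (fun _ _ => zero_le) hbs
      rw [← div_eq_mul_inv]
      refine ENNReal.div_le_of_le_mul ?_
      refine le_trans ?_ (mul_le_mul_right h1 _)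
      rw [← ENNReal.ofReal_mul (Real.exp_pos _).le, ← Real.exp_add]
      refine ENNReal.ofReal_le_ofReal (Real.exp_le_exp.2 ?_)
      nlinarith
    · rw [Set.indicator_of_notMem hb]
      exact zero_le
  · intro a _ ha
    rw [Set.indicator_apply, expMechanism_apply, if_neg ha, zero_mul, ite_self]

end Failure

/-! ### Good runs of the private local search. -/

section Utility

variable {U : Type*} [MetricSpace U] [Fintype U]

/-- `F'` results from `F` by an almost optimal swap, if there is any swap. -/
def GoodStep (D : Finset U) (e : ℝ) (F F' : Finset U) : Prop :=
  if (F ×ˢ Fᶜ).Nonempty then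
    ∃ p ∈ F ×ˢ Fᶜ, F' = swap F p ∧ ∀ p' ∈ F ×ˢ Fᶜ, cost F' D ≤ cost (swap F p') D + e
  else F' = F

theorem card_swap {F : Finset U} {p : U × U} (hp : p ∈ F ×ˢ Fᶜ) : (swap F p).card = F.card := by
  obtain ⟨h1, h2⟩ := Finset.mem_product.1 hp
  rw [Finset.mem_compl] at h2
  rw [swap, Finset.card_insert_of_notMem fun h => h2 (Finset.mem_of_mem_erase h),
    Finset.card_erase_of_mem h1]
  have := Finset.card_pos.2 ⟨_, h1⟩
  omega

theorem GoodStep.card_eq {D F F' : Finset U} {e : ℝ} (h : GoodStep D e F F') :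
    F'.card = F.card := by
  unfold GoodStep at h
  split_ifs at h
  · obtain ⟨p, hp, rfl, -⟩ := h
    exact card_swap hp
  · rw [h]

/-- Good steps only compete with swaps that bring in a new center, while `SwapRun` allows any point.
The gap is closed while the goal is missed; for k = n the cost is zero. -/
theorem exists_cost_le_of_goodSteps {D : Finset U} {F : ℕ → Finset U} {k T q b : ℕ} {e : ℝ}
    (he : 0 ≤ e) (hk0 : 0 < k) (hk : k ≤ Fintype.card U) (hF : (F 0).card = k)
    (hgood : ∀ t < T, GoodStep D e (F t) (F (t + 1)))
    (hq : 65536 * Real.log (1 + 24576 * (Fintype.card U : ℝ) ^ 3) ≤ 2 ^ q)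
    (hb : (12 * Fintype.card U : ℝ) ≤ 2 ^ 2 ^ b)
    (hT : 17 * k * (37891 + 288 * (q + b)) ≤ T) :
    ∃ t ≤ T, cost (F t) D ≤ 6 * opt k D + 12 * (k * e) := by
  have hopt := opt_nonneg k D
  have hke : 0 ≤ k * e := mul_nonneg (Nat.cast_nonneg k) he
  have hcard : ∀ t ≤ T, (F t).card = k := by
    intro t
    induction t with
    | zero => exact fun _ => hF
    | succ t ih => exact fun ht => ((hgood t (by omega)).card_eq).trans (ih (by omega))
  rcases hk.lt_or_eq with hlt | heq
  · by_contra hcon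
    push Not at hcon
    have hne : ∀ t ≤ T, (F t ×ˢ (F t)ᶜ).Nonempty := fun t ht => by
      rw [← Finset.card_pos, Finset.card_product, Finset.card_compl, hcard t ht]
      exact Nat.mul_pos hk0 (by omega)
    have hgood' : ∀ t, ∃ p : U × U, t < T → p ∈ F t ×ˢ (F t)ᶜ ∧ F (t + 1) = swap (F t) p ∧
        ∀ p' ∈ F t ×ˢ (F t)ᶜ, cost (F (t + 1)) D ≤ cost (swap (F t) p') D + e := by
      intro t
      by_cases ht : t < T
      · have h1 := hgood t ht
        rw [GoodStep, if_pos (hne t ht.le)] at h1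
        obtain ⟨p, hp⟩ := h1
        exact ⟨p, fun _ => hp⟩
      · obtain ⟨z, -⟩ := Finset.card_pos.1
          (by rw [hcard 0 (Nat.zero_le T)]; exact hk0 : 0 < (F 0).card)
        exact ⟨(z, z), fun h => absurd h ht⟩
    choose p hp using hgood'
    obtain ⟨O, hOk, hO⟩ := exists_cost_eq_opt hk D
    have hOne : O.Nonempty := Finset.card_pos.1 (by omega)
    have R : SwapRun D F (fun t => (p t).1) (fun t => (p t).2) k T e :=
      { k_pos := hk0
        e_nonneg := he
        card := hcard
        mem := fun t ht => (Finset.mem_product.1 (hp t ht).1).1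
        step := fun t ht => (hp t ht).2.1
        near_opt := fun t ht x' hx' y' => by
          by_cases hy : y' ∈ F t
          -- Swapping in a point of F t cannot lower the cost, whereas beyond the goal some swap
          -- strictly lowers it, and that swap brings in a new center.
          · obtain ⟨f, hf, hsum⟩ := exists_swaps hOne (F := F t) (by rw [hcard t ht.le, hOk]) D
            have h1 := hsum O le_rfl
            rw [Finset.filter_true_of_mem fun X _ => (nearest_spec hOne X).1, hO] at h1
            have h2 : ∑ X ∈ D, Metric.infDist X (F t : Set U) = cost (F t) D := rfl
            rw [h2] at h1
            have h3 := hcon t ht.le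
            obtain ⟨o, ho, hgain⟩ : ∃ o ∈ O, 0 < cost (F t) D - cost (swap (F t) (f o, o)) D := by
              by_contra hneg
              push Not at hneg
              linarith [Finset.sum_nonpos hneg]
            have hsub : ∀ z ∈ F t, ∀ x' ∈ F t, cost (F t) D ≤ cost (swap (F t) (x', z)) D :=
              fun z hz x' _ => cost_anti (Finset.insert_subset hz (Finset.erase_subset _ _))
                ⟨z, Finset.mem_insert_self _ _⟩
            have hoF : o ∉ F t := fun h => by
              have := hsub o h (f o) (hf o ho)
              linarith
            have h4 := (hp t ht).2.2 (f o, o)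
              (Finset.mem_product.2 ⟨hf o ho, Finset.mem_compl.2 hoF⟩)
            have h5 := hsub y' hy x' hx'
            linarith
          · exact (hp t ht).2.2 (x', y') (Finset.mem_product.2 ⟨hx', Finset.mem_compl.2 hy⟩) }
    obtain ⟨t, ht, hle⟩ := R.exists_cost_le hk hq hb hT
    exact absurd hle (not_le.2 (hcon t ht))
  · refine ⟨0, Nat.zero_le T, ?_⟩
    have h1 : F 0 = Finset.univ := Finset.eq_univ_of_card _ (by rw [hF, heq])
    have h2 : cost (F 0) D = 0 := Finset.sum_eq_zero fun X _ =>
      Metric.infDist_zero_of_mem (by rw [h1]; exact Finset.mem_coe.2 (Finset.mem_univ X))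
    rw [h2]
    positivity

theorem swapStep_failure (D F : Finset U) {η : ℝ} (hη : 0 ≤ η) (e : ℝ) :
    (swapStep η D F).toOuterMeasure {F' | ¬ GoodStep D e F F'} ≤
      (Fintype.card U : ℝ≥0∞) ^ 2 * ENNReal.ofReal (Real.exp (-(η * e))) := by
  unfold swapStep
  split_ifs with h
  · rw [PMF.toOuterMeasure_map_apply]
    refine le_trans (measure_mono ?_)
      ((expMechanism_failure (F ×ˢ Fᶜ) h hη (fun p => cost (swap F p) D) e).trans ?_)
    · intro p hp hgood
      refine hp ?_
      rw [GoodStep, if_pos h]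
      exact ⟨p, hgood.1, rfl, hgood.2⟩
    · gcongr
      rw [Finset.card_product, sq]
      exact_mod_cast Nat.mul_le_mul (Finset.card_le_univ F) (Finset.card_le_univ Fᶜ)
  · rw [PMF.toOuterMeasure_pure_apply, if_neg]
    · exact zero_le
    · rw [Set.mem_ofPred_eq, not_not, GoodStep, if_neg h]

theorem swapSequence_failure (D F : Finset U) {η : ℝ} (hη : 0 ≤ η) (e : ℝ) (T : ℕ) :
    (swapSequence η D F T).toOuterMeasure
      {Fs | ¬ (Fs 0 = F ∧ ∀ i : Fin T, GoodStep D e (Fs i.castSucc) (Fs i.succ))} ≤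
      T * ((Fintype.card U : ℝ≥0∞) ^ 2 * ENNReal.ofReal (Real.exp (-(η * e)))) := by
  induction T with
  | zero =>
    rw [swapSequence, PMF.toOuterMeasure_pure_apply, if_neg]
    · exact zero_le
    · rw [Set.mem_ofPred_eq, not_not]
      exact ⟨rfl, fun i => i.elim0⟩
  | succ T ih =>
    rw [swapSequence, Nat.cast_succ, add_mul, one_mul]
    refine toOuterMeasure_bind_le ih fun Fs hFs => ?_
    rw [Set.mem_ofPred_eq, not_not] at hFs
    rw [PMF.toOuterMeasure_map_apply]
    refine le_trans (measure_mono ?_) (swapStep_failure D (Fs (Fin.last T)) hη e)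
    intro F' hF' hgood
    have hc : ∀ i : Fin (T + 1), Fin.snoc (α := fun _ => Finset U) Fs F' i.castSucc = Fs i :=
      fun i => Fin.snoc_castSucc (α := fun _ => Finset U) F' Fs i
    have hl : Fin.snoc (α := fun _ => Finset U) Fs F' (Fin.last (T + 1)) = F' :=
      Fin.snoc_last (α := fun _ => Finset U) F' Fs
    refine hF' ⟨(hc 0).trans hFs.1, fun i => ?_⟩
    show GoodStep D e (Fin.snoc (α := fun _ => Finset U) Fs F' i.castSucc)
      (Fin.snoc (α := fun _ => Finset U) Fs F' i.succ)
    refine Fin.lastCases ?_ (fun i => ?_) i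
    · rw [hc, Fin.succ_last, hl]
      exact hgood
    · rw [hc, ← Fin.castSucc_succ, hc]
      exact hFs.2 i

end Utility

/-! ### Union bound and choice of the parameters. -/

section Utility

variable {U : Type*} [MetricSpace U] [Fintype U]

/-- There are T swaps with at most n² candidates each and one selection among T + 1 sets. The
selection loses another e ≤ k e, so 12 becomes 13. -/
theorem localSearch_failure {L : ℕ} {β : ℝ} {k T q b : ℕ} {ε : ℝ} (hε : 0 < ε) (D : Finset U)
    (hk0 : 0 < k) (hk : k ≤ Fintype.card U)
    (hinit : (dpHstInit L β k (half_pos hε) D).toOuterMeasure {F | F.card ≠ k} = 0)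
    (hq : 65536 * Real.log (1 + 24576 * (Fintype.card U : ℝ) ^ 3) ≤ 2 ^ q)
    (hb : (12 * Fintype.card U : ℝ) ≤ 2 ^ 2 ^ b)
    (hT : 17 * k * (37891 + 288 * (q + b)) ≤ T) {e : ℝ} (he : 0 ≤ e) :
    (dpHstLocalSearch L β k T hε D).toOuterMeasure
      {F | F.card = k ∧ cost F D ≤ 6 * opt k D + 13 * (k * e)}ᶜ ≤
      ((T + 1) * (Fintype.card U ^ 2 + 1) : ℝ≥0∞) *
        ENNReal.ofReal (Real.exp (-(swapParameter L T ε * e))) := by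
  have hη : 0 ≤ swapParameter L T ε := by unfold swapParameter; positivity
  set η := swapParameter L T ε with hηdef
  set δ := ENNReal.ofReal (Real.exp (-(η * e))) with hδ
  have hfinal : (dpHstLocalSearch L β k T hε D).toOuterMeasure
      {F | F.card = k ∧ cost F D ≤ 6 * opt k D + 13 * (k * e)}ᶜ ≤
      0 + (T * ((Fintype.card U : ℝ≥0∞) ^ 2 * δ) + ((T + 1 : ℕ) : ℝ≥0∞) * δ) := by
    refine toOuterMeasure_bind_le hinit.le fun F₁ hF₁ => ?_
    rw [Set.mem_ofPred_eq, ne_eq, not_not] at hF₁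
    refine toOuterMeasure_bind_le (swapSequence_failure D F₁ hη e T) fun Fs hFs => ?_
    rw [Set.mem_ofPred_eq, not_not] at hFs
    rw [PMF.toOuterMeasure_map_apply]
    have hsel := expMechanism_failure (Finset.univ : Finset (Fin (T + 1))) Finset.univ_nonempty hη
      (fun j => cost (Fs j) D) e
    rw [Finset.card_univ, Fintype.card_fin] at hsel
    refine le_trans (measure_mono ?_) hsel
    intro j hj hgood
    refine hj ?_
    set F : ℕ → Finset U := fun t => if h : t < T + 1 then Fs ⟨t, h⟩ else F₁ with hF
    have hFt : ∀ t (h : t < T + 1), F t = Fs ⟨t, h⟩ := fun t h => dif_pos h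
    have hF0 : F 0 = F₁ := by rw [hFt 0 (Nat.succ_pos T)]; exact hFs.1
    have hsteps : ∀ t < T, GoodStep D e (F t) (F (t + 1)) := fun t ht => by
      rw [hFt t (by omega), hFt (t + 1) (by omega)]
      exact hFs.2 ⟨t, ht⟩
    have hcard : ∀ t ≤ T, (F t).card = k := by
      intro t
      induction t with
      | zero => exact fun _ => by rw [hF0, hF₁]
      | succ t ih => exact fun ht => ((hsteps t (by omega)).card_eq).trans (ih (by omega))
    obtain ⟨t, ht, hle⟩ := exists_cost_le_of_goodSteps he hk0 hk (by rw [hF0, hF₁]) hsteps hq hb hT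
    have h1 := hgood.2 ⟨t, by omega⟩ (Finset.mem_univ _)
    rw [hFt t (by omega)] at hle
    refine ⟨?_, ?_⟩
    · have h2 := hcard j (by omega)
      rwa [hFt j j.2] at h2
    · have hk1 : (1 : ℝ) ≤ k := by exact_mod_cast hk0
      have h2 : e ≤ k * e := le_mul_of_one_le_left he hk1
      linarith
  refine hfinal.trans (le_of_eq_of_le (zero_add _) ?_)
  rw [← mul_assoc, ← add_mul]
  gcongr
  push_cast
  rw [mul_add, mul_one]
  gcongr
  exact le_self_add

/-- The base-two logarithm of `log n`, rounded up. -/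
theorem exists_double_log {n : ℝ} (hn : 3 ≤ n) :
    1 ≤ Real.log n ∧ 1 / 50 ≤ Real.log (Real.log n) ∧ Real.log (Real.log n) ≤ n ∧
      ∃ m : ℕ, Real.log n ≤ 2 ^ m ∧ (m : ℝ) ≤ 3 / 2 * Real.log (Real.log n) + 1 := by
  have h1 : 1026 / 1000 ≤ Real.log n := by
    have h2 : Real.log 3 ≤ Real.log n := Real.log_le_log (by norm_num) hn
    have h3 : Real.log 3 = Real.log 2 + Real.log (3 / 2) := by
      rw [← Real.log_mul (by norm_num) (by norm_num)]
      norm_num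
    have h4 := Real.log_two_gt_d9
    have h5 := Real.one_sub_inv_le_log_of_pos (show (0 : ℝ) < 3 / 2 by norm_num)
    norm_num at h5
    linarith
  have hpos : 0 < Real.log n := by linarith
  have h2 : 1 / 50 ≤ Real.log (Real.log n) := by
    refine le_trans ?_ (Real.one_sub_inv_le_log_of_pos hpos)
    have h3 : (Real.log n)⁻¹ ≤ (1026 / 1000 : ℝ)⁻¹ := inv_anti₀ (by norm_num) h1
    norm_num at h3
    linarith
  refine ⟨by linarith, h2, ?_, ⌈Real.logb 2 (Real.log n)⌉₊, ?_, ?_⟩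
  · have h3 := Real.log_le_sub_one_of_pos hpos
    have h4 := Real.log_le_sub_one_of_pos (show 0 < n by linarith)
    linarith
  · have h3 := Nat.le_ceil (Real.logb 2 (Real.log n))
    rw [Real.logb_le_iff_le_rpow (by norm_num) hpos, Real.rpow_natCast] at h3
    exact h3
  · have h3 : 0 ≤ Real.logb 2 (Real.log n) := Real.logb_nonneg (by norm_num) (by linarith)
    have h4 := (Nat.ceil_lt_add_one h3).le
    have h5 : Real.logb 2 (Real.log n) ≤ 3 / 2 * Real.log (Real.log n) := by
      rw [Real.logb, div_le_iff₀ (Real.log_pos (by norm_num))]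
      have h6 := Real.log_two_gt_d9
      nlinarith
    linarith

theorem localSearch_utility {c : ℝ} (hc : 0 < c) (hn : 3 ≤ Fintype.card U) {L : ℕ} {β : ℝ} {k : ℕ}
    (hk0 : 1 ≤ k) (hk : k ≤ Fintype.card U) {ε : ℝ} (hε : 0 < ε) (D : Finset U)
    (hinit : (dpHstInit L β k (half_pos hε) D).toOuterMeasure {F | F.card ≠ k} = 0) :
    ENNReal.ofReal (1 - (Fintype.card U : ℝ) ^ (-c)) ≤
      (dpHstLocalSearch L β k
        ⌈40000000 * k * Real.log (Real.log (Fintype.card U))⌉₊ hε D).toOuterMeasure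
        {F | F.card = k ∧ cost F D ≤ 6 * opt k D +
          52 * (c + 21) * 40000100 * (ε⁻¹ * k ^ 2 * 2 ^ L *
            Real.log (Real.log (Fintype.card U)) * Real.log (Fintype.card U))} := by
  set n : ℝ := (Fintype.card U : ℝ) with hndef
  have hn3 : (3 : ℝ) ≤ n := by rw [hndef]; exact_mod_cast hn
  have hn0 : 0 < n := by linarith
  obtain ⟨hlog, hll, hlln, m, hm1, hm2⟩ := exists_double_log hn3
  set l := Real.log n with hl
  set ll := Real.log l with hlldef
  have hk1 : (1 : ℝ) ≤ k := by exact_mod_cast hk0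
  have hkn : (k : ℝ) ≤ n := by rw [hndef]; exact_mod_cast hk
  set T := ⌈40000000 * k * ll⌉₊ with hT
  have hT1 : 40000000 * k * ll ≤ T := Nat.le_ceil _
  have hkll : 1 / 50 ≤ k * ll := by nlinarith
  have hT2 : (T : ℝ) + 1 ≤ 40000100 * (k * ll) := by
    have := (Nat.ceil_lt_add_one (show 0 ≤ 40000000 * k * ll by positivity)).le
    linarith
  -- The failure bound becomes n^(-c) n^(-21) (T + 1) (n² + 1), and the last two factors are at most
  -- n^18 and n³.
  set e := (c + 21) * l / swapParameter L T ε with he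
  have hη : 0 < swapParameter L T ε := by unfold swapParameter; positivity
  have he0 : 0 ≤ e := by positivity
  have hηe : swapParameter L T ε * e = (c + 21) * l := by
    rw [he]
    field_simp
  have hq : 65536 * Real.log (1 + 24576 * n ^ 3) ≤ 2 ^ (20 + m) := by
    have h1 : 1 + 24576 * n ^ 3 ≤ n ^ 13 := by
      have h2 : (3 : ℝ) ^ 10 ≤ n ^ 10 := pow_le_pow_left₀ (by norm_num) hn3 10
      have h3 : (1 : ℝ) ≤ n ^ 3 := one_le_pow₀ (by linarith)
      have h4 : n ^ 13 = n ^ 10 * n ^ 3 := by ring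
      rw [h4]
      nlinarith
    have h2 : Real.log (1 + 24576 * n ^ 3) ≤ 13 * l := by
      refine (Real.log_le_log (by positivity) h1).trans (le_of_eq ?_)
      rw [Real.log_pow, ← hl]
      norm_num
    rw [pow_add]
    linarith
  have hb : 12 * n ≤ 2 ^ 2 ^ (3 + m) := by
    have h1 : 12 * n ≤ n ^ 4 := by
      have h2 : (3 : ℝ) ^ 3 ≤ n ^ 3 := pow_le_pow_left₀ (by norm_num) hn3 3
      nlinarith
    refine h1.trans ?_
    rw [← Real.log_le_log_iff (by positivity) (by positivity), Real.log_pow, Real.log_pow]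
    push_cast
    have h2 := Real.log_two_gt_d9
    have h3 : (2 : ℝ) ^ (3 + m) = 8 * 2 ^ m := by rw [pow_add]; norm_num
    rw [h3]
    have h4 : (8 * 2 ^ m) * (1 / 2 : ℝ) ≤ 8 * 2 ^ m * Real.log 2 :=
      mul_le_mul_of_nonneg_left (by linarith) (by positivity)
    linarith
  have hTbig : 17 * k * (37891 + 288 * (20 + m + (3 + m))) ≤ T := by
    have h1 : (17 * k * (37891 + 288 * (20 + m + (3 + m))) : ℝ) ≤ T := by
      refine le_trans ?_ hT1
      have h2 : 17 * (37891 + 288 * (20 + (m : ℝ) + (3 + m))) ≤ 40000000 * ll := by linarith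
      nlinarith
    exact_mod_cast h1
  have hfail := localSearch_failure (L := L) (β := β) hε D hk0 hk hinit hq hb hTbig he0
  rw [hηe] at hfail
  refine one_sub_le_toOuterMeasure _ _ (by positivity) ?_
  refine le_trans (measure_mono (Set.compl_subset_compl.2 ?_)) (hfail.trans ?_)
  · rintro F ⟨h1, h2⟩
    refine ⟨h1, h2.trans ?_⟩
    have h3 : k * e = 4 * (c + 21) * (k * 2 ^ L * l * ε⁻¹) * (T + 1) := by
      rw [he, swapParameter]
      field_simp
    have h4 : k * e ≤ 4 * (c + 21) * (k * 2 ^ L * l * ε⁻¹) * (40000100 * (k * ll)) := by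
      rw [h3]
      exact mul_le_mul_of_nonneg_left hT2 (by positivity)
    nlinarith
  · have h1 : (((T : ℝ≥0∞) + 1) * ((Fintype.card U : ℝ≥0∞) ^ 2 + 1)) =
        ENNReal.ofReal (((T : ℝ) + 1) * (n ^ 2 + 1)) := by
      rw [ENNReal.ofReal_mul (by positivity), ENNReal.ofReal_add (by positivity) zero_le_one,
        ENNReal.ofReal_add (by positivity) zero_le_one, ENNReal.ofReal_pow (by positivity),
        ENNReal.ofReal_natCast, ENNReal.ofReal_one, hndef, ENNReal.ofReal_natCast]
    rw [h1, ← ENNReal.ofReal_mul (by positivity)]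
    refine ENNReal.ofReal_le_ofReal ?_
    have h2 : Real.exp (-((c + 21) * l)) = n ^ (-c) * (n ^ 21)⁻¹ := by
      rw [← Real.rpow_natCast, ← Real.rpow_neg hn0.le, ← Real.rpow_add hn0,
        Real.rpow_def_of_pos hn0]
      congr 1
      push_cast
      ring
    rw [h2, mul_comm (n ^ (-c)), ← mul_assoc]
    refine mul_le_of_le_one_left (by positivity) ?_
    rw [← div_eq_mul_inv, div_le_one (by positivity)]
    have h3 : (T : ℝ) + 1 ≤ n ^ 18 := by
      have h4 : (3 : ℝ) ^ 16 ≤ n ^ 16 := pow_le_pow_left₀ (by norm_num) hn3 16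
      have h5 : k * ll ≤ n * n := mul_le_mul hkn hlln (by linarith) hn0.le
      have h6 : n ^ 18 = n ^ 16 * (n * n) := by ring
      rw [h6]
      refine hT2.trans (mul_le_mul (by norm_num at h4; linarith) h5 (by linarith) (by positivity))
    have h4 : n ^ 2 + 1 ≤ n ^ 3 := by nlinarith [sq_nonneg n]
    have h5 : n ^ 21 = n ^ 18 * n ^ 3 := by ring
    rw [h5]
    exact mul_le_mul h3 h4 (by positivity) (by positivity)

end Utility

/-! ### The clusters form a laminar family -/

section Clusters

variable {U : Type*} [MetricSpace U] [Fintype U]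

theorem IsCenterOf.unique {σ : U ≃ Fin (Fintype.card U)} {r : ℝ} {S : Finset U} {c c' u : U}
    (h : IsCenterOf σ r S c u) (h' : IsCenterOf σ r S c' u) : c = c' :=
  σ.injective (le_antisymm (h.2.2 c' h'.1 h'.2.1) (h'.2.2 c h.1 h.2.1))

theorem exists_isCenterOf (σ : U ≃ Fin (Fintype.card U)) {r : ℝ} (hr : 0 ≤ r) {S : Finset U} {u : U}
    (hu : u ∈ S) : ∃ c, IsCenterOf σ r S c u := by
  obtain ⟨c, hc, hmin⟩ := (S.filter fun c => dist c u ≤ r).exists_min_image σ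
    ⟨u, by simp [hu, hr]⟩
  rw [Finset.mem_filter] at hc
  exact ⟨c, hc.1, hc.2, fun c' h1 h2 => hmin c' (Finset.mem_filter.2 ⟨h1, h2⟩)⟩

theorem mem_carve_self (σ : U ≃ Fin (Fintype.card U)) {r : ℝ} (hr : 0 ≤ r) {S : Finset U} {u : U}
    (hu : u ∈ S) : u ∈ carve σ r S u := by
  obtain ⟨c, hc⟩ := exists_isCenterOf σ hr hu
  exact Finset.mem_filter.2 ⟨hu, c, hc, hc⟩

theorem carve_eq_of_mem {σ : U ≃ Fin (Fintype.card U)} {r : ℝ} {S : Finset U} {u w : U}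
    (hw : w ∈ carve σ r S u) : carve σ r S w = carve σ r S u := by
  obtain ⟨_, c, hu, hw⟩ := Finset.mem_filter.1 hw
  ext x
  simp only [carve, Finset.mem_filter]
  refine and_congr_right fun _ => ⟨?_, ?_⟩
  · rintro ⟨c', h1, h2⟩
    exact ⟨c, hu, (h1.unique hw) ▸ h2⟩
  · rintro ⟨c', h1, h2⟩
    exact ⟨c, hw, (h1.unique hu) ▸ h2⟩

variable {L : ℕ} {β : ℝ} (π : Orders U L)

theorem cluster_succ {t : ℕ} (ht : t < L) (u : U) : cluster β π (t + 1) u =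
    carve (π ⟨t, ht⟩ (cluster β π t u)) (β * 2 ^ L / 2 ^ (t + 2)) (cluster β π t u) u := by
  rw [cluster, dif_pos ht]

theorem cluster_succ_subset (t : ℕ) (u : U) : cluster β π (t + 1) u ⊆ cluster β π t u := by
  by_cases ht : t < L
  · rw [cluster_succ π ht]
    exact Finset.filter_subset _ _
  · rw [cluster, dif_neg ht]

theorem cluster_anti {s t : ℕ} (h : s ≤ t) (u : U) : cluster β π t u ⊆ cluster β π s u :=
  antitone_nat_of_succ_le (f := fun t => cluster β π t u) (fun t => cluster_succ_subset π t u) h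

theorem mem_cluster_self (hβ : 0 ≤ β) (t : ℕ) (u : U) : u ∈ cluster β π t u := by
  induction t with
  | zero => simp [cluster]
  | succ t ih =>
    by_cases ht : t < L
    · rw [cluster_succ π ht]
      exact mem_carve_self _ (by positivity) ih
    · rw [cluster, dif_neg ht]
      exact ih

theorem cluster_eq_of_mem {t : ℕ} {u w : U} (hw : w ∈ cluster β π t u) :
    cluster β π t w = cluster β π t u := by
  induction t with
  | zero => rfl
  | succ t ih =>
    have h := ih (cluster_succ_subset π t u hw)
    by_cases ht : t < L
    · rw [cluster_succ π ht] at hw ⊢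
      rw [cluster_succ π ht, h]
      exact carve_eq_of_mem hw
    · rw [cluster, dif_neg ht, h, cluster, dif_neg ht]

theorem cluster_eq_singleton (hL : 1 ≤ L) (hβ : 0 ≤ β) (hβ2 : β < 2)
    (hdist : ∀ u v : U, u ≠ v → 1 ≤ dist u v) (u : U) : cluster β π L u = {u} := by
  obtain ⟨t, rfl⟩ := Nat.exists_eq_add_of_le' hL
  have hr : β * 2 ^ (t + 1) / 2 ^ (t + 2) < 1 := by
    rw [div_lt_one (by positivity), pow_succ _ (t + 1), mul_comm]
    gcongr
  refine Finset.eq_singleton_iff_unique_mem.2 ⟨mem_cluster_self π hβ _ u, fun w hw => ?_⟩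
  rw [cluster_succ π (Nat.lt_succ_self t)] at hw
  obtain ⟨_, c, hu, hw⟩ := Finset.mem_filter.1 hw
  have h : ∀ x, IsCenterOf (π ⟨t, Nat.lt_succ_self t⟩ (cluster β π t u))
      (β * 2 ^ (t + 1) / 2 ^ (t + 2)) (cluster β π t u) c x → c = x := by
    intro x hx
    by_contra hne
    exact absurd ((hdist c x hne).trans hx.2.1) (not_le.2 hr)
  rw [← h w hw, ← h u hu]

theorem mem_nodes {v : Node U L} : v ∈ nodes β π ↔
    ∃ u, 1 < (cluster β π v.1 u).card ∧ v.2 = cluster β π (v.1 + 1) u := by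
  simp [nodes]

theorem eq_cluster_of_mem_nodes {v : Node U L} (hv : v ∈ nodes β π) {u : U} (hu : u ∈ v.2) :
    v.2 = cluster β π (v.1 + 1) u := by
  obtain ⟨x, _, hx⟩ := (mem_nodes π).1 hv
  rw [hx] at hu ⊢
  exact (cluster_eq_of_mem π hu).symm

theorem disjoint_of_not_isDescendant {v w : Node U L} (hv : v ∈ nodes β π) (hw : w ∈ nodes β π)
    (hne : v ≠ w) (h1 : ¬ IsDescendant v w) (h2 : ¬ IsDescendant w v) : Disjoint v.2 w.2 := by
  rw [Finset.disjoint_left]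
  intro u hu hu'
  have e1 := eq_cluster_of_mem_nodes π hv hu
  have e2 := eq_cluster_of_mem_nodes π hw hu'
  rcases lt_trichotomy v.1 w.1 with h | h | h
  · refine h2 ⟨h, ?_⟩
    rw [e1, e2]
    exact cluster_anti π (by simpa using h.le) u
  · exact hne (Prod.ext h (by rw [e1, e2, h]))
  · refine h1 ⟨h, ?_⟩
    rw [e1, e2]
    exact cluster_anti π (by simpa using h.le) u

/-- Every point `u` is the cluster of some node, which has no descendants. -/
theorem exists_leaf (hL : 1 ≤ L) (hβ : 0 ≤ β) (hβ2 : β < 2)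
    (hdist : ∀ u v : U, u ≠ v → 1 ≤ dist u v) (hcard : 1 < Fintype.card U) (u : U) :
    ∃ v ∈ nodes β π, v.2 = {u} ∧ ∀ w ∈ nodes β π, ¬ IsDescendant w v := by
  have hex : ∃ t, t < L ∧ cluster β π (t + 1) u = {u} :=
    ⟨L - 1, by omega, by rw [Nat.sub_add_cancel hL, cluster_eq_singleton π hL hβ hβ2 hdist]⟩
  obtain ⟨ht, hcl⟩ := Nat.find_spec hex
  have hmin : ∀ s < Nat.find hex, ¬ (s < L ∧ cluster β π (s + 1) u = {u}) :=
    fun s hs => Nat.find_min hex hs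
  generalize Nat.find hex = t at ht hcl hmin
  refine ⟨(⟨t, ht⟩, {u}), (mem_nodes π).2 ⟨u, ?_, hcl.symm⟩, rfl, ?_⟩
  · rcases t with - | s
    · simpa [cluster] using hcard
    · by_contra hle
      refine hmin s (Nat.lt_succ_self s) ⟨by omega, ?_⟩
      have h1 : (cluster β π (s + 1) u).card ≤ 1 := by simpa using hle
      exact Finset.eq_singleton_iff_unique_mem.2 ⟨mem_cluster_self π hβ _ u, fun w hw =>
        Finset.card_le_one.1 h1 w hw u (mem_cluster_self π hβ _ u)⟩
  · rintro w hw ⟨h1, h2⟩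
    obtain ⟨x, hx, hwx⟩ := (mem_nodes π).1 hw
    have hxw : x ∈ w.2 := hwx ▸ mem_cluster_self π hβ _ x
    have hxu : x = u := Finset.mem_singleton.1 (h2 hxw)
    subst hxu
    have h3 : cluster β π w.1 x ⊆ {x} := by
      rw [← hcl]
      exact cluster_anti π h1 x
    exact absurd hx (not_lt.2 (by simpa using Finset.card_le_card h3))

end Clusters

/-! ### The subtree search -/

section Search

variable {U : Type*} [MetricSpace U] [Fintype U] {L : ℕ}

theorem IsDescendant.trans {u v w : Node U L} (h : IsDescendant u v) (h' : IsDescendant v w) :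
    IsDescendant u w :=
  ⟨h'.1.trans h.1, h.2.trans h'.2⟩

/-- The elements of `N` that belong to `C` or have a descendant in `C`. -/
def ancestors (N C : Finset (Node U L)) : Finset (Node U L) :=
  N.filter fun v => v ∈ C ∨ ∃ w ∈ C, IsDescendant w v

theorem prune_subset (C : Finset (Node U L)) : prune C ⊆ C := Finset.filter_subset _ _

theorem exists_mem_prune {C : Finset (Node U L)} {v : Node U L} (hv : v ∈ C) :
    ∃ w ∈ prune C, w = v ∨ IsDescendant w v := by
  obtain ⟨w, hw, hmax⟩ := (C.filter fun w => w = v ∨ IsDescendant w v).exists_max_image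
    (fun w => w.1) ⟨v, by simp [hv]⟩
  rw [Finset.mem_filter] at hw
  refine ⟨w, Finset.mem_filter.2 ⟨hw.1, fun x hx hxw => ?_⟩, hw.2⟩
  refine absurd (hmax x (Finset.mem_filter.2 ⟨hx, Or.inr ?_⟩)) (not_le.2 hxw.1)
  rcases hw.2 with rfl | h
  · exact hxw
  · exact hxw.trans h

theorem ancestors_mono {N C C' : Finset (Node U L)} (h : C ⊆ C') :
    ancestors N C ⊆ ancestors N C' :=
  Finset.monotone_filter_right _ fun _ _ hv =>
    hv.imp (fun h' => h h') fun ⟨w, hw, hd⟩ => ⟨w, h hw, hd⟩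

theorem ancestors_subset_prune (N C : Finset (Node U L)) :
    ancestors N C ⊆ ancestors N (prune C) := by
  intro v hv
  obtain ⟨hN, hv⟩ := Finset.mem_filter.1 hv
  refine Finset.mem_filter.2 ⟨hN, ?_⟩
  rcases hv with hv | ⟨w, hw, hwv⟩
  · obtain ⟨x, hx, rfl | hxv⟩ := exists_mem_prune hv
    · exact Or.inl hx
    · exact Or.inr ⟨x, hx, hxv⟩
  · obtain ⟨x, hx, rfl | hxw⟩ := exists_mem_prune hw
    · exact Or.inr ⟨x, hx, hwv⟩
    · exact Or.inr ⟨x, hx, hxw.trans hwv⟩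

theorem card_top {score : Node U L → ℝ} {m : ℕ} {P : Finset (Node U L)}
    (hinj : Set.InjOn score P) (hm : m ≤ P.card) : (top score m P).card = m := by
  set r : Node U L → ℕ := fun v => (P.filter fun w => score v < score w).card with hr
  have hlt : ∀ v ∈ P, ∀ w ∈ P, score v < score w → r w < r v := by
    intro v _ w hw h
    refine Finset.card_lt_card ⟨fun x hx => ?_, fun hsub => ?_⟩
    · rw [Finset.mem_filter] at hx ⊢
      exact ⟨hx.1, h.trans hx.2⟩
    · exact lt_irrefl _ (Finset.mem_filter.1 (hsub (Finset.mem_filter.2 ⟨hw, h⟩))).2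
  have hrinj : Set.InjOn r P := by
    intro v hv w hw h
    rcases lt_trichotomy (score v) (score w) with h' | h' | h'
    · exact absurd h (hlt v hv w hw h').ne'
    · exact hinj hv hw h'
    · exact absurd h (hlt w hw v hv h').ne
  have himage : P.image r = Finset.range P.card := by
    refine Finset.eq_of_subset_of_card_le ?_ ?_
    · intro i hi
      obtain ⟨v, hv, rfl⟩ := Finset.mem_image.1 hi
      refine Finset.mem_range.2 (Finset.card_lt_card ⟨Finset.filter_subset _ _, fun hsub => ?_⟩)
      exact lt_irrefl _ (Finset.mem_filter.1 (hsub hv)).2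
    · rw [Finset.card_range, Finset.card_image_of_injOn hrinj]
  have h1 : (top score m P).image r = Finset.range m := by
    rw [top, ← Finset.filter_image (p := fun i => i < m), himage]
    ext i
    simp only [Finset.mem_filter, Finset.mem_range]
    omega
  have h2 : ((top score m P).image r).card = (top score m P).card :=
    Finset.card_image_of_injOn (hrinj.mono (by exact_mod_cast Finset.filter_subset _ _))
  rw [← h2, h1, Finset.card_range]

theorem top_zero (score : Node U L → ℝ) (P : Finset (Node U L)) : top score 0 P = ∅ := by
  simp [top]

theorem filter_eq_sdiff_ancestors (N C : Finset (Node U L)) :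
    (N.filter fun v => v ∉ C ∧ ∀ w ∈ C, ¬ IsDescendant w v) = N \ ancestors N C := by
  ext v
  simp only [ancestors, Finset.mem_filter, Finset.mem_sdiff]
  grind

/-- The sets of nodes that the subtree search can produce. -/
structure IsPartialSelection (N : Finset (Node U L)) (k : ℕ) (C : Finset (Node U L)) : Prop where
  subset : C ⊆ N
  not_isDescendant : ∀ v ∈ C, ∀ w ∈ C, ¬ IsDescendant w v
  card_le : C.card ≤ k

variable {N : Finset (Node U L)} {score : Node U L → ℝ} {k : ℕ} {C : Finset (Node U L)}

theorem IsPartialSelection.prune_eq (h : IsPartialSelection N k C) : prune C = C :=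
  Finset.filter_true_of_mem h.not_isDescendant

theorem IsPartialSelection.searchRound_eq (h : IsPartialSelection N k C) (hC : C.card = k) :
    searchRound N score k C = C := by
  rw [searchRound, hC, Nat.sub_self, top_zero, Finset.union_empty, h.prune_eq]

theorem IsPartialSelection.searchRound (hscore : Set.InjOn score N)
    (hN : ∀ C, IsPartialSelection N k C → k - C.card ≤ (N \ ancestors N C).card)
    (h : IsPartialSelection N k C) : IsPartialSelection N k (searchRound N score k C) := by
  rw [DPHST.searchRound, filter_eq_sdiff_ancestors]
  refine ⟨(prune_subset _).trans (Finset.union_subset h.subset ?_), fun v hv w hw => ?_, ?_⟩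
  · exact (Finset.filter_subset _ _).trans Finset.sdiff_subset
  · exact (Finset.mem_filter.1 hv).2 w (prune_subset _ hw)
  · refine (Finset.card_le_card (prune_subset _)).trans ((Finset.card_union_le _ _).trans ?_)
    rw [card_top (hscore.mono (by exact_mod_cast Finset.sdiff_subset)) (hN C h)]
    have := h.card_le
    omega

theorem IsPartialSelection.card_ancestors_lt (hscore : Set.InjOn score N)
    (hN : ∀ C, IsPartialSelection N k C → k - C.card ≤ (N \ ancestors N C).card)
    (h : IsPartialSelection N k C) (hC : C.card ≠ k) :
    (ancestors N C).card < (ancestors N (DPHST.searchRound N score k C)).card := by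
  rw [DPHST.searchRound, filter_eq_sdiff_ancestors]
  refine Finset.card_lt_card ⟨(ancestors_mono Finset.subset_union_left).trans
    (ancestors_subset_prune _ _), fun hsub => ?_⟩
  have hcard := card_top (hscore.mono (by exact_mod_cast Finset.sdiff_subset)) (hN C h)
  have hle := h.card_le
  obtain ⟨v, hv⟩ : (top score (k - C.card) (N \ ancestors N C)).Nonempty := by
    rw [← Finset.card_pos, hcard]
    omega
  have hv' := Finset.mem_sdiff.1 (Finset.filter_subset _ _ hv)
  refine hv'.2 (hsub (ancestors_subset_prune _ _ ?_))
  exact Finset.mem_filter.2 ⟨hv'.1, Or.inl (Finset.mem_union_right _ hv)⟩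

/-- Each unfinished round selects a node outside the set of ancestors, and pruning keeps that set,
so it grows strictly. After as many rounds as there are potential nodes it would exhaust them,
leaving no candidate although fewer than k nodes are selected. -/
theorem isPartialSelection_subtreeSearch (hscore : Set.InjOn score N)
    (hN : ∀ C, IsPartialSelection N k C → k - C.card ≤ (N \ ancestors N C).card) :
    IsPartialSelection N k (subtreeSearch N score k) ∧ (subtreeSearch N score k).card = k := by
  have hall : ∀ j, IsPartialSelection N k ((DPHST.searchRound N score k)^[j] ∅) ∧
      (((DPHST.searchRound N score k)^[j] ∅).card = k ∨
        j ≤ (ancestors N ((DPHST.searchRound N score k)^[j] ∅)).card) := by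
    intro j
    induction j with
    | zero => exact ⟨⟨by simp, by simp, by simp⟩, Or.inr (Nat.zero_le _)⟩
    | succ j ih =>
      obtain ⟨h1, h2⟩ := ih
      simp only [Function.iterate_succ_apply']
      refine ⟨h1.searchRound hscore hN, ?_⟩
      by_cases hC : ((DPHST.searchRound N score k)^[j] ∅).card = k
      · exact Or.inl (by rw [h1.searchRound_eq hC, hC])
      · exact Or.inr (lt_of_le_of_lt (h2.resolve_left hC) (h1.card_ancestors_lt hscore hN hC))
  obtain ⟨h1, h2⟩ := hall (Fintype.card (Node U L))
  refine ⟨h1, ?_⟩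
  by_contra hC
  have h3 := h2.resolve_left hC
  have h4 : ancestors N (subtreeSearch N score k) = Finset.univ :=
    Finset.eq_univ_of_card _ (le_antisymm (Finset.card_le_univ _) h3)
  have h5 := hN _ h1
  have h6 := h1.card_le
  change k - (subtreeSearch N score k).card ≤
    (N \ ancestors N (subtreeSearch N score k)).card at h5
  change (subtreeSearch N score k).card ≤ k at h6
  rw [h4, Finset.sdiff_eq_empty_iff_subset.2 (Finset.subset_univ _), Finset.card_empty] at h5
  omega

end Search

/-! ### The initialization finds k distinct points when there are no ties. -/

section Init

variable {U : Type*} [MetricSpace U] [Fintype U] {L : ℕ} {β : ℝ} (π : Orders U L)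

/-- Leaf nodes of different points are distinct and have no descendants. Each of them is either
selected already or still available. -/
theorem card_candidates (hL : 1 ≤ L) (hβ : 0 ≤ β) (hβ2 : β < 2)
    (hdist : ∀ u v : U, u ≠ v → 1 ≤ dist u v) (hcard : 1 < Fintype.card U) {k : ℕ}
    (hk : k ≤ Fintype.card U) (C : Finset (Node U L)) (hC : IsPartialSelection (nodes β π) k C) :
    k - C.card ≤ (nodes β π \ ancestors (nodes β π) C).card := by
  choose ℓ hℓ hsingle hleaf using exists_leaf π hL hβ hβ2 hdist hcard
  have hinj : Function.Injective ℓ := fun u w h => by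
    have h1 : ({u} : Finset U) = {w} := by rw [← hsingle u, ← hsingle w, h]
    exact Finset.singleton_inj.1 h1
  have h1 : Finset.univ.image ℓ ⊆ C ∪ (nodes β π \ ancestors (nodes β π) C) := by
    intro v hv
    obtain ⟨u, -, rfl⟩ := Finset.mem_image.1 hv
    by_cases hu : ℓ u ∈ C
    · exact Finset.mem_union_left _ hu
    · refine Finset.mem_union_right _ (Finset.mem_sdiff.2 ⟨hℓ u, fun hanc => ?_⟩)
      rcases (Finset.mem_filter.1 hanc).2 with h | ⟨w, hw, hd⟩
      · exact hu h
      · exact hleaf u w (hC.subset hw) hd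
  have h2 := (Finset.card_le_card h1).trans (Finset.card_union_le _ _)
  rw [Finset.card_image_of_injective _ hinj, Finset.card_univ] at h2
  omega

/-- Existence: choose the maximal child depth by depth. Uniqueness: without ties two such points
share their cluster at every depth, and at depth L it is a single point. -/
theorem card_findLeaf (hL : 1 ≤ L) (hβ : 0 ≤ β) (hβ2 : β < 2)
    (hdist : ∀ u v : U, u ≠ v → 1 ≤ dist u v) {count : Node U L → ℝ}
    (hcount : ∀ (t : Fin L) (S S' : Finset U), count (t, S) = count (t, S') → S = S')
    {v : Node U L} (hv : v ∈ nodes β π) : (findLeaf β π count v).card = 1 := by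
  obtain ⟨x, -, hx⟩ := (mem_nodes π).1 hv
  have hex : ∀ i ≤ L, ∃ u ∈ v.2, ∀ t : Fin L, v.1 < t → (t : ℕ) < i → ∀ w ∈ cluster β π t u,
      count (t, cluster β π (t + 1) w) ≤ count (t, cluster β π (t + 1) u) := by
    intro i
    induction i with
    | zero => exact fun _ => ⟨x, hx ▸ mem_cluster_self π hβ _ x, fun t _ h => absurd h (by omega)⟩
    | succ i ih =>
      intro hi
      obtain ⟨u, hu, hmax⟩ := ih (by omega)
      by_cases hvi : (v.1 : ℕ) < i
      · obtain ⟨w, hw, hw'⟩ := (cluster β π i u).exists_max_image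
          (fun w => count (⟨i, hi⟩, cluster β π (i + 1) w)) ⟨u, mem_cluster_self π hβ _ u⟩
        have heq : ∀ j ≤ i, cluster β π j w = cluster β π j u := fun j hj =>
          cluster_eq_of_mem π (cluster_anti π hj u hw)
        refine ⟨w, ?_, fun t ht hti y hy => ?_⟩
        · rw [eq_cluster_of_mem_nodes π hv hu, ← heq _ hvi]
          exact mem_cluster_self π hβ _ w
        · rcases Nat.lt_succ_iff_lt_or_eq.1 hti with h | h
          · rw [heq _ h.le] at hy
            rw [heq _ h]
            exact hmax t ht h y hy
          · have h' : t = ⟨i, hi⟩ := Fin.ext h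
            subst h'
            rw [heq i le_rfl] at hy
            exact hw' y hy
      · exact ⟨u, hu, fun t ht hti => absurd ht (by rw [Fin.lt_def]; omega)⟩
  obtain ⟨u, hu, hmax⟩ := hex L le_rfl
  rw [Finset.card_eq_one]
  refine ⟨u, Finset.eq_singleton_iff_unique_mem.2
    ⟨Finset.mem_filter.2 ⟨hu, fun t ht => hmax t ht t.2⟩, fun u' hu' => ?_⟩⟩
  obtain ⟨hu', hmax'⟩ := Finset.mem_filter.1 hu'
  have heq : ∀ i, (v.1 : ℕ) + 1 ≤ i → i ≤ L → cluster β π i u' = cluster β π i u := by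
    intro i hi
    induction i, hi using Nat.le_induction with
    | base =>
      exact fun _ => (eq_cluster_of_mem_nodes π hv hu').symm.trans (eq_cluster_of_mem_nodes π hv hu)
    | succ i hi ih =>
      intro hiL
      have h := ih (by omega)
      have hvi : v.1 < (⟨i, hiL⟩ : Fin L) := hi
      refine hcount ⟨i, hiL⟩ _ _ (le_antisymm ?_ ?_)
      · refine hmax ⟨i, hiL⟩ hvi hiL u' ?_
        rw [← h]
        exact mem_cluster_self π hβ _ u'
      · refine hmax' ⟨i, hiL⟩ hvi u ?_
        change u ∈ cluster β π i u'
        rw [h]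
        exact mem_cluster_self π hβ _ u
  have h := heq L v.1.2 le_rfl
  rw [cluster_eq_singleton π hL hβ hβ2 hdist, cluster_eq_singleton π hL hβ hβ2 hdist] at h
  exact Finset.singleton_inj.1 h

theorem card_hstCenters (hL : 1 ≤ L) (hβ : 0 ≤ β) (hβ2 : β < 2)
    (hdist : ∀ u v : U, u ≠ v → 1 ≤ dist u v) (hcard : 1 < Fintype.card U) {k : ℕ}
    (hk : k ≤ Fintype.card U) (D : Finset U) {ω : Node U L → ℝ}
    (hω : Function.Injective fun v => noisyCount D ω v * 2 ^ level v) :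
    (hstCenters β k D π ω).card = k := by
  obtain ⟨h1, h2⟩ := isPartialSelection_subtreeSearch
    (score := fun v => noisyCount D ω v * 2 ^ level v) hω.injOn
    (card_candidates π hL hβ hβ2 hdist hcard hk)
  have hcount : ∀ (t : Fin L) (S S' : Finset U),
      noisyCount D ω (t, S) = noisyCount D ω (t, S') → S = S' := by
    intro t S S' h
    have h3 : ((t, S) : Node U L) = (t, S') := hω (by simp only [h, level])
    exact (Prod.mk.inj h3).2
  rw [hstCenters, Finset.card_biUnion, Finset.sum_congr rfl fun v hv =>
    card_findLeaf π hL hβ hβ2 hdist hcount (h1.subset hv), Finset.sum_const, h2,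
    smul_eq_mul, mul_one]
  intro v hv w hw hne
  exact Finset.disjoint_of_subset_left (Finset.filter_subset _ _)
    (Finset.disjoint_of_subset_right (Finset.filter_subset _ _)
      (disjoint_of_not_isDescendant π (h1.subset hv) (h1.subset hw) hne
        (h1.not_isDescendant w hw v hv) (h1.not_isDescendant v hv w hw)))

end Init

/-! ### The noise -/

section Noise

/-- Product measures are monotone, up to constants. -/
theorem pi_le_smul_pi {ι : Type*} [Fintype ι] {X : ι → Type*} [∀ i, MeasurableSpace (X i)]
    {μ ν : ∀ i, Measure (X i)} [∀ i, SigmaFinite (μ i)] [∀ i, SigmaFinite (ν i)] {c : ι → ℝ≥0∞}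
    (hc0 : ∀ i, c i ≠ 0) (hc : ∀ i, c i ≠ ∞) (h : ∀ i, ν i ≤ c i • μ i) :
    Measure.pi ν ≤ (∏ i, c i) • Measure.pi μ := by
  have hC0 : ∏ i, c i ≠ 0 := Finset.prod_ne_zero_iff.2 fun i _ => hc0 i
  have hC : ∏ i, c i ≠ ∞ := ENNReal.prod_ne_top fun i _ => hc i
  have h1 : (∏ i, c i)⁻¹ • (Measure.pi ν).toOuterMeasure ≤
      OuterMeasure.pi fun i => (μ i).toOuterMeasure := by
    rw [OuterMeasure.le_pi]
    intro s _
    rw [smul_apply, smul_eq_mul]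
    change (∏ i, c i)⁻¹ * Measure.pi ν (Set.univ.pi s) ≤ _
    rw [Measure.pi_pi, ENNReal.inv_mul_le_iff hC0 hC, ← Finset.prod_mul_distrib]
    exact Finset.prod_le_prod' fun i _ => h i (s i)
  refine Measure.le_iff.2 fun s hs => ?_
  rw [Measure.smul_apply, smul_eq_mul, ← ENNReal.inv_mul_le_iff hC0 hC]
  refine (h1 s).trans ?_
  rw [Measure.pi, toMeasure_apply _ _ hs]

theorem measurable_laplacePDF (b : ℝ) :
    Measurable fun x => ENNReal.ofReal (laplacePDF b x) := by
  unfold laplacePDF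
  fun_prop

theorem laplace_le_smul_volume {b : ℝ} (hb : 0 < b) :
    laplace b ≤ ENNReal.ofReal (1 / (2 * b)) • (volume : Measure ℝ) := by
  rw [laplace, ← withDensity_const]
  refine withDensity_mono (Filter.Eventually.of_forall fun x => ENNReal.ofReal_le_ofReal ?_)
  rw [laplacePDF]
  gcongr
  rw [Real.exp_le_one_iff, neg_nonpos]
  positivity

theorem laplacePDF_sub_le {b : ℝ} (hb : 0 < b) (s x : ℝ) :
    laplacePDF b (x - s) ≤ Real.exp (|s| / b) * laplacePDF b x := by
  rw [laplacePDF, laplacePDF, ← mul_div_assoc, ← Real.exp_add]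
  gcongr
  have h1 : |x| ≤ |x - s| + |s| := by
    have h2 := abs_add_le (x - s) s
    rwa [sub_add_cancel] at h2
  have h3 : |x| / b ≤ (|x - s| + |s|) / b := by gcongr
  rw [add_div] at h3
  linarith

/-- Translation invariance of Lebesgue measure reduces this to the pointwise ratio of densities. -/
theorem map_add_laplace_le {b : ℝ} (hb : 0 < b) (s : ℝ) :
    (laplace b).map (fun x => x + s) ≤ ENNReal.ofReal (Real.exp (|s| / b)) • laplace b := by
  refine Measure.le_iff.2 fun A hA => ?_
  have hA' : MeasurableSet ((fun x => x + s) ⁻¹' A) := (measurable_add_const s) hA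
  rw [Measure.map_apply (measurable_add_const s) hA, Measure.smul_apply, smul_eq_mul, laplace,
    withDensity_apply _ hA, withDensity_apply _ hA', ← lintegral_indicator hA',
    ← lintegral_sub_right_eq_self _ s, ← lintegral_indicator hA,
    ← lintegral_const_mul _ ((measurable_laplacePDF b).indicator hA)]
  refine lintegral_mono fun x => ?_
  by_cases hx : x ∈ A
  · rw [Set.indicator_of_mem hx, Set.indicator_of_mem (by simpa using hx),
      ← ENNReal.ofReal_mul (Real.exp_pos _).le]
    exact ENNReal.ofReal_le_ofReal (laplacePDF_sub_le hb s x)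
  · rw [Set.indicator_of_notMem (by simpa using hx)]
    exact zero_le

variable {U : Type*} [Fintype U] {L : ℕ}

theorem map_add_noise_le {ε : ℝ} (hε : 0 < ε) (s : Node U L → ℝ) :
    (noise U L ε).map (fun ω => ω + s) ≤
      ENNReal.ofReal (Real.exp (∑ v, |s v| / (2 ^ (v.1 + 1 : ℕ) / ε))) • noise U L ε := by
  have hb : ∀ v : Node U L, (0 : ℝ) < 2 ^ (v.1 + 1 : ℕ) / ε := fun v => by positivity
  have h1 : ∀ v : Node U L, IsProbabilityMeasure (laplace (2 ^ (v.1 + 1 : ℕ) / ε)) :=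
    fun v => isProbabilityMeasure_laplace (hb v)
  have h2 : ∀ v : Node U L, IsProbabilityMeasure
      ((laplace (2 ^ (v.1 + 1 : ℕ) / ε)).map fun x => x + s v) :=
    fun v => Measure.isProbabilityMeasure_map (measurable_add_const _).aemeasurable
  have h3 : (noise U L ε).map (fun ω => ω + s) =
      Measure.pi fun v : Node U L => (laplace (2 ^ (v.1 + 1 : ℕ) / ε)).map fun x => x + s v :=
    Measure.pi_map_pi fun v => (measurable_add_const _).aemeasurable
  rw [h3, Real.exp_sum, ENNReal.ofReal_prod_of_nonneg fun _ _ => (Real.exp_pos _).le]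
  exact pi_le_smul_pi (fun v => by simp [Real.exp_pos]) (fun v => ENNReal.ofReal_ne_top)
    fun v => map_add_laplace_le (hb v) (s v)

/-- The noise is dominated by a multiple of Lebesgue measure, for which affine hyperplanes are null.
This excludes ties of scores. -/
theorem noise_hyperplane {ε : ℝ} (hε : 0 < ε) {v w : Node U L} (hvw : v ≠ w) {a b : ℝ}
    (ha : a ≠ 0) (c : ℝ) : noise U L ε {ω | ω v * a - ω w * b = c} = 0 := by
  have hb : ∀ v : Node U L, (0 : ℝ) < 2 ^ (v.1 + 1 : ℕ) / ε := fun v => by positivity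
  have h1 : ∀ v : Node U L, IsProbabilityMeasure (laplace (2 ^ (v.1 + 1 : ℕ) / ε)) :=
    fun v => isProbabilityMeasure_laplace (hb v)
  have hle : noise U L ε ≤ (∏ v : Node U L, ENNReal.ofReal (1 / (2 * (2 ^ (v.1 + 1 : ℕ) / ε)))) •
      (volume : Measure (Node U L → ℝ)) :=
    pi_le_smul_pi (fun v => by have := hb v; simp; positivity) (fun v => ENNReal.ofReal_ne_top)
      fun v => laplace_le_smul_volume (hb v)
  refine le_antisymm ((hle _).trans ?_) zero_le
  rw [Measure.smul_apply, smul_eq_mul, nonpos_iff_eq_zero]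
  refine mul_eq_zero_of_right _ ?_
  let φ : (Node U L → ℝ) →ₗ[ℝ] ℝ := a • LinearMap.proj v - b • LinearMap.proj w
  have hφ : ∀ ω, φ ω = ω v * a - ω w * b := fun ω => by
    simp [φ, mul_comm]
  rcases Set.eq_empty_or_nonempty {ω : Node U L → ℝ | ω v * a - ω w * b = c} with h | ⟨ω₀, hω₀⟩
  · rw [h, measure_empty]
  · have h2 : {ω : Node U L → ℝ | ω v * a - ω w * b = c} =
        (fun ω => ω + -ω₀) ⁻¹' (LinearMap.ker φ : Set (Node U L → ℝ)) := by
      ext ω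
      rw [Set.mem_preimage, SetLike.mem_coe, LinearMap.mem_ker, map_add, map_neg, hφ, hφ,
        Set.mem_ofPred_eq, ← (show ω₀ v * a - ω₀ w * b = c from hω₀), add_neg_eq_zero]
    rw [h2, measure_preimage_add_right]
    refine Measure.addHaar_submodule _ _ fun htop => ha ?_
    have h3 : Pi.single v 1 ∈ LinearMap.ker φ := htop ▸ Submodule.mem_top
    rw [LinearMap.mem_ker, hφ, Pi.single_eq_same, Pi.single_eq_of_ne hvw.symm] at h3
    simpa using h3

theorem noise_ties {ε : ℝ} (hε : 0 < ε) (D : Finset U) :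
    noise U L ε {ω | ¬ Function.Injective fun v => noisyCount D ω v * 2 ^ (level v)} = 0 := by
  have hsub : {ω : Node U L → ℝ |
      ¬ Function.Injective fun v => noisyCount D ω v * 2 ^ (level v)} ⊆
      ⋃ (v : Node U L) (w : Node U L) (_ : v ≠ w), {ω | ω v * 2 ^ level v - ω w * 2 ^ level w =
        ((D ∩ w.2).card : ℝ) * 2 ^ level w - ((D ∩ v.2).card : ℝ) * 2 ^ level v} := by
    intro ω hω
    obtain ⟨v, w, h, hne⟩ := Function.not_injective_iff.1 hω
    refine Set.mem_iUnion.2 ⟨v, Set.mem_iUnion.2 ⟨w, Set.mem_iUnion.2 ⟨hne, ?_⟩⟩⟩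
    rw [noisyCount, noisyCount] at h
    rw [Set.mem_ofPred_eq]
    linarith
  refine measure_mono_null hsub (measure_iUnion_null fun v => measure_iUnion_null fun w =>
    measure_iUnion_null fun hne => noise_hyperplane hε hne (by positivity) _)

end Noise

section Init

variable {U : Type*} [MetricSpace U] [Fintype U]

theorem dpHstInit_card {L : ℕ} {β : ℝ} (hL : 1 ≤ L) (hβ : 0 ≤ β) (hβ2 : β < 2)
    (hdist : ∀ u v : U, u ≠ v → 1 ≤ dist u v) (hcard : 1 < Fintype.card U) {k : ℕ}
    (hk : k ≤ Fintype.card U) {ε : ℝ} (hε : 0 < ε) (D : Finset U) :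
    (dpHstInit L β k hε D).toOuterMeasure {F | F.card ≠ k} = 0 := by
  refine le_antisymm ((toOuterMeasure_bind_le (B := ∅) (δ := 0) (δ' := 0) (by simp)
    fun π _ => ?_).trans (by simp)) zero_le
  rw [PMF.toOuterMeasure_apply_fintype, nonpos_iff_eq_zero, Finset.sum_eq_zero_iff]
  intro F _
  by_cases hF : F.card = k
  · exact Set.indicator_of_notMem (by simpa using hF) _
  · rw [Set.indicator_of_mem (by simpa using hF)]
    change noise U L ε {ω | hstCenters β k D π ω = F} = 0
    refine measure_mono_null ?_ (noise_ties hε D)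
    rintro ω rfl hinj
    exact hF (card_hstCenters π hL hβ hβ2 hdist hcard hk D hinj)

end Init

/-! ### Privacy -/

section Composition

variable {α β : Type*}

theorem bind_apply_le {p p' : PMF α} {f f' : α → PMF β} {c c' : ℝ≥0∞} (hp : ∀ a, p a ≤ c * p' a)
    (hf : ∀ a b, f a b ≤ c' * f' a b) (b : β) : p.bind f b ≤ c * c' * p'.bind f' b := by
  rw [PMF.bind_apply, PMF.bind_apply, ← ENNReal.tsum_mul_left]
  refine ENNReal.tsum_le_tsum fun a => (mul_le_mul' (hp a) (hf a b)).trans (le_of_eq ?_)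
  ring

theorem map_apply_le {p p' : PMF α} {c : ℝ≥0∞} (hp : ∀ a, p a ≤ c * p' a) (f : α → β) (b : β) :
    p.map f b ≤ c * p'.map f b := by
  have h := bind_apply_le (f := PMF.pure ∘ f) (f' := PMF.pure ∘ f) (c' := 1) hp
    (fun a b => by rw [one_mul]) b
  rwa [mul_one] at h

theorem toOuterMeasure_le_of_apply_le {p p' : PMF α} {c : ℝ≥0∞} (hp : ∀ a, p a ≤ c * p' a)
    (s : Set α) : p.toOuterMeasure s ≤ c * p'.toOuterMeasure s := by
  rw [PMF.toOuterMeasure_apply, PMF.toOuterMeasure_apply, ← ENNReal.tsum_mul_left]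
  refine ENNReal.tsum_le_tsum fun a => ?_
  by_cases ha : a ∈ s
  · simpa [ha] using hp a
  · simp [ha]

theorem expMechanism_apply_le [Fintype α] (s : Finset α) (hs : s.Nonempty) {η Δ : ℝ} (hη : 0 ≤ η)
    {q q' : α → ℝ} (hq : ∀ a, |q a - q' a| ≤ Δ) (a : α) :
    expMechanism s hs η q a ≤
      ENNReal.ofReal (Real.exp (2 * (η * Δ))) * expMechanism s hs η q' a := by
  set E := ENNReal.ofReal (Real.exp (η * Δ)) with hE
  have hw : ∀ {q q' : α → ℝ}, (∀ a, |q a - q' a| ≤ Δ) → ∀ a,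
      ENNReal.ofReal (Real.exp (-(η * q a))) ≤ E * ENNReal.ofReal (Real.exp (-(η * q' a))) := by
    intro q q' hq a
    rw [hE, ← ENNReal.ofReal_mul (Real.exp_pos _).le, ← Real.exp_add]
    refine ENNReal.ofReal_le_ofReal (Real.exp_le_exp.2 ?_)
    have h1 := (abs_le.1 (hq a)).1
    nlinarith
  have hq' : ∀ a, |q' a - q a| ≤ Δ := fun a => by rw [abs_sub_comm]; exact hq a
  have hE0 : E ≠ 0 := by simp [hE, Real.exp_pos]
  have hET : E ≠ ∞ := ENNReal.ofReal_ne_top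
  have h2 : ENNReal.ofReal (Real.exp (2 * (η * Δ))) = E * E := by
    rw [hE, ← ENNReal.ofReal_mul (Real.exp_pos _).le, ← Real.exp_add, two_mul]
  have hsum : (∑ b ∈ s, ENNReal.ofReal (Real.exp (-(η * q b))))⁻¹ ≤
      E * (∑ b ∈ s, ENNReal.ofReal (Real.exp (-(η * q' b))))⁻¹ := by
    rw [← ENNReal.inv_le_inv, inv_inv, ENNReal.mul_inv (Or.inl hE0) (Or.inl hET), inv_inv,
      ENNReal.inv_mul_le_iff hE0 hET, Finset.mul_sum]
    exact Finset.sum_le_sum fun b _ => hw hq' b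
  rw [expMechanism_apply, expMechanism_apply, h2]
  refine (mul_le_mul' (b := E * if a ∈ s then ENNReal.ofReal (Real.exp (-(η * q' a))) else 0)
    ?_ hsum).trans (le_of_eq (by ring))
  split_ifs
  · exact hw hq a
  · exact zero_le

end Composition

/-! ### Privacy of the initialization. -/

section Init

variable {U : Type*} [MetricSpace U] [Fintype U] {L : ℕ} {β : ℝ}

theorem top_congr {score score' : Node U L → ℝ} {P : Finset (Node U L)}
    (h : ∀ v ∈ P, score v = score' v) (m : ℕ) : top score m P = top score' m P := by
  refine Finset.filter_congr fun v hv => ?_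
  rw [Finset.filter_congr fun w hw => by rw [h v hv, h w hw]]

theorem subtreeSearch_congr {N : Finset (Node U L)} {score score' : Node U L → ℝ}
    (h : ∀ v ∈ N, score v = score' v) (k : ℕ) :
    subtreeSearch N score k = subtreeSearch N score' k := by
  have h1 : searchRound N score k = searchRound N score' k := by
    funext C
    rw [searchRound, searchRound, top_congr fun v hv => h v (Finset.filter_subset _ _ hv)]
  rw [subtreeSearch, subtreeSearch, h1]

theorem hstCenters_congr (π : Orders U L) {D D' : Finset U} {ω ω' : Node U L → ℝ}
    (h : ∀ (t : Fin L) (u : U), noisyCount D ω (t, cluster β π (t + 1) u) =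
      noisyCount D' ω' (t, cluster β π (t + 1) u)) (k : ℕ) :
    hstCenters β k D π ω = hstCenters β k D' π ω' := by
  have h1 : ∀ v ∈ nodes β π,
      noisyCount D ω v * 2 ^ level v = noisyCount D' ω' v * 2 ^ level v := by
    rintro ⟨t, S⟩ hv
    obtain ⟨u, -, hu⟩ := (mem_nodes π).1 hv
    dsimp only at hu
    rw [hu, h]
  rw [hstCenters, hstCenters, subtreeSearch_congr h1]
  refine Finset.biUnion_congr rfl fun v _ => Finset.filter_congr fun u _ => ?_
  simp only [h]

/-- The change of the noise that makes up for a change of the data at the point `p`. -/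
def shift (β : ℝ) (π : Orders U L) (p : U) (r : ℝ) (v : Node U L) : ℝ :=
  if v.2 = cluster β π (v.1 + 1) p then r else 0

theorem mem_cluster_iff (π : Orders U L) (hβ : 0 ≤ β) (t : ℕ) (p u : U) :
    p ∈ cluster β π t u ↔ cluster β π t u = cluster β π t p :=
  ⟨fun h => (cluster_eq_of_mem π h).symm, fun h => h ▸ mem_cluster_self π hβ t p⟩

theorem noisyCount_insert (hβ : 0 ≤ β) (π : Orders U L) {D : Finset U} {p : U} (hp : p ∉ D)
    (ω : Node U L → ℝ) (t : Fin L) (u : U) :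
    noisyCount (insert p D) ω (t, cluster β π (t + 1) u) =
      noisyCount D (ω + shift β π p 1) (t, cluster β π (t + 1) u) := by
  simp only [noisyCount, Pi.add_apply, shift, ← mem_cluster_iff π hβ]
  split_ifs with h
  · rw [Finset.insert_inter_of_mem h, Finset.card_insert_of_notMem (by simp [hp])]
    push_cast
    ring
  · rw [Finset.insert_inter_of_notMem h, add_zero]

/-- One cluster per depth contains p, so the sum is ε (1/2 + 1/4 + … + 1 / 2^L). -/
theorem sum_shift_le (π : Orders U L) (p : U) {r ε : ℝ} (hr : |r| = 1) (hε : 0 < ε) :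
    ∑ v : Node U L, |shift β π p r v| / (2 ^ (v.1 + 1 : ℕ) / ε) ≤ ε := by
  have h1 : ∀ t : Fin L, ∑ S : Finset U, |shift β π p r (t, S)| / (2 ^ (t + 1 : ℕ) / ε) =
      ε * (1 / 2) ^ (t + 1 : ℕ) := by
    intro t
    rw [Finset.sum_eq_single (cluster β π (t + 1) p)]
    · rw [shift, if_pos rfl, hr, one_div_div, one_div_pow, div_eq_mul_one_div]
    · intro S _ hS
      rw [shift, if_neg hS, abs_zero, zero_div]
    · exact fun h => absurd (Finset.mem_univ _) h
  have h2 : ∀ m : ℕ, ∑ t ∈ Finset.range m, (1 / 2 : ℝ) ^ (t + 1) = 1 - (1 / 2) ^ m := by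
    intro m
    induction m with
    | zero => simp
    | succ m ih =>
      rw [Finset.sum_range_succ, ih]
      ring
  rw [Fintype.sum_prod_type, Finset.sum_congr rfl fun t _ => h1 t, ← Finset.mul_sum,
    Fin.sum_univ_eq_sum_range fun t => (1 / 2 : ℝ) ^ (t + 1), h2]
  have h3 : (0 : ℝ) < (1 / 2) ^ L := by positivity
  nlinarith

theorem initGivenOrders_apply_le (π : Orders U L) (k : ℕ) {ε : ℝ} (hε : 0 < ε) {D D' : Finset U}
    {p : U} {r : ℝ} (hr : |r| = 1)
    (h : ∀ (ω : Node U L → ℝ) (t : Fin L) (u : U), noisyCount D ω (t, cluster β π (t + 1) u) =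
      noisyCount D' (ω + shift β π p r) (t, cluster β π (t + 1) u)) (F : Finset U) :
    initGivenOrders β k hε D π F ≤
      ENNReal.ofReal (Real.exp ε) * initGivenOrders β k hε D' π F := by
  change noise U L ε {ω | hstCenters β k D π ω = F} ≤
    ENNReal.ofReal (Real.exp ε) * noise U L ε {ω | hstCenters β k D' π ω = F}
  have h1 : {ω | hstCenters β k D π ω = F} =
      (fun ω => ω + shift β π p r) ⁻¹' {ω | hstCenters β k D' π ω = F} := by
    ext ω
    rw [Set.mem_preimage, Set.mem_ofPred_eq, Set.mem_ofPred_eq, hstCenters_congr π (h ω)]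
  rw [h1, ← Measure.map_apply (measurable_add_const _) (measFibers_hstCenters β k D' π F)]
  refine (map_add_noise_le hε _ _).trans ?_
  rw [Measure.smul_apply, smul_eq_mul]
  gcongr
  exact sum_shift_le π p hr hε

theorem exists_insert_of_card_symmDiff {D D' : Finset U} (h : (symmDiff D D').card = 1) :
    ∃ p, (p ∉ D' ∧ D = insert p D') ∨ (p ∉ D ∧ D' = insert p D) := by
  obtain ⟨p, hp⟩ := Finset.card_eq_one.1 h
  have h1 : ∀ x, (x ∈ D ∧ x ∉ D' ∨ x ∈ D' ∧ x ∉ D) ↔ x = p := fun x => by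
    rw [← Finset.mem_symmDiff, hp, Finset.mem_singleton]
  refine ⟨p, ?_⟩
  rcases (h1 p).2 rfl with ⟨h2, h3⟩ | ⟨h2, h3⟩
  · refine Or.inl ⟨h3, Finset.ext fun x => ?_⟩
    have := h1 x
    rw [Finset.mem_insert]
    grind
  · refine Or.inr ⟨h3, Finset.ext fun x => ?_⟩
    have := h1 x
    rw [Finset.mem_insert]
    grind

/-- The random orders do not depend on the data, so the comparison can be made for fixed orders. -/
theorem dpHstInit_apply_le (hβ : 0 ≤ β) (k : ℕ) {ε : ℝ} (hε : 0 < ε) {D D' : Finset U}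
    (h : (symmDiff D D').card = 1) (F : Finset U) :
    dpHstInit L β k hε D F ≤ ENNReal.ofReal (Real.exp ε) * dpHstInit L β k hε D' F := by
  have h1 := bind_apply_le (c := 1) (p := PMF.uniformOfFintype (Orders U L))
    (p' := PMF.uniformOfFintype (Orders U L)) (f := initGivenOrders β k hε D)
    (f' := initGivenOrders β k hε D') (c' := ENNReal.ofReal (Real.exp ε))
    (fun π => by rw [one_mul]) (fun π F => ?_) F
  · rwa [one_mul] at h1
  · obtain ⟨p, ⟨hp, rfl⟩ | ⟨hp, rfl⟩⟩ := exists_insert_of_card_symmDiff h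
    · exact initGivenOrders_apply_le π k hε abs_one (noisyCount_insert hβ π hp) F
    · refine initGivenOrders_apply_le π k hε (p := p) (r := -1) (by simp) (fun ω t u => ?_) F
      rw [noisyCount_insert hβ π hp]
      congr 1
      ext v
      simp only [Pi.add_apply, shift]
      split_ifs <;> ring

end Init

/-! ### Privacy of the swaps and composition. -/

section LocalSearch

variable {U : Type*} [MetricSpace U] [Fintype U] {Δ : ℝ} {D D' : Finset U}

theorem abs_cost_sub_cost_le (hΔ0 : 0 ≤ Δ) (hΔ : ∀ u v : U, dist u v ≤ Δ)
    (h : (symmDiff D D').card = 1) (F : Finset U) : |cost F D - cost F D'| ≤ Δ := by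
  have h1 : ∀ p : U, |Metric.infDist p (F : Set U)| ≤ Δ := by
    intro p
    rw [abs_of_nonneg Metric.infDist_nonneg]
    rcases F.eq_empty_or_nonempty with rfl | ⟨f, hf⟩
    · simpa using hΔ0
    · exact (Metric.infDist_le_dist_of_mem (by exact_mod_cast hf)).trans (hΔ p f)
  obtain ⟨p, ⟨hp, rfl⟩ | ⟨hp, rfl⟩⟩ := exists_insert_of_card_symmDiff h
  · rw [cost, Finset.sum_insert hp, cost, add_sub_cancel_right]
    exact h1 p
  · rw [abs_sub_comm, cost, Finset.sum_insert hp, cost, add_sub_cancel_right]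
    exact h1 p

theorem swapStep_apply_le {η : ℝ} (hη : 0 ≤ η) (hΔ0 : 0 ≤ Δ) (hΔ : ∀ u v : U, dist u v ≤ Δ)
    (h : (symmDiff D D').card = 1) (F F' : Finset U) :
    swapStep η D F F' ≤ ENNReal.ofReal (Real.exp (2 * (η * Δ))) * swapStep η D' F F' := by
  rw [swapStep, swapStep]
  split_ifs with hne
  · exact map_apply_le (expMechanism_apply_le _ hne hη fun p => abs_cost_sub_cost_le hΔ0 hΔ h _) _ _
  · refine le_mul_of_one_le_left' ?_
    rw [ENNReal.one_le_ofReal, Real.one_le_exp_iff]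
    positivity

theorem swapSequence_apply_le {η : ℝ} (hη : 0 ≤ η) (hΔ0 : 0 ≤ Δ) (hΔ : ∀ u v : U, dist u v ≤ Δ)
    (h : (symmDiff D D').card = 1) (F : Finset U) (T : ℕ) (Fs : Fin (T + 1) → Finset U) :
    swapSequence η D F T Fs ≤
      ENNReal.ofReal (Real.exp (2 * (η * Δ))) ^ T * swapSequence η D' F T Fs := by
  induction T with
  | zero => rw [pow_zero, one_mul]; rfl
  | succ T ih =>
    rw [pow_succ]
    exact bind_apply_le ih
      (fun Gs => map_apply_le (swapStep_apply_le hη hΔ0 hΔ h _) _) Fs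

theorem isDifferentiallyPrivate_dpHstLocalSearch {L : ℕ} {β : ℝ} (hβ : 0 ≤ β)
    (hΔ : ∀ u v : U, dist u v ≤ 2 ^ L) (k T : ℕ) {ε : ℝ} (hε : 0 < ε) :
    IsDifferentiallyPrivate ε (dpHstLocalSearch (U := U) L β k T hε) := by
  intro D D' h O
  have hη : 0 ≤ swapParameter L T ε := by unfold swapParameter; positivity
  have hΔ0 : (0 : ℝ) ≤ 2 ^ L := by positivity
  -- The privacy budget: ε / 2 for the initialization and 2 ε' 2^L for each of the T + 1 exponential
  -- mechanisms, where 2 ε' 2^L (T + 1) = ε / 2.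
  have hE : ENNReal.ofReal (Real.exp ε) = ENNReal.ofReal (Real.exp (ε / 2)) *
      (ENNReal.ofReal (Real.exp (2 * (swapParameter L T ε * 2 ^ L))) ^ T *
        ENNReal.ofReal (Real.exp (2 * (swapParameter L T ε * 2 ^ L)))) := by
    rw [← pow_succ, ← ENNReal.ofReal_pow (Real.exp_pos _).le,
      ← ENNReal.ofReal_mul (Real.exp_pos _).le, ← Real.exp_nat_mul, ← Real.exp_add, swapParameter]
    congr 2
    push_cast
    field_simp
    ring
  rw [hE]
  refine toOuterMeasure_le_of_apply_le (bind_apply_le (dpHstInit_apply_le hβ k (half_pos hε) h)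
    fun F₁ => bind_apply_le (swapSequence_apply_le hη hΔ0 hΔ h F₁ T) fun Fs =>
      map_apply_le (expMechanism_apply_le _ _ hη fun j => abs_cost_sub_cost_le hΔ0 hΔ h _) _) O

end LocalSearch

end

end DPHST

theorem mainTheorem1 :
    (∀ (U : Type*) [MetricSpace U] [Fintype U] (L : ℕ), 1 ≤ L →
      IsLeast {r : ℝ | ∃ u v : U, u ≠ v ∧ dist u v = r} 1 →
      IsGreatest {r : ℝ | ∃ u v : U, dist u v = r} (2 ^ L) →
      ∀ (β : ℝ), 1 ≤ β → β < 2 →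
      ∀ (k T : ℕ), 1 ≤ k → k ≤ Fintype.card U →
      ∀ (ε : ℝ) (hε : 0 < ε),
        DPHST.IsDifferentiallyPrivate ε
          (DPHST.dpHstLocalSearch (U := U) L β k T hε)) ∧
    (∀ c : ℝ, 0 < c → ∃ A B : ℝ, 0 < A ∧ 0 < B ∧
      ∀ (U : Type*) [MetricSpace U] [Fintype U] (L : ℕ), 1 ≤ L → 3 ≤ Fintype.card U →
      IsLeast {r : ℝ | ∃ u v : U, u ≠ v ∧ dist u v = r} 1 →
      IsGreatest {r : ℝ | ∃ u v : U, dist u v = r} (2 ^ L) →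
      ∀ (β : ℝ), 1 ≤ β → β < 2 →
      ∀ (k : ℕ), 1 ≤ k → k ≤ Fintype.card U →
      ∀ (ε : ℝ) (hε : 0 < ε) (D : Finset U),
        ENNReal.ofReal (1 - (Fintype.card U : ℝ) ^ (-c)) ≤
          (DPHST.dpHstLocalSearch L β k
            ⌈A * k * Real.log (Real.log (Fintype.card U))⌉₊ hε D).toOuterMeasure
            {F | F.card = k ∧
              DPHST.cost F D ≤ 6 * DPHST.opt k D +
                B * (ε⁻¹ * k ^ 2 * 2 ^ L * Real.log (Real.log (Fintype.card U)) *
                  Real.log (Fintype.card U))}) := by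
  refine ⟨fun U _ _ L _ _ hmax β hβ _ k T _ _ ε hε =>
    DPHST.isDifferentiallyPrivate_dpHstLocalSearch (zero_le_one.trans hβ)
      (fun u v => hmax.2 ⟨u, v, rfl⟩) k T hε, fun c hc =>
    ⟨40000000, 52 * (c + 21) * 40000100, by norm_num, by positivity,
      fun U _ _ L hL hn hmin _ β hβ hβ2 k hk hkn ε hε D => ?_⟩⟩
  exact DPHST.localSearch_utility hc hn hk hkn hε D
    (DPHST.dpHstInit_card hL (zero_le_one.trans hβ) hβ2 (fun u v huv => hmin.2 ⟨u, v, huv, rfl⟩)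
      (by omega) hkn (half_pos hε) D)
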